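/- Let $k$ be an algebraically closed field (of any characteristic), let $G$ be a finite group scheme over $k$, let $d\ge 2$, and let $G$ act on $Y=\operatorname{Spec} k[[u_1,\dots,u_d]]$ over $k$. Assume that the action is faithful, that it is free outside the closed point (that is, with $U\subset Y$ the complement of the closed point, the quotient morphism $U\to U/G$ is a $G$-torsor), and that the closed point is a fixed point (its scheme-theoretic stabilizer is all of $G$). Call the action linear if it is induced by a homomorphism of $k$-group schemes $G\to \mathbf{GL}_d$ from the obvious action of $\mathbf{GL}_d$ on $k[[u_1,\dots,u_d]]$ by linear substitutions, and linearizable if it becomes linear after a change of coordinates, i.e. after a $k$-algebra automorphism of $k[[u_1,\dots,u_d]]$. Then the $G$-action on $Y$ is linearizable if and only if $G$ is linearly reductive, i.e. every finite-dimensional representation of $G$ over $k$ is semisimple. -/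

import Mathlib

open scoped TensorProduct

/-!
A finite group scheme over a field `k` is `G = Spec H`, where `H` is a commutative Hopf algebra over
`k` that is finite-dimensional as a vector space.  Its comultiplication, counit and antipode are
the multiplication, unit and inversion of `G`.
-/

namespace FinGroupScheme

universe u v w

/-! ### Representations and linear reductivity -/

/-- A (linear) representation of the group scheme `G = Spec H` on the `k`-vector space `V`:
a right comodule structure `V → V ⊗ H` (a point `g` of `G` acts by `v ↦ ∑ g(v₁) v₀`). -/
structure Rep (k : Type u) (H : Type v) (V : Type w) [Field k] [CommRing H] [HopfAlgebra k H]
    [AddCommGroup V] [Module k V] where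
  coact : V →ₗ[k] V ⊗[k] H
  counit_coact : (TensorProduct.rid k V).toLinearMap ∘ₗ
    (Coalgebra.counit (R := k) (A := H)).lTensor V ∘ₗ coact = LinearMap.id
  coassoc : (TensorProduct.assoc k V H H).toLinearMap ∘ₗ coact.rTensor H ∘ₗ coact =
    (Coalgebra.comul (R := k) (A := H)).lTensor V ∘ₗ coact

namespace Rep

variable {k : Type u} {H : Type v} {V : Type w} [Field k] [CommRing H] [HopfAlgebra k H]
  [AddCommGroup V] [Module k V]

/-- `W ⊆ V` is a subrepresentation: the coaction maps `W` into `W ⊗ H ⊆ V ⊗ H`. -/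
def IsSubrep (r : Rep k H V) (W : Submodule k V) : Prop :=
  ∀ x ∈ W, r.coact x ∈ LinearMap.range (W.subtype.rTensor H)

/-- A representation is semisimple: every subrepresentation has a complementary one. -/
def IsSemisimple (r : Rep k H V) : Prop :=
  ∀ W : Submodule k V, r.IsSubrep W → ∃ W' : Submodule k V, r.IsSubrep W' ∧ IsCompl W W'

end Rep

/-- `G = Spec H` is linearly reductive: every finite-dimensional representation is semisimple. -/
def IsLinearlyReductive (k : Type u) (H : Type v) [Field k] [CommRing H] [HopfAlgebra k H] :
    Prop :=
  ∀ (V : Type u) [AddCommGroup V] [Module k V] [Module.Finite k V] (r : Rep k H V),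
    r.IsSemisimple

/-! ### Actions on affine schemes -/

/-- A (left) action `G × Y → Y` over `k` of the group scheme `G = Spec H` on the affine scheme
`Y = Spec A`, given by its homomorphism `A → H ⊗ A` on coordinate rings.  The two laws say that the
unit of `G` acts as the identity and that `(g g') y = g (g' y)`. -/
structure Action (k : Type u) (H : Type v) (A : Type w) [Field k] [CommRing H] [HopfAlgebra k H]
    [CommRing A] [Algebra k A] where
  coact : A →ₐ[k] H ⊗[k] A
  counit_coact : (Algebra.TensorProduct.lid k A).toAlgHom.comp
    ((Algebra.TensorProduct.map (Bialgebra.counitAlgHom k H) (AlgHom.id k A)).comp coact) =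
      AlgHom.id k A
  coassoc : (Algebra.TensorProduct.assoc k k k H H A).toAlgHom.comp
    ((Algebra.TensorProduct.map (Bialgebra.comulAlgHom k H) (AlgHom.id k A)).comp coact) =
      (Algebra.TensorProduct.map (AlgHom.id k H) coact).comp coact

namespace Action

variable {k : Type u} {H : Type v} {A : Type w} [Field k] [CommRing H] [HopfAlgebra k H]
  [CommRing A] [Algebra k A]

/-- The ring of invariants `A^G = {a | coact a = 1 ⊗ a}`, so that `Y / G = Spec A^G`. -/
def invariants (δ : Action k H A) : Subalgebra k A :=
  AlgHom.equalizer δ.coact Algebra.TensorProduct.includeRight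

theorem mem_invariants (δ : Action k H A) {a : A} :
    a ∈ δ.invariants ↔ δ.coact a = 1 ⊗ₜ[k] a :=
  Iff.rfl

/-- The map `A ⊗_{A^G} A → H ⊗ A`, `a ⊗ b ↦ coact a * (1 ⊗ b)`, that corresponds to
`G × Y → Y ×_{Y/G} Y`, `(g, y) ↦ (g y, y)`. -/
noncomputable def galoisMap (δ : Action k H A) : A ⊗[δ.invariants] A →+ H ⊗[k] A :=
  TensorProduct.liftAddHom
    ((AddMonoidHom.mul.compl₂
      (Algebra.TensorProduct.includeRight : A →ₐ[k] H ⊗[k] A).toRingHom.toAddMonoidHom).comp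
        δ.coact.toRingHom.toAddMonoidHom)
    (fun r a b => by
      have hr : δ.coact (r : A) = 1 ⊗ₜ[k] (r : A) := δ.mem_invariants.mp r.2
      have h : (1 : H) ⊗ₜ[k] ((r : A) * b) = (1 ⊗ₜ[k] (r : A)) * (1 ⊗ₜ[k] b) := by simp
      change δ.coact ((r : A) * a) * (1 ⊗ₜ[k] b) = δ.coact a * (1 ⊗ₜ[k] ((r : A) * b))
      rw [map_mul, hr, h]
      ring)

theorem galoisMap_tmul (δ : Action k H A) (a b : A) :
    δ.galoisMap (a ⊗ₜ b) = δ.coact a * (1 ⊗ₜ[k] b) :=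
  rfl

/-- The action is free: the quotient morphism `Y → Y / G` is a `G`-torsor, that is, it is
faithfully flat and `G × Y → Y ×_{Y/G} Y` is an isomorphism. -/
def IsFree (δ : Action k H A) : Prop :=
  Module.FaithfullyFlat δ.invariants A ∧ Function.Bijective δ.galoisMap

/-- The action is faithful: for every `k`-algebra `T`, only one `T`-valued point of `G` acts on
`Y_T = Spec (T ⊗ A)` in a given way.  (Two points of `G` with values in a ring of any universe can
be compared over a quotient of `H ⊗ H`, so the universe of `H` is large enough for `T`.) -/
def IsFaithful (δ : Action k H A) : Prop :=
  ∀ (T : Type v) [CommRing T] [Algebra k T] (g g' : H →ₐ[k] T),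
    (Algebra.TensorProduct.map g (AlgHom.id k A)).comp δ.coact =
      (Algebra.TensorProduct.map g' (AlgHom.id k A)).comp δ.coact → g = g'

/-- The `k`-valued point `y` of `Y` is a fixed point, i.e. its stabilizer is all of `G`: the orbit
map `G → Y`, `g ↦ g y`, is the constant map with value `y`. -/
def IsFixedPoint (δ : Action k H A) (y : A →ₐ[k] k) : Prop :=
  (Algebra.TensorProduct.map (AlgHom.id k H) y).comp δ.coact =
    (Algebra.TensorProduct.includeRight : k →ₐ[k] H ⊗[k] k).comp y

/-- Naturality used to carry the unit law over to another coordinate ring. -/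
theorem counit_natural {B : Type w} [CommRing B] [Algebra k B] (g : A →ₐ[k] B) (x : H ⊗[k] A) :
    Algebra.TensorProduct.lid k B (Algebra.TensorProduct.map (Bialgebra.counitAlgHom k H)
      (AlgHom.id k B) (Algebra.TensorProduct.map (AlgHom.id k H) g x)) =
    g (Algebra.TensorProduct.lid k A (Algebra.TensorProduct.map (Bialgebra.counitAlgHom k H)
      (AlgHom.id k A) x)) := by
  induction x with
  | zero => simp
  | tmul h a => simp
  | add x y hx hy => simp only [map_add, hx, hy]

/-- Naturality used to carry the associativity law over to another coordinate ring. -/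
theorem comul_natural {B : Type w} [CommRing B] [Algebra k B] (g : A →ₐ[k] B) (x : H ⊗[k] A) :
    Algebra.TensorProduct.assoc k k k H H B (Algebra.TensorProduct.map
      (Bialgebra.comulAlgHom k H) (AlgHom.id k B)
        (Algebra.TensorProduct.map (AlgHom.id k H) g x)) =
    Algebra.TensorProduct.map (AlgHom.id k H) (Algebra.TensorProduct.map (AlgHom.id k H) g)
      (Algebra.TensorProduct.assoc k k k H H A (Algebra.TensorProduct.map
        (Bialgebra.comulAlgHom k H) (AlgHom.id k A) x)) := by
  induction x with
  | zero => simp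
  | tmul h a =>
    simp only [Algebra.TensorProduct.map_tmul, AlgHom.id_apply]
    generalize Bialgebra.comulAlgHom k H h = y
    induction y with
    | zero => simp
    | tmul p q => simp
    | add p q hp hq => simp only [TensorProduct.add_tmul, map_add, hp, hq]
  | add x y hx hy => simp only [map_add, hx, hy]

theorem counit_apply (δ : Action k H A) (a : A) :
    Algebra.TensorProduct.lid k A (Algebra.TensorProduct.map (Bialgebra.counitAlgHom k H)
      (AlgHom.id k A) (δ.coact a)) = a :=
  DFunLike.congr_fun δ.counit_coact a

theorem coassoc_apply (δ : Action k H A) (a : A) :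
    Algebra.TensorProduct.assoc k k k H H A (Algebra.TensorProduct.map
      (Bialgebra.comulAlgHom k H) (AlgHom.id k A) (δ.coact a)) =
    Algebra.TensorProduct.map (AlgHom.id k H) δ.coact (δ.coact a) :=
  DFunLike.congr_fun δ.coassoc a

/-- The coaction on the localization `A_f` at an invariant `f`. -/
noncomputable def awayCoact (δ : Action k H A) (f : A) (hf : f ∈ δ.invariants) :
    Localization.Away f →ₐ[k] H ⊗[k] Localization.Away f :=
  IsLocalization.liftAlgHom (M := Submonoid.powers f)
    (f := (Algebra.TensorProduct.map (AlgHom.id k H)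
      (IsScalarTower.toAlgHom k A (Localization.Away f))).comp δ.coact)
    (by
      rintro ⟨_, n, rfl⟩
      have hu : IsUnit (algebraMap A (Localization.Away f) f) :=
        IsLocalization.Away.algebraMap_isUnit f
      have h := hu.map (Algebra.TensorProduct.includeRight :
        Localization.Away f →ₐ[k] H ⊗[k] Localization.Away f)
      have e := δ.mem_invariants.mp hf
      simp only [map_pow]
      refine IsUnit.pow n ?_
      simpa [e] using h)

theorem awayCoact_algebraMap (δ : Action k H A) (f : A) (hf : f ∈ δ.invariants) (a : A) :
    δ.awayCoact f hf (algebraMap A (Localization.Away f) a) =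
      Algebra.TensorProduct.map (AlgHom.id k H)
        (IsScalarTower.toAlgHom k A (Localization.Away f)) (δ.coact a) := by
  simp [awayCoact]

/-- The restriction of the action to the `G`-stable open subscheme `D(f) = Spec A_f ⊆ Y`, for an
invariant function `f`. -/
noncomputable def restrict (δ : Action k H A) (f : A) (hf : f ∈ δ.invariants) :
    Action k H (Localization.Away f) where
  coact := δ.awayCoact f hf
  counit_coact := by
    refine IsLocalization.algHom_ext (Submonoid.powers f) (AlgHom.ext fun a => ?_)
    change Algebra.TensorProduct.lid k _ (Algebra.TensorProduct.map _ _
      (δ.awayCoact f hf (algebraMap A _ a))) = algebraMap A _ a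
    rw [awayCoact_algebraMap, counit_natural, counit_apply]
    rfl
  coassoc := by
    refine IsLocalization.algHom_ext (Submonoid.powers f) (AlgHom.ext fun a => ?_)
    change Algebra.TensorProduct.assoc k k k H H _ (Algebra.TensorProduct.map _ _
      (δ.awayCoact f hf (algebraMap A _ a))) =
      Algebra.TensorProduct.map _ (δ.awayCoact f hf) (δ.awayCoact f hf (algebraMap A _ a))
    rw [awayCoact_algebraMap, comul_natural, coassoc_apply]
    generalize δ.coact a = x
    induction x with
    | zero => simp
    | tmul h b => simp [awayCoact_algebraMap]
    | add x y hx hy => simp only [map_add, hx, hy]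

/-- For `Y` local and `G` finite: the action is free outside the closed point.  The open subschemes
`D(f)`, for `f` an invariant function that vanishes at the closed point, are `G`-stable, and they
cover `Y` minus the closed point (`A` is integral over `A^G`, so no other point lies over the image
of the closed point in `Y / G`).  Being a torsor is local on the quotient, so the action on the
complement of the closed point is free if and only if it is free on each `D(f)`. -/
def IsFreeOutsideClosedPoint [IsLocalRing A] (δ : Action k H A) : Prop :=
  ∀ (f : A) (hf : f ∈ δ.invariants), f ∈ IsLocalRing.maximalIdeal A → (δ.restrict f hf).IsFree

/-- Transport of an action along an isomorphism of coordinate rings. -/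
noncomputable def transport {B : Type w} [CommRing B] [Algebra k B] (δ : Action k H A)
    (φ : A ≃ₐ[k] B) : Action k H B where
  coact := (Algebra.TensorProduct.map (AlgHom.id k H) φ.toAlgHom).comp
    (δ.coact.comp φ.symm.toAlgHom)
  counit_coact := by
    refine AlgHom.ext fun b => ?_
    change Algebra.TensorProduct.lid k _ (Algebra.TensorProduct.map _ _
      (Algebra.TensorProduct.map _ φ.toAlgHom (δ.coact (φ.symm b)))) = b
    rw [counit_natural, counit_apply]
    exact φ.apply_symm_apply b
  coassoc := by
    refine AlgHom.ext fun b => ?_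
    change Algebra.TensorProduct.assoc k k k H H _ (Algebra.TensorProduct.map _ _
      (Algebra.TensorProduct.map _ φ.toAlgHom (δ.coact (φ.symm b)))) =
      Algebra.TensorProduct.map _ _
        (Algebra.TensorProduct.map _ φ.toAlgHom (δ.coact (φ.symm b)))
    rw [comul_natural, coassoc_apply]
    generalize δ.coact (φ.symm b) = x
    induction x with
    | zero => simp
    | tmul h b => simp
    | add x y hx hy => simp only [map_add, hx, hy]

end Action

/-! ### Actions on the spectrum of a power series ring -/

section PowerSeries

variable {k : Type u} {H : Type v} [Field k] [CommRing H] [HopfAlgebra k H] {d : ℕ}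

/-- A homomorphism of group schemes `G = Spec H → GL_d`: an `H`-valued point `M` of `GL_d` that is
multiplicative, `M (g g') = M (g) M (g')`. -/
def IsHomToGL (M : Matrix.GeneralLinearGroup (Fin d) H) : Prop :=
  ∀ i j, Coalgebra.comul (R := k) (M.val i j) = ∑ l, M.val i l ⊗ₜ[k] M.val l j

/-- The canonical map `H ⊗ k[[u₁, …, u_d]] → H[[u₁, …, u_d]]` (an isomorphism if `H` is
finite-dimensional). -/
noncomputable def tensorToPowerSeries (k : Type u) (H : Type v) [Field k] [CommRing H]
    [HopfAlgebra k H] (d : ℕ) :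
    H ⊗[k] MvPowerSeries (Fin d) k →ₐ[k] MvPowerSeries (Fin d) H :=
  Algebra.TensorProduct.lift (IsScalarTower.toAlgHom k H (MvPowerSeries (Fin d) H))
    (MvPowerSeries.mapAlgHom (Algebra.ofId k H)) (fun _ _ => Commute.all _ _)

namespace Action

/-- The action on `k[[u₁, …, u_d]]` is linear: for some homomorphism `M : G → GL_d`, it is the
action `f ↦ f (M · u)` that `M` induces from the obvious action of `GL_d`. -/
def IsLinear (δ : Action k H (MvPowerSeries (Fin d) k)) : Prop :=
  ∃ M : Matrix.GeneralLinearGroup (Fin d) H, IsHomToGL (k := k) M ∧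
    ∀ f : MvPowerSeries (Fin d) k, tensorToPowerSeries k H d (δ.coact f) =
      MvPowerSeries.subst
        (fun i => ∑ j, MvPowerSeries.C (M.val i j) * MvPowerSeries.X j) f

/-- The action becomes linear after some change of coordinates. -/
def IsLinearizable (δ : Action k H (MvPowerSeries (Fin d) k)) : Prop :=
  ∃ φ : MvPowerSeries (Fin d) k ≃ₐ[k] MvPowerSeries (Fin d) k, (δ.transport φ).IsLinear

/-- The closed point of `Spec k[[u₁, …, u_d]]`, as a `k`-valued point: `f ↦ f(0)`. -/
noncomputable def closedPt (k : Type u) [Field k] (d : ℕ) : MvPowerSeries (Fin d) k →ₐ[k] k where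
  toRingHom := MvPowerSeries.constantCoeff
  commutes' _ := MvPowerSeries.constantCoeff_C _

/-- A very small action: faithful, free outside the closed point, and fixing the closed point. -/
structure IsVerySmall (δ : Action k H (MvPowerSeries (Fin d) k)) : Prop where
  faithful : δ.IsFaithful
  free : δ.IsFreeOutsideClosedPoint
  fixed : δ.IsFixedPoint (closedPt k d)

end Action

end PowerSeries

end FinGroupScheme

/-! Suppose the action is linear, given by a matrix `M` of functions on `G`. Freeness outside the
origin forces the orbit map `g ↦ M(g) v` of every nonzero vector `v` to be a closed immersion: its
coordinates generate `H` (`hasFreeOrbits_of_transport`). To see this on the line through `v`, an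
invariant power series `f` is needed that vanishes at the origin but not on that line; the norm of a
suitable linear form is one. The torsor property on `D(f)` puts `h ⊗ f ^ N` into the image of `A ⊗
A` for every `h`, and comparing coefficients along the line expresses `h` through the orbit
coordinates.

Free orbits force linear reductivity (`HasFreeOrbits.isLinearlyReductive`). A tangent vector of `G`
at the unit that kills a nonzero vector is zero, and over an algebraically closed field two
independent tangent vectors would have a nontrivial combination with singular matrix; so the Lie
algebra is at most one-dimensional. With `I` the augmentation ideal, each `I ^ n / I ^ (n + 1)` is
then at most a line, and an eigenvector for `Spec (H ⧸ I ^ n)` is improved step by step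
(`exists_eigenvector_succ`). When it fails to be an eigenvector for the next neighbourhood, `Spec (H
⧸ I ^ n)` is a diagonalizable subgroup. Infinitesimal points centralize it by rigidity, so they
preserve its weight spaces, and a better eigenvector exists in one of these. For large `n` the ideal
`I ^ n` cuts out the identity component; the eigencharacter generates its coordinate ring, so the
component is diagonalizable. A rational point of order `p` in characteristic `p` would be unipotent
and fix a nonzero vector, so the order of `G(k)` is invertible (`HasFreeOrbits.card_ne_zero`).
Averaging a projection over the weight idempotents and then over `G(k)` makes it equivariant.

Conversely, let `G` be linearly reductive and fix the origin. The coordinate functions lie in a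
finite-dimensional stable subspace of the maximal ideal. Its map to the cotangent space splits
equivariantly, which gives coordinates with stable span
(`Action.IsFixedPoint.exists_stable_coordinates`). By the formal inverse function theorem they
define an automorphism of the power series ring, and in these coordinates the action is linear. -/

namespace FinGroupScheme

open WithConv

universe u v w

/-! ### Matrix coefficients -/

section Comatrix

variable {k : Type u} {H : Type v} [Field k] [CommRing H] [HopfAlgebra k H]
  {ι : Type w} [Fintype ι] [DecidableEq ι]

/-- The matrix `M` of functions on `G` is a homomorphism from `G` to the monoid of matrices. -/
structure IsComatrix (k : Type u) {H : Type v} [Field k] [CommRing H] [HopfAlgebra k H]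
    {ι : Type w} [Fintype ι] [DecidableEq ι] (M : Matrix ι ι H) : Prop where
  comul : ∀ i j, Coalgebra.comul (R := k) (M i j) = ∑ l, M i l ⊗ₜ[k] M l j
  counit : ∀ i j, Coalgebra.counit (R := k) (M i j) = (1 : Matrix ι ι k) i j

theorem IsComatrix.map_mul {M : Matrix ι ι H} (hM : IsComatrix k M) {R : Type*} [CommRing R]
    [Algebra k R] (g h : WithConv (H →ₐ[k] R)) :
    M.map (g * h).ofConv = M.map g.ofConv * M.map h.ofConv := by
  ext i j
  simp [Matrix.mul_apply, AlgHom.convMul_apply, hM.comul]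

theorem IsComatrix.map_one {M : Matrix ι ι H} (hM : IsComatrix k M) {R : Type*} [CommRing R]
    [Algebra k R] : M.map (1 : WithConv (H →ₐ[k] R)).ofConv = 1 := by
  ext i j
  simp only [Matrix.map_apply, AlgHom.convOne_apply, hM.counit, Matrix.one_apply]
  split_ifs <;> simp

/-- Points of `G` with values in `R` act on `R^ι`. -/
def IsComatrix.toMonoidHom {M : Matrix ι ι H} (hM : IsComatrix k M) (R : Type*) [CommRing R]
    [Algebra k R] : WithConv (H →ₐ[k] R) →* Matrix ι ι R where
  toFun g := M.map g.ofConv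
  map_one' := hM.map_one
  map_mul' := hM.map_mul

/-- The value of `M` at the unit is idempotent by multiplicativity and invertible, hence it is the
identity matrix. -/
theorem IsHomToGL.isComatrix {d : ℕ} {M : Matrix.GeneralLinearGroup (Fin d) H}
    (hM : IsHomToGL (k := k) M) : IsComatrix k M.val where
  comul := hM
  counit := by
    have h : M.val.map (1 : WithConv (H →ₐ[k] k)).ofConv *
        M.val.map (1 : WithConv (H →ₐ[k] k)).ofConv =
        M.val.map (1 : WithConv (H →ₐ[k] k)).ofConv := by
      ext i j
      have key := AlgHom.convMul_apply (1 : WithConv (H →ₐ[k] k)) 1 (M.val i j)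
      rw [hM i j, mul_one] at key
      simp only [map_sum, Algebra.TensorProduct.lift_tmul] at key
      simp only [Matrix.mul_apply, Matrix.map_apply]
      exact key.symm
    have hu : IsUnit (M.val.map (1 : WithConv (H →ₐ[k] k)).ofConv) :=
      M.isUnit.map ((1 : WithConv (H →ₐ[k] k)).ofConv.mapMatrix)
    have h1 := hu.mul_left_cancel (h.trans (mul_one _).symm)
    intro i j
    exact congrFun (congrFun h1 i) j

theorem comp_mul {R S : Type*} [CommRing R] [Algebra k R] [CommRing S] [Algebra k S]
    (f : R →ₐ[k] S) (g h : WithConv (H →ₐ[k] R)) :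
    toConv (f.comp (g * h).ofConv) = toConv (f.comp g.ofConv) * toConv (f.comp h.ofConv) := by
  rw [AlgHom.comp_convMul_distrib]

theorem comp_one {R S : Type*} [CommRing R] [Algebra k R] [CommRing S] [Algebra k S]
    (f : R →ₐ[k] S) :
    toConv (f.comp (1 : WithConv (H →ₐ[k] R)).ofConv) = 1 := by
  ext x
  simp

/-- Points of `G` are functorial in the ring of values. -/
def pointsMap {R S : Type*} [CommRing R] [Algebra k R] [CommRing S] [Algebra k S]
    (f : R →ₐ[k] S) : WithConv (H →ₐ[k] R) →* WithConv (H →ₐ[k] S) where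
  toFun g := toConv (f.comp g.ofConv)
  map_one' := comp_one f
  map_mul' := comp_mul f

theorem pointsMap_apply {R S : Type*} [CommRing R] [Algebra k R] [CommRing S] [Algebra k S]
    (f : R →ₐ[k] S) (g : WithConv (H →ₐ[k] R)) (x : H) :
    (pointsMap f g).ofConv x = f (g.ofConv x) := rfl

/-- The inverse of a point of `G`. -/
noncomputable def pointInv {R : Type*} [CommRing R] [Algebra k R] (g : WithConv (H →ₐ[k] R)) :
    WithConv (H →ₐ[k] R) :=
  toConv (g.ofConv.comp (HopfAlgebra.antipodeAlgHom k H))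

theorem pointInv_mul {R : Type*} [CommRing R] [Algebra k R] (g : WithConv (H →ₐ[k] R)) :
    pointInv g * g = 1 := by
  have h := comp_mul g.ofConv (toConv (HopfAlgebra.antipodeAlgHom k H)) (toConv (AlgHom.id k H))
  rw [AlgHom.antipode_id_cancel, comp_one] at h
  exact h.symm

/-- In a monoid in which every element has a left inverse, left inverses are two-sided. -/
theorem mul_pointInv {R : Type*} [CommRing R] [Algebra k R] (g : WithConv (H →ₐ[k] R)) :
    g * pointInv g = 1 := by
  have h : pointInv (pointInv g) = g :=
    (mul_one _).symm.trans (by rw [← pointInv_mul g, ← mul_assoc, pointInv_mul, one_mul])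
  simpa only [h] using pointInv_mul (pointInv g)

end Comatrix

/-! ### The augmentation ideal -/

section Augmentation

variable (k : Type u) (H : Type v) [Field k] [CommRing H] [HopfAlgebra k H]

/-- The ideal of the unit section of `G = Spec H`. -/
def augIdeal : Ideal H := RingHom.ker (Bialgebra.counitAlgHom k H)

variable {k H}

theorem mem_augIdeal {x : H} : x ∈ augIdeal k H ↔ Coalgebra.counit (R := k) x = 0 := Iff.rfl

theorem sub_counit_mem_augIdeal (x : H) :
    x - algebraMap k H (Coalgebra.counit (R := k) x) ∈ augIdeal k H := by
  simp [mem_augIdeal]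

/-- A point of `G` is congruent to the unit modulo `𝔞` iff it maps the augmentation ideal
to `𝔞`. -/
theorem pointsMap_mk_eq_one_iff {R : Type w} [CommRing R] [Algebra k R] (𝔞 : Ideal R)
    (g : WithConv (H →ₐ[k] R)) :
    pointsMap (Ideal.Quotient.mkₐ k 𝔞) g = 1 ↔ ∀ x ∈ augIdeal k H, g.ofConv x ∈ 𝔞 := by
  constructor
  · intro h x hx
    have h1 : (pointsMap (Ideal.Quotient.mkₐ k 𝔞) g).ofConv x = 0 := by
      rw [h, AlgHom.convOne_apply, mem_augIdeal.1 hx, map_zero]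
    exact Ideal.Quotient.eq_zero_iff_mem.1 h1
  · intro h
    ext x
    have h1 := Ideal.Quotient.eq_zero_iff_mem.2 (h _ (sub_counit_mem_augIdeal x))
    rw [map_sub, map_sub, sub_eq_zero, AlgHom.commutes] at h1
    exact h1

/-- The points congruent to the unit modulo `𝔞` are the kernel of reduction, hence closed under
products; `conj_apply_mem` is the normality of this kernel. -/
theorem mul_apply_mem {R : Type w} [CommRing R] [Algebra k R] {𝔞 : Ideal R}
    {g h : WithConv (H →ₐ[k] R)} (hg : ∀ x ∈ augIdeal k H, g.ofConv x ∈ 𝔞)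
    (hh : ∀ x ∈ augIdeal k H, h.ofConv x ∈ 𝔞) :
    ∀ x ∈ augIdeal k H, (g * h).ofConv x ∈ 𝔞 := by
  rw [← pointsMap_mk_eq_one_iff] at *
  rw [map_mul, hg, hh, one_mul]

theorem conj_apply_mem {R : Type w} [CommRing R] [Algebra k R] {𝔞 : Ideal R}
    (g : WithConv (H →ₐ[k] R)) {h : WithConv (H →ₐ[k] R)}
    (hh : ∀ x ∈ augIdeal k H, h.ofConv x ∈ 𝔞) :
    ∀ x ∈ augIdeal k H, (g * h * pointInv g).ofConv x ∈ 𝔞 := by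
  rw [← pointsMap_mk_eq_one_iff] at *
  rw [map_mul, map_mul, hh, mul_one, ← map_mul, mul_pointInv, map_one]

/-- A linear functional that kills `1` and the square of the augmentation ideal is a point
derivation at the unit section; it is determined by its values on generators. -/
theorem eq_zero_of_adjoin_eq_top {s : Set H} (hs : Algebra.adjoin k s = ⊤) (y : H →ₗ[k] k)
    (h1 : y 1 = 0) (h2 : ∀ a ∈ augIdeal k H ^ 2, y a = 0) (hy : ∀ a ∈ s, y a = 0) : y = 0 := by
  ext a
  have ha : a ∈ Algebra.adjoin k s := by rw [hs]; trivial
  induction ha using Algebra.adjoin_induction with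
  | mem x hx => exact hy x hx
  | algebraMap r => simp [Algebra.algebraMap_eq_smul_one, h1]
  | add a b _ _ ha hb => rw [map_add, ha, hb]; simp
  | mul a b _ _ ha hb =>
    have h := h2 _ (by
      rw [pow_two]
      exact Ideal.mul_mem_mul (sub_counit_mem_augIdeal (k := k) a)
        (sub_counit_mem_augIdeal (k := k) b))
    simp only [Algebra.algebraMap_eq_smul_one, sub_mul, mul_sub, map_sub, smul_mul_assoc,
      mul_smul_comm, one_mul, mul_one, map_smul, ha, hb, h1, LinearMap.zero_apply] at h ⊢
    simpa using h

end Augmentation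

/-! ### Free orbits and the tangent space at the unit -/

section Orbit

variable {k : Type u} {H : Type v} [Field k] [CommRing H] [HopfAlgebra k H]
  {ι : Type w} [Fintype ι]

/-- The orbit map `g ↦ M(g) v` of a vector. -/
def orbit (M : Matrix ι ι H) (v : ι → k) (i : ι) : H := ∑ j, v j • M i j

/-- The orbit maps of all nonzero vectors are closed immersions of `G`. -/
def HasFreeOrbits (k : Type u) {H : Type v} [Field k] [CommRing H] [HopfAlgebra k H]
    {ι : Type w} [Fintype ι] (M : Matrix ι ι H) : Prop :=
  ∀ v : ι → k, v ≠ 0 → Algebra.adjoin k (Set.range (orbit M v)) = ⊤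

theorem map_orbit {R : Type*} [AddCommMonoid R] [Module k R] (M : Matrix ι ι H) (v : ι → k)
    (f : H →ₗ[k] R) (i : ι) : f (orbit M v i) = ∑ j, v j • f (M i j) := by
  simp [orbit]

theorem map_orbit_eq_mulVec (M : Matrix ι ι H) (v : ι → k)
    (f : H →ₗ[k] k) (i : ι) : f (orbit M v i) = (M.map f).mulVec v i := by
  simp [map_orbit, Matrix.mulVec, dotProduct, mul_comm]

variable [DecidableEq ι]

theorem IsComatrix.counit_orbit {M : Matrix ι ι H} (hM : IsComatrix k M) (v : ι → k) (i : ι) :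
    Coalgebra.counit (R := k) (orbit M v i) = v i := by
  have : M.map (Coalgebra.counit (R := k) (A := H)) = 1 := by ext i j; exact hM.counit i j
  rw [map_orbit_eq_mulVec, this, Matrix.one_mulVec]

theorem IsComatrix.comul_orbit {M : Matrix ι ι H} (hM : IsComatrix k M) (v : ι → k) (i : ι) :
    Coalgebra.comul (R := k) (orbit M v i) = ∑ l, M i l ⊗ₜ[k] orbit M v l := by
  simp only [orbit, map_sum, map_smul, hM.comul, Finset.smul_sum, TensorProduct.tmul_sum,
    TensorProduct.tmul_smul]
  rw [Finset.sum_comm]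

/-- If orbits are free, then the Lie algebra of `G` is at most one-dimensional. -/
theorem HasFreeOrbits.exists_augIdeal_le [IsAlgClosed k] [Nonempty ι] {M : Matrix ι ι H}
    (hF : HasFreeOrbits k M) :
    ∃ t ∈ augIdeal k H, augIdeal k H ≤ Ideal.span {t} ⊔ augIdeal k H ^ 2 := by
  -- The étale case: the cotangent space at the unit is zero and `t = 0` will do.
  by_cases hI : augIdeal k H ≤ augIdeal k H ^ 2
  · exact ⟨0, zero_mem _, hI.trans le_sup_right⟩
  obtain ⟨t, ht, ht2⟩ := SetLike.not_le_iff_exists.1 hI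
  refine ⟨t, ht, ?_⟩
  by_contra hcon
  obtain ⟨s, hs, hs2⟩ := SetLike.not_le_iff_exists.1 hcon
  let I2 : Submodule k H := (augIdeal k H ^ 2).restrictScalars k
  have hI2 : ∀ a ∈ I2, Coalgebra.counit (R := k) a = 0 := fun a ha =>
    mem_augIdeal.1 (Ideal.pow_le_self two_ne_zero ha)
  -- The functionals sought must also kill `1`. Adjoining the constants to a subspace of the
  -- augmentation ideal captures no new element of that ideal.
  have hmem : ∀ (N : Submodule k H) (a : H), (∀ b ∈ N, Coalgebra.counit (R := k) b = 0) →
      a ∈ augIdeal k H → a ∈ Submodule.span k {1} ⊔ N → a ∈ N := by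
    intro N a hN ha h
    obtain ⟨b, hb, c, hc, rfl⟩ := Submodule.mem_sup.1 h
    obtain ⟨r, rfl⟩ := Submodule.mem_span_singleton.1 hb
    have := mem_augIdeal.1 ha
    rw [map_add, hN c hc, map_smul, Bialgebra.counit_one] at this
    have hr : r = 0 := by simpa using this
    simpa [hr] using hc
  have ht3 : t ∉ Submodule.span k {1} ⊔ I2 := fun h => ht2 (hmem I2 t hI2 ht h)
  have hs3 : s ∉ Submodule.span k {1} ⊔ (Submodule.span k {t} ⊔ I2) := by
    intro h
    have h4 := hmem _ s (by
      intro b hb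
      obtain ⟨p, hp, c, hc, rfl⟩ := Submodule.mem_sup.1 hb
      obtain ⟨r, rfl⟩ := Submodule.mem_span_singleton.1 hp
      rw [map_add, hI2 c hc, map_smul, mem_augIdeal.1 ht]; simp) hs h
    obtain ⟨p, hp, c, hc, rfl⟩ := Submodule.mem_sup.1 h4
    obtain ⟨r, rfl⟩ := Submodule.mem_span_singleton.1 hp
    refine hs2 (add_mem ?_ (Submodule.mem_sup_right hc))
    rw [Algebra.smul_def]
    exact Submodule.mem_sup_left (Ideal.mul_mem_left _ _ (Ideal.mem_span_singleton_self t))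
  -- Two independent tangent vectors at the unit: `y t ≠ 0`, while `z t = 0` and `z s ≠ 0`.
  obtain ⟨y, hyt, hy⟩ := Submodule.exists_le_ker_of_notMem ht3
  obtain ⟨z, hzs, hz⟩ := Submodule.exists_le_ker_of_notMem hs3
  have hy1 : y 1 = 0 :=
    hy (Submodule.mem_sup_left (Submodule.mem_span_singleton_self 1))
  have hz1 : z 1 = 0 :=
    hz (Submodule.mem_sup_left (Submodule.mem_span_singleton_self 1))
  have hzt : z t = 0 := hz (Submodule.mem_sup_right
    (Submodule.mem_sup_left (Submodule.mem_span_singleton_self t)))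
  have hy2 : ∀ a ∈ augIdeal k H ^ 2, y a = 0 := fun a ha => hy (Submodule.mem_sup_right ha)
  have hz2 : ∀ a ∈ augIdeal k H ^ 2, z a = 0 :=
    fun a ha => hz (Submodule.mem_sup_right (Submodule.mem_sup_right ha))
  have key : ∀ x : H →ₗ[k] k, x 1 = 0 → (∀ a ∈ augIdeal k H ^ 2, x a = 0) →
      ∀ v : ι → k, v ≠ 0 → (M.map x).mulVec v = 0 → x = 0 := by
    intro x h1 h2 v hv hx
    refine eq_zero_of_adjoin_eq_top (hF v hv) x h1 h2 ?_
    rintro _ ⟨i, rfl⟩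
    rw [map_orbit_eq_mulVec, hx, Pi.zero_apply]
  have hdet : IsUnit (M.map y).det := by
    rw [isUnit_iff_ne_zero]
    intro h
    obtain ⟨v, hv, hv0⟩ := Matrix.exists_mulVec_eq_zero_iff.2 h
    exact hyt (by rw [key y hy1 hy2 v hv hv0]; rfl)
  -- An eigenvector of `M(y)⁻¹ M(z)` with eigenvalue `c` is killed by the matrix of `z - c • y`, so
  -- this tangent vector must vanish.
  obtain ⟨c, hc⟩ := Module.End.exists_eigenvalue (Matrix.toLin' ((M.map y)⁻¹ * M.map z))
  obtain ⟨v, hv⟩ := hc.exists_hasEigenvector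
  have hv1 : (M.map z).mulVec v = c • (M.map y).mulVec v := by
    have h := hv.apply_eq_smul
    rw [Matrix.toLin'_apply] at h
    have h' := congrArg (M.map y).mulVec h
    rwa [Matrix.mulVec_mulVec, ← mul_assoc, Matrix.mul_nonsing_inv _ hdet, one_mul,
      Matrix.mulVec_smul] at h'
  have hzy : z - c • y = 0 := by
    refine key _ (by simp [hy1, hz1]) (fun a ha => by simp [hy2 a ha, hz2 a ha]) v hv.2 ?_
    have : M.map (z - c • y) = M.map z - c • M.map y := by ext; simp
    rw [this, Matrix.sub_mulVec, Matrix.smul_mulVec, hv1, sub_self]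
  have hc0 : c = 0 := by
    have := LinearMap.congr_fun hzy t
    simpa [hzt, hyt] using this
  have := LinearMap.congr_fun hzy s
  exact hzs (by simpa [hc0] using this)

/-- Multiply the inclusion for `n` with the one for the augmentation ideal itself; all cross terms
have degree at least `n + 2`. -/
theorem augIdeal_pow_le {t : H} (ht : t ∈ augIdeal k H)
    (h : augIdeal k H ≤ Ideal.span {t} ⊔ augIdeal k H ^ 2) (n : ℕ) :
    augIdeal k H ^ n ≤ Ideal.span {t ^ n} ⊔ augIdeal k H ^ (n + 1) := by
  induction n with
  | zero => simp
  | succ n ih =>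
    have htI : Ideal.span {t} ≤ augIdeal k H := by simpa using ht
    calc augIdeal k H ^ (n + 1) = augIdeal k H ^ n * augIdeal k H := pow_succ _ _
      _ ≤ (Ideal.span {t ^ n} ⊔ augIdeal k H ^ (n + 1)) *
          (Ideal.span {t} ⊔ augIdeal k H ^ 2) := Ideal.mul_mono ih h
      _ ≤ _ := by
        rw [Ideal.sup_mul, Ideal.mul_sup, Ideal.mul_sup, Ideal.span_singleton_mul_span_singleton,
          ← pow_succ]
        refine sup_le (sup_le le_sup_left (le_sup_of_le_right ?_))
          (le_sup_of_le_right (sup_le ?_ ?_))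
        · calc Ideal.span {t ^ n} * augIdeal k H ^ 2
              ≤ augIdeal k H ^ n * augIdeal k H ^ 2 := by
                refine Ideal.mul_mono_left ?_
                rw [Ideal.span_singleton_le_iff_mem]
                exact Ideal.pow_mem_pow ht n
            _ = _ := by rw [← pow_add]
        · calc augIdeal k H ^ (n + 1) * Ideal.span {t}
              ≤ augIdeal k H ^ (n + 1) * augIdeal k H := Ideal.mul_mono_right htI
            _ = _ := by rw [← pow_succ]
        · rw [← pow_add]
          exact Ideal.pow_le_pow_right (by omega)

/-- Each graded piece is spanned over `k` by the class of `t ^ n`: a coefficient in `H` may be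
replaced by its value at the unit. -/
theorem exists_sub_smul_pow_mem {t : H} (ht : t ∈ augIdeal k H)
    (h : augIdeal k H ≤ Ideal.span {t} ⊔ augIdeal k H ^ 2) (n : ℕ) {a : H}
    (ha : a ∈ augIdeal k H ^ n) : ∃ c : k, a - c • t ^ n ∈ augIdeal k H ^ (n + 1) := by
  obtain ⟨p, hp, q, hq, rfl⟩ := Submodule.mem_sup.1 (augIdeal_pow_le ht h n ha)
  obtain ⟨r, rfl⟩ := Ideal.mem_span_singleton'.1 hp
  refine ⟨Coalgebra.counit r, ?_⟩
  have h1 : (r - algebraMap k H (Coalgebra.counit r)) * t ^ n ∈ augIdeal k H ^ (n + 1) := by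
    rw [pow_succ']
    exact Ideal.mul_mem_mul (sub_counit_mem_augIdeal r) (Ideal.pow_mem_pow ht n)
  have : r * t ^ n + q - Coalgebra.counit (R := k) r • t ^ n =
      (r - algebraMap k H (Coalgebra.counit r)) * t ^ n + q := by
    rw [Algebra.smul_def]; ring
  rw [this]
  exact add_mem h1 hq

end Orbit

/-! ### Quotients of the Hopf algebra generated by a group-like element -/

section GroupLike

variable {k : Type u} {H : Type v} [Field k] [CommRing H] [HopfAlgebra k H]
  {ι : Type w} [Fintype ι]

/-- The comultiplication, with values reduced modulo the ideal `L`. -/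
noncomputable def redComul (k : Type u) {H : Type v} [Field k] [CommRing H] [HopfAlgebra k H]
    (L : Ideal H) : H →ₐ[k] (H ⧸ L) ⊗[k] (H ⧸ L) :=
  (Algebra.TensorProduct.map (Ideal.Quotient.mkₐ k L) (Ideal.Quotient.mkₐ k L)).comp
    (Bialgebra.comulAlgHom k H)

theorem redComul_apply (L : Ideal H) (x : H) :
    redComul k L x = TensorProduct.map (Ideal.Quotient.mkₐ k L).toLinearMap
      (Ideal.Quotient.mkₐ k L).toLinearMap (Coalgebra.comul (R := k) x) := rfl

/-- This views `redComul` as the product of the two tautological points of `Spec (H ⧸ L)`, so that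
statements about products of points apply to it. -/
theorem redComul_eq_mul (L : Ideal H) :
    toConv (redComul k L) =
      toConv (Algebra.TensorProduct.includeLeft.comp (Ideal.Quotient.mkₐ k L)) *
      toConv (Algebra.TensorProduct.includeRight.comp (Ideal.Quotient.mkₐ k L)) := by
  ext x
  rw [AlgHom.convMul_apply]
  have h : Algebra.TensorProduct.map (Ideal.Quotient.mkₐ k L) (Ideal.Quotient.mkₐ k L) =
      Algebra.TensorProduct.lift
        (Algebra.TensorProduct.includeLeft.comp (Ideal.Quotient.mkₐ k L))
        (Algebra.TensorProduct.includeRight.comp (Ideal.Quotient.mkₐ k L))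
        (fun _ _ => Commute.all _ _) := by
    ext <;> simp
  exact DFunLike.congr_fun h _

/-- The comultiplication maps high powers of the augmentation ideal to zero in the tensor square
of a quotient by a smaller power. -/
theorem redComul_augIdeal_pow_eq_zero {n m : ℕ} (hm : 2 * n ≤ m) {x : H}
    (hx : x ∈ augIdeal k H ^ m) : redComul k (augIdeal k H ^ n) x = 0 := by
  set I := augIdeal k H
  set π := Ideal.Quotient.mkₐ k (I ^ n)
  let j₁ : H →ₐ[k] (H ⧸ I ^ n) ⊗[k] (H ⧸ I ^ n) := Algebra.TensorProduct.includeLeft.comp π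
  let j₂ : H →ₐ[k] (H ⧸ I ^ n) ⊗[k] (H ⧸ I ^ n) := Algebra.TensorProduct.includeRight.comp π
  let 𝔟 : Ideal ((H ⧸ I ^ n) ⊗[k] (H ⧸ I ^ n)) := I.map j₁ ⊔ I.map j₂
  have h1 : ∀ x ∈ I, redComul k (I ^ n) x ∈ 𝔟 := by
    have h := mul_apply_mem (𝔞 := 𝔟) (g := toConv j₁) (h := toConv j₂)
      (fun x hx => Ideal.mem_sup_left (Ideal.mem_map_of_mem _ hx))
      (fun x hx => Ideal.mem_sup_right (Ideal.mem_map_of_mem _ hx))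
    rwa [← redComul_eq_mul] at h
  -- Each of the two summands of `𝔟` has vanishing `n`-th power, so every product of `2 * n` factors
  -- vanishes.
  have h2 : 𝔟 ^ (n + n) = ⊥ := by
    refine le_bot_iff.1 (Ideal.sup_pow_add_le_pow_sup_pow.trans ?_)
    rw [← Ideal.map_pow, ← Ideal.map_pow, sup_le_iff, Ideal.map_le_iff_le_comap,
      Ideal.map_le_iff_le_comap]
    constructor
    · intro y hy
      have : π y = 0 := Ideal.Quotient.eq_zero_iff_mem.2 hy
      simp [j₁, this]
    · intro y hy
      have : π y = 0 := Ideal.Quotient.eq_zero_iff_mem.2 hy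
      simp [j₂, this]
  have h3 : (I ^ (n + n)).map (redComul k (I ^ n)) ≤ ⊥ := by
    rw [Ideal.map_pow, ← h2]
    exact Ideal.pow_right_mono (Ideal.map_le_iff_le_comap.2 h1) _
  have h4 : x ∈ I ^ (n + n) := Ideal.pow_le_pow_right (by omega) hx
  exact (Submodule.mem_bot _).1 (h3 (Ideal.mem_map_of_mem _ h4))

/-- An eigenvector modulo `L` satisfies `g (g' v) = χ(g) χ(g') v` for points `g`, `g'` of `Spec (H ⧸
L)`. The ideal `L` need not define a subgroup. -/
theorem redComul_orbit [DecidableEq ι] {M : Matrix ι ι H} (hM : IsComatrix k M) {L : Ideal H} {v : ι → k}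
    {χ : H} (hv : ∀ i, orbit M v i - v i • χ ∈ L) (i : ι) :
    redComul k L (orbit M v i) =
      v i • (Ideal.Quotient.mkₐ k L χ ⊗ₜ[k] Ideal.Quotient.mkₐ k L χ) := by
  set π := Ideal.Quotient.mkₐ k L with hπ
  have hv' : ∀ i, π (orbit M v i) = v i • π χ := by
    intro i
    rw [← map_smul, ← sub_eq_zero, ← map_sub]
    exact Ideal.Quotient.eq_zero_iff_mem.2 (hv i)
  rw [redComul_apply, hM.comul_orbit, map_sum]
  simp only [TensorProduct.map_tmul, AlgHom.toLinearMap_apply]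
  rw [← hπ]
  simp only [hv']
  rw [TensorProduct.smul_tmul', ← hv' i, orbit, map_sum, TensorProduct.sum_tmul]
  refine Finset.sum_congr rfl fun l _ => ?_
  rw [TensorProduct.tmul_smul, map_smul, TensorProduct.smul_tmul']

/-- Coordinate functions on `H` with respect to a basis of the quotient `H ⧸ L`. -/
noncomputable def coordConv {L : Ideal H} {r : ℕ} (b : Module.Basis (Fin r) k (H ⧸ L))
    (l : Fin r) : WithConv (H →ₗ[k] k) :=
  toConv (b.coord l ∘ₗ (Ideal.Quotient.mkₐ k L).toLinearMap)

theorem coordConv_apply {L : Ideal H} {r : ℕ} (b : Module.Basis (Fin r) k (H ⧸ L))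
    (l : Fin r) (x : H) : (coordConv b l).ofConv x = b.coord l (Ideal.Quotient.mkₐ k L x) := rfl

theorem exists_basis_pow_of_adjoin_eq_top {C : Type*} [CommRing C] [Algebra k C]
    [Module.Finite k C] {x : C} (hx : Algebra.adjoin k {x} = ⊤) :
    ∃ (r : ℕ) (b : Module.Basis (Fin r) k C), ∀ l : Fin r, b l = x ^ (l : ℕ) := by
  have hint : IsIntegral k x := Algebra.IsIntegral.isIntegral _
  refine ⟨_, (PowerBasis.ofAdjoinEqTop hint hx).basis, fun l => ?_⟩
  rw [PowerBasis.basis_eq_pow, PowerBasis.ofAdjoinEqTop_gen hint hx]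

/-- Modulo `L` the orbit coordinates of an eigenvector are scalar multiples of `χ`. Since they
generate `H`, the class of `χ` alone generates `H ⧸ L`. -/
theorem exists_basis_pow [Module.Finite k H] [Nonempty ι] {M : Matrix ι ι H}
    (hF : HasFreeOrbits k M) {L : Ideal H} {v : ι → k} (hv0 : v ≠ 0) {χ : H}
    (hv : ∀ i, orbit M v i - v i • χ ∈ L) :
    ∃ (r : ℕ) (b : Module.Basis (Fin r) k (H ⧸ L)),
      ∀ l : Fin r, b l = Ideal.Quotient.mkₐ k L χ ^ (l : ℕ) := by
  set π := Ideal.Quotient.mkₐ k L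
  have htop : Algebra.adjoin k {π χ} = ⊤ := by
    have h1 : (Algebra.adjoin k (Set.range (orbit M v))).map π = ⊤ := by
      rw [hF v hv0, Algebra.map_top, AlgHom.range_eq_top]
      exact Ideal.Quotient.mkₐ_surjective k L
    rw [eq_top_iff, ← h1, AlgHom.map_adjoin, Algebra.adjoin_le_iff]
    rintro _ ⟨_, ⟨i, rfl⟩, rfl⟩
    have : π (orbit M v i) = v i • π χ := by
      rw [← map_smul, ← sub_eq_zero, ← map_sub]
      exact Ideal.Quotient.eq_zero_iff_mem.2 (hv i)
    rw [this]
    exact Subalgebra.smul_mem _ (Algebra.self_mem_adjoin_singleton k (π χ)) _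
  exact exists_basis_pow_of_adjoin_eq_top htop

variable {L : Ideal H} {χ : H} {r : ℕ} {b : Module.Basis (Fin r) k (H ⧸ L)}

theorem mk_eq_sum_coordConv
    (hb : ∀ l : Fin r, b l = Ideal.Quotient.mkₐ k L χ ^ (l : ℕ)) (x : H) :
    Ideal.Quotient.mkₐ k L x =
      ∑ l, (coordConv b l).ofConv x • Ideal.Quotient.mkₐ k L χ ^ (l : ℕ) := by
  conv_lhs => rw [← b.sum_repr (Ideal.Quotient.mkₐ k L x)]
  refine Finset.sum_congr rfl fun l _ => ?_
  rw [hb]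
  rfl

/-- If `H ⧸ L` is spanned by the powers of a group-like element, then the coordinate functions are
orthogonal idempotents in the dual algebra. -/
theorem coordConv_mul_coordConv
    (hb : ∀ l : Fin r, b l = Ideal.Quotient.mkₐ k L χ ^ (l : ℕ))
    (hL : ∀ x ∈ L, redComul k L x = 0)
    (hχ : redComul k L χ = Ideal.Quotient.mkₐ k L χ ⊗ₜ[k] Ideal.Quotient.mkₐ k L χ)
    (l m : Fin r) :
    coordConv b l * coordConv b m = if l = m then coordConv b l else 0 := by
  set π := Ideal.Quotient.mkₐ k L
  let F : (H ⧸ L) ⊗[k] (H ⧸ L) →ₗ[k] k :=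
    LinearMap.mul' k k ∘ₗ TensorProduct.map (b.coord l) (b.coord m)
  have h1 : ∀ x, (coordConv b l * coordConv b m).ofConv x = F (redComul k L x) := by
    intro x
    have : F ∘ₗ (TensorProduct.map π.toLinearMap π.toLinearMap) =
        LinearMap.mul' k k ∘ₗ TensorProduct.map (coordConv b l).ofConv (coordConv b m).ofConv := by
      ext; rfl
    rw [redComul_apply]
    exact (LinearMap.congr_fun this _).symm
  -- In the basis of powers of the group-like class, comultiplication is diagonal, which is dual to
  -- a product of copies of `k`.
  have h2 : ∀ x, redComul k L x =
      ∑ j, (coordConv b j).ofConv x • (((π χ) ^ (j : ℕ)) ⊗ₜ[k] ((π χ) ^ (j : ℕ))) := by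
    intro x
    have hx : x - ∑ j, (coordConv b j).ofConv x • χ ^ (j : ℕ) ∈ L := by
      rw [← Ideal.Quotient.eq_zero_iff_mem]
      change π _ = 0
      rw [map_sub, map_sum, sub_eq_zero, mk_eq_sum_coordConv hb x]
      simp only [map_smul, map_pow]
      rfl
    have := hL _ hx
    rw [map_sub, sub_eq_zero] at this
    rw [this, map_sum]
    simp only [map_smul, map_pow, hχ, Algebra.TensorProduct.tmul_pow]
  apply WithConv.ofConv_injective
  ext x
  rw [h1, h2, map_sum]
  have h3 : ∀ j : Fin r, F (((π χ) ^ (j : ℕ)) ⊗ₜ[k] ((π χ) ^ (j : ℕ))) =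
      if l = m ∧ j = l then 1 else 0 := by
    intro j
    rw [← hb]
    simp only [F, LinearMap.comp_apply, TensorProduct.map_tmul, LinearMap.mul'_apply,
      Module.Basis.coord_apply, Module.Basis.repr_self, Finsupp.single_apply]
    split_ifs <;> simp_all
  simp only [map_smul, h3]
  split_ifs with h
  · subst h; simp
  · simp [h]

theorem sum_coordConv (hb : ∀ l : Fin r, b l = Ideal.Quotient.mkₐ k L χ ^ (l : ℕ))
    (hLI : L ≤ augIdeal k H) (hχ : Coalgebra.counit (R := k) χ = 1) :
    ∑ l, coordConv b l = 1 := by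
  ext x
  have hx : x - ∑ j, (coordConv b j).ofConv x • χ ^ (j : ℕ) ∈ L := by
    rw [← Ideal.Quotient.eq_zero_iff_mem]
    change Ideal.Quotient.mkₐ k L _ = 0
    rw [map_sub, map_sum, sub_eq_zero, mk_eq_sum_coordConv hb x]
    simp only [map_smul, map_pow]
  have h := mem_augIdeal.1 (hLI hx)
  rw [map_sub, map_sum, sub_eq_zero] at h
  simp only [map_smul, Bialgebra.counit_pow, hχ, one_pow, smul_eq_mul, mul_one] at h
  simp [h]

end GroupLike

/-! ### Rigidity of diagonalizable subgroups -/

section Centralize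

/-- A matrix that is the cube of itself and congruent to zero modulo a nilpotent ideal is zero. -/
theorem matrix_eq_zero_of_pow_three {ι : Type*} [Fintype ι] {R : Type*} [CommRing R] {J : Ideal R} {n : ℕ}
    (hJ : J ^ n = ⊥) {D : Matrix ι ι R} (hD : D * D * D = D) (h : ∀ i j, D i j ∈ J) : D = 0 := by
  have key : ∀ m : ℕ, ∀ i j, D i j ∈ J ^ m := by
    intro m
    induction m with
    | zero => simp
    | succ m ih =>
      intro i j
      rw [← hD, Matrix.mul_apply, pow_succ]
      refine Ideal.sum_mem _ fun l _ => Ideal.mul_mem_mul ?_ (h l j)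
      rw [Matrix.mul_apply]
      exact Ideal.sum_mem _ fun q _ => Ideal.mul_mem_right _ _ (ih i q)
  ext i j
  have := key n i j
  rwa [hJ] at this

variable {k : Type u} {H : Type v} [Field k] [CommRing H] [HopfAlgebra k H]
  {ι : Type w} [Fintype ι] [DecidableEq ι]

theorem IsComatrix.map_mul_linear {M : Matrix ι ι H} (hM : IsComatrix k M)
    (x y : WithConv (H →ₗ[k] k)) :
    M.map (x * y).ofConv = M.map x.ofConv * M.map y.ofConv := by
  ext i j
  simp [Matrix.mul_apply, LinearMap.convMul_apply, hM.comul]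

variable {L : Ideal H} {χ : H} {r : ℕ} {b : Module.Basis (Fin r) k (H ⧸ L)}

/-- A point of the diagonalizable subgroup `Spec (H ⧸ L)` commutes with its weight projections. -/
theorem commute_weight {M : Matrix ι ι H} (hM : IsComatrix k M)
    (hb : ∀ l : Fin r, b l = Ideal.Quotient.mkₐ k L χ ^ (l : ℕ))
    (horth : ∀ l m, coordConv b l * coordConv b m = if l = m then coordConv b l else 0)
    {R : Type*} [CommRing R] [Algebra k R] (f : H →ₐ[k] R) (hf : ∀ x ∈ L, f x = 0) (m : Fin r) :
    Commute (M.map f) ((M.map (coordConv b m).ofConv).map (algebraMap k R)) := by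
  have hfx : ∀ x, f x = ∑ l, (coordConv b l).ofConv x • f χ ^ (l : ℕ) := by
    intro x
    have hx : x - ∑ j, (coordConv b j).ofConv x • χ ^ (j : ℕ) ∈ L := by
      rw [← Ideal.Quotient.eq_zero_iff_mem]
      change Ideal.Quotient.mkₐ k L _ = 0
      rw [map_sub, map_sum, sub_eq_zero, mk_eq_sum_coordConv hb x]
      simp only [map_smul, map_pow]
    have h := hf _ hx
    rw [map_sub, sub_eq_zero] at h
    rw [h, map_sum]
    simp only [map_smul, map_pow]
  -- The weight decomposition: on the `l`-th weight space a point of the subgroup acts by the `l`-th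
  -- power of the value of the character.
  have hsum : M.map f =
      ∑ l : Fin r, (f χ ^ (l : ℕ)) • (M.map (coordConv b l).ofConv).map (algebraMap k R) := by
    ext i j
    rw [Matrix.map_apply, hfx, Matrix.sum_apply]
    refine Finset.sum_congr rfl fun l _ => ?_
    simp [Algebra.smul_def, mul_comm]
  rw [hsum]
  refine Commute.sum_left _ _ _ fun l _ => Commute.smul_left ?_ _
  rw [Commute, SemiconjBy, ← Matrix.map_mul, ← Matrix.map_mul, ← hM.map_mul_linear,
    ← hM.map_mul_linear, horth, horth]
  by_cases h : l = m
  · subst h; rfl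
  · rw [if_neg h, if_neg (Ne.symm h)]

/-- The infinitesimal neighbourhoods of the unit in `G` centralize the diagonalizable subgroup
`Spec (H ⧸ I ^ n)`, where `I` is the augmentation ideal. -/
theorem commute_weight_augIdeal {M : Matrix ι ι H} (hM : IsComatrix k M) {n : ℕ}
    {b : Module.Basis (Fin r) k (H ⧸ augIdeal k H ^ n)}
    (hb : ∀ l : Fin r, b l = Ideal.Quotient.mkₐ k (augIdeal k H ^ n) χ ^ (l : ℕ))
    (horth : ∀ l m, coordConv b l * coordConv b m = if l = m then coordConv b l else 0)
    (m : ℕ) (l : Fin r) :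
    Commute (M.map (Ideal.Quotient.mkₐ k (augIdeal k H ^ m)))
      ((M.map (coordConv b l).ofConv).map (algebraMap k (H ⧸ augIdeal k H ^ m))) := by
  let S := H ⧸ augIdeal k H ^ m
  let C := H ⧸ augIdeal k H ^ n
  let σ : H →ₐ[k] S := Ideal.Quotient.mkₐ k (augIdeal k H ^ m)
  let π : H →ₐ[k] C := Ideal.Quotient.mkₐ k (augIdeal k H ^ n)
  let j₁ : WithConv (H →ₐ[k] S ⊗[k] C) :=
    pointsMap Algebra.TensorProduct.includeLeft (toConv σ)
  let j₂ : WithConv (H →ₐ[k] S ⊗[k] C) :=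
    pointsMap Algebra.TensorProduct.includeRight (toConv π)
  -- The conjugate of the universal point `j₂` of `Spec (H ⧸ I ^ n)` by the universal point `j₁` of
  -- `Spec (H ⧸ I ^ m)`. It is congruent to the unit modulo an ideal with vanishing `n`-th power, so
  -- it again factors through `H ⧸ I ^ n` and commutes with the weight projections.
  let f := j₁ * j₂ * pointInv j₁
  let E := M.map (coordConv b l).ofConv
  have hEE : E * E = E := by
    rw [← hM.map_mul_linear, horth, if_pos rfl]
  have hf : ∀ x ∈ augIdeal k H ^ n, f.ofConv x = 0 := by
    have h1 : ∀ x ∈ augIdeal k H, f.ofConv x ∈ (augIdeal k H).map j₂.ofConv :=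
      conj_apply_mem j₁ fun x hx => Ideal.mem_map_of_mem _ hx
    have h2 : ((augIdeal k H).map j₂.ofConv) ^ n = ⊥ := by
      rw [← Ideal.map_pow, ← le_bot_iff, Ideal.map_le_iff_le_comap]
      intro y hy
      have : π y = 0 := Ideal.Quotient.eq_zero_iff_mem.2 hy
      change (1 : S) ⊗ₜ[k] π y = 0
      rw [this, TensorProduct.tmul_zero]
    intro x hx
    have h3 : f.ofConv x ∈ ((augIdeal k H).map j₂.ofConv) ^ n := by
      have h4 : (augIdeal k H).map f.ofConv ≤ (augIdeal k H).map j₂.ofConv := Ideal.map_le_iff_le_comap.2 h1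
      refine Ideal.pow_right_mono h4 n ?_
      rw [← Ideal.map_pow]
      exact Ideal.mem_map_of_mem _ hx
    rwa [h2] at h3
  have hcomm := commute_weight hM hb horth f.ofConv hf l
  -- Taking the coefficient of the `l`-th power of `χ` turns the matrix of `j₂` into the projection
  -- `E`, hence the matrix of `f` into the conjugate of `E` by `A`.
  let φ : S ⊗[k] C →ₗ[k] S := (TensorProduct.rid k S).toLinearMap ∘ₗ (b.coord l).lTensor S
  have hφ : ∀ s c, φ (s ⊗ₜ c) = b.coord l c • s := fun s c => by simp [φ]
  let A : Matrix ι ι S := M.map σ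
  let A' : Matrix ι ι S := M.map (pointInv (toConv σ)).ofConv
  let E' : Matrix ι ι S := E.map (algebraMap k S)
  have hE' : E' * E' = E' := by
    rw [← Matrix.map_mul, hEE]
  have hA'A : A' * A = 1 := by
    have := hM.map_mul (pointInv (toConv σ)) (toConv σ)
    rw [pointInv_mul, hM.map_one] at this
    exact this.symm
  have hAA' : A * A' = 1 := by
    have := hM.map_mul (toConv σ) (pointInv (toConv σ))
    rw [mul_pointInv, hM.map_one] at this
    exact this.symm
  have hφf : (M.map f.ofConv).map φ = A * E' * A' := by
    ext i j
    rw [hM.map_mul, hM.map_mul]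
    simp only [Matrix.map_apply, Matrix.mul_apply, Finset.sum_mul, map_sum]
    refine Finset.sum_congr rfl fun p _ => Finset.sum_congr rfl fun q _ => ?_
    have h1 : j₁.ofConv (M i q) * j₂.ofConv (M q p) * (pointInv j₁).ofConv (M p j) =
        (σ (M i q) * (pointInv (toConv σ)).ofConv (M p j)) ⊗ₜ[k] π (M q p) := by
      change (σ (M i q) ⊗ₜ[k] (1 : C)) * ((1 : S) ⊗ₜ[k] π (M q p)) *
        ((pointInv (toConv σ)).ofConv (M p j) ⊗ₜ[k] (1 : C)) = _
      simp
    rw [h1, hφ, Algebra.smul_def]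
    change algebraMap k S (E q p) * (σ (M i q) * (pointInv (toConv σ)).ofConv (M p j)) =
      σ (M i q) * algebraMap k S (E q p) * (pointInv (toConv σ)).ofConv (M p j)
    ring
  have hcomm' : Commute (A * E' * A') E' := by
    rw [← hφf]
    have hl : ∀ X : Matrix ι ι (S ⊗[k] C),
        (X * E.map (algebraMap k (S ⊗[k] C))).map φ = X.map φ * E' := by
      intro X
      ext i j
      simp only [Matrix.map_apply, Matrix.mul_apply, map_sum, E']
      refine Finset.sum_congr rfl fun q _ => ?_
      rw [mul_comm, ← Algebra.smul_def, map_smul, Algebra.smul_def, mul_comm]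
    have hr : ∀ X : Matrix ι ι (S ⊗[k] C),
        (E.map (algebraMap k (S ⊗[k] C)) * X).map φ = E' * X.map φ := by
      intro X
      ext i j
      simp only [Matrix.map_apply, Matrix.mul_apply, map_sum, E']
      refine Finset.sum_congr rfl fun q _ => ?_
      rw [← Algebra.smul_def, map_smul, Algebra.smul_def]
    have := congrArg (fun X : Matrix ι ι (S ⊗[k] C) => X.map φ) hcomm.eq
    exact (hl _).symm.trans (this.trans (hr _))
  have hP : A * E' * A' = E' := by
    set P := A * E' * A' with hPdef
    have hPP : P * P = P := by
      calc P * P = A * E' * (A' * A) * E' * A' := by simp only [hPdef, mul_assoc]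
        _ = P := by rw [hA'A, mul_one, mul_assoc A, hE']
    -- The difference of two commuting idempotents equals its own cube. Here `A` is congruent to the
    -- identity modulo a nilpotent ideal, so the difference has entries in that ideal and vanishes.
    have hD : (P - E') * (P - E') * (P - E') = P - E' := by
      have h1 := hcomm'.eq
      have h2 : P * E' * P = P * E' := by rw [mul_assoc, ← h1, ← mul_assoc, hPP]
      have h3 : P * E' * E' = P * E' := by rw [mul_assoc, hE']
      simp only [sub_mul, mul_sub, hPP, hE', ← h1, h2, h3]
      abel
    refine sub_eq_zero.1 (matrix_eq_zero_of_pow_three (J := (augIdeal k H).map σ) (n := m) ?_ hD ?_)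
    · rw [← Ideal.map_pow]
      exact Ideal.map_quotient_self _
    · have hA : ∀ i j, A i j - (1 : Matrix ι ι S) i j ∈ (augIdeal k H).map σ := by
        intro i j
        have h := Ideal.mem_map_of_mem σ (sub_counit_mem_augIdeal (k := k) (M i j))
        rw [hM.counit, map_sub, AlgHom.commutes] at h
        have h1 : algebraMap k S ((1 : Matrix ι ι k) i j) = (1 : Matrix ι ι S) i j := by
          rw [Matrix.one_apply, Matrix.one_apply]
          split_ifs <;> simp
        rwa [h1] at h
      intro i j
      have hPE : P - E' = (A - 1) * E' * A' + E' * (A' * (1 - A)) := by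
        rw [mul_sub, hA'A, mul_one, sub_mul, sub_mul, one_mul, mul_sub, mul_one]
        abel
      rw [hPE, Matrix.add_apply, mul_assoc, ← mul_assoc E', Matrix.mul_apply, Matrix.mul_apply]
      refine add_mem (Ideal.sum_mem _ fun q _ => Ideal.mul_mem_right _ _ ?_)
        (Ideal.sum_mem _ fun q _ => Ideal.mul_mem_left _ _ ?_)
      · exact hA i q
      · rw [Matrix.sub_apply, ← neg_sub]
        exact neg_mem (hA q j)
  change A * E' = E' * A
  calc A * E' = A * E' * (A' * A) := by rw [hA'A, mul_one]
    _ = A * E' * A' * A := by rw [← mul_assoc]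
    _ = E' * A := by rw [hP]

end Centralize

/-! ### Eigenvectors for infinitesimal neighbourhoods of the unit -/

section Infinitesimal

variable {k : Type u} {H : Type v} [Field k] [CommRing H] [HopfAlgebra k H]
  {ι : Type w} [Fintype ι] [DecidableEq ι]

/-- If `v` is an eigenvector for the infinitesimal neighbourhood defined by `I ^ n`, but not for the
next one, then `I ^ n` defines a subgroup. -/
theorem redComul_eq_zero_of_mem {M : Matrix ι ι H} (hM : IsComatrix k M) {t : H}
    (ht : t ∈ augIdeal k H) (hI : augIdeal k H ≤ Ideal.span {t} ⊔ augIdeal k H ^ 2)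
    {n : ℕ} {v : ι → k} {χ : H}
    (hχ : redComul k (augIdeal k H ^ n) χ =
      Ideal.Quotient.mkₐ k (augIdeal k H ^ n) χ ⊗ₜ[k] Ideal.Quotient.mkₐ k (augIdeal k H ^ n) χ)
    (hv : ∀ i, orbit M v i - v i • χ ∈ augIdeal k H ^ n)
    {i : ι} (hi : orbit M v i - v i • χ ∉ augIdeal k H ^ (n + 1)) :
    ∀ x ∈ augIdeal k H ^ n, redComul k (augIdeal k H ^ n) x = 0 := by
  let J : Ideal H := RingHom.ker (redComul k (augIdeal k H ^ n))
  -- The failure of `v` to be an eigenvector modulo `I ^ (n + 1)` gives an element of `J` that spans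
  -- the line `I ^ n / I ^ (n + 1)`.
  have hs : orbit M v i - v i • χ ∈ J := by
    rw [RingHom.mem_ker, map_sub, redComul_orbit hM hv, map_smul, hχ, sub_self]
  obtain ⟨c, hc⟩ := exists_sub_smul_pow_mem ht hI n (hv i)
  have hc0 : c ≠ 0 := by
    rintro rfl
    exact hi (by simpa using hc)
  have h1 : augIdeal k H ^ n ≤ J ⊔ augIdeal k H ^ (n + 1) := by
    intro a ha
    obtain ⟨e, he⟩ := exists_sub_smul_pow_mem ht hI n ha
    set s := orbit M v i - v i • χ
    clear_value s
    have : a = (e * c⁻¹) • s + ((a - e • t ^ n) - (e * c⁻¹) • (s - c • t ^ n)) := by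
      rw [smul_sub, smul_smul, inv_mul_cancel_right₀ hc0]
      abel
    rw [this]
    refine add_mem (Submodule.mem_sup_left ?_)
      (Submodule.mem_sup_right (sub_mem he ?_))
    · rw [Algebra.smul_def]; exact Ideal.mul_mem_left _ _ hs
    · rw [Algebra.smul_def]; exact Ideal.mul_mem_left _ _ hc
  -- Iteration pushes the error term into arbitrarily high powers of `I`, and those from `2 * n` on
  -- lie in `J`.
  have h2 : ∀ j, augIdeal k H ^ n ≤ J ⊔ augIdeal k H ^ (n + 1 + j) := by
    intro j
    induction j with
    | zero => exact h1
    | succ j ih =>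
      refine ih.trans (sup_le le_sup_left ?_)
      calc augIdeal k H ^ (n + 1 + j) = augIdeal k H ^ (j + 1) * augIdeal k H ^ n := by
            rw [← pow_add]; congr 1; ring
        _ ≤ augIdeal k H ^ (j + 1) * (J ⊔ augIdeal k H ^ (n + 1)) := Ideal.mul_mono_right h1
        _ ≤ _ := by
          rw [Ideal.mul_sup, ← pow_add]
          refine sup_le_sup Ideal.mul_le_right (le_of_eq ?_)
          congr 1; ring
  intro x hx
  have h3 : augIdeal k H ^ n ≤ J := by
    refine (h2 n).trans (sup_le le_rfl fun y hy => ?_)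
    exact redComul_augIdeal_pow_eq_zero (by omega) hy
  exact h3 hx

/-- An eigenvector for an infinitesimal neighbourhood of the unit, extended to the next
neighbourhood with the help of a projection that commutes with it. -/
theorem exists_eigenvector_succ_of_projection [IsAlgClosed k] {M : Matrix ι ι H} {t : H}
    (ht : t ∈ augIdeal k H) (hI : augIdeal k H ≤ Ideal.span {t} ⊔ augIdeal k H ^ 2)
    {n : ℕ} {v : ι → k} (hv0 : v ≠ 0) {χ : H} {E : Matrix ι ι k} (hE : E * E = E)
    (hEv : E.mulVec v = v)
    (hEχ : ∀ w i, orbit M (E.mulVec w) i - E.mulVec w i • χ ∈ augIdeal k H ^ n)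
    (hcomm : Commute (M.map (Ideal.Quotient.mkₐ k (augIdeal k H ^ (n + 1))))
      (E.map (algebraMap k (H ⧸ augIdeal k H ^ (n + 1))))) :
    ∃ w : ι → k, w ≠ 0 ∧ ∃ χ' : H, ∀ i, orbit M w i - w i • χ' ∈ augIdeal k H ^ (n + 1) := by
  let S := H ⧸ augIdeal k H ^ (n + 1)
  let σ : H →ₐ[k] S := Ideal.Quotient.mkₐ k (augIdeal k H ^ (n + 1))
  -- On the image of `E` the matrix acts by `χ` modulo `I ^ n`, so modulo `I ^ (n + 1)` it acts as
  -- `χ + t ^ n Y` with a scalar matrix `Y`.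
  choose Y hY using fun i j =>
    exists_sub_smul_pow_mem ht hI n (hEχ (Pi.single j 1) i)
  let Y' : Matrix ι ι k := Y
  let f : Module.End k (ι → k) := Matrix.toLin' (E * Y' * E)
  let p : Submodule k (ι → k) := LinearMap.range (Matrix.toLin' E)
  have hp : ∀ x ∈ p, E.mulVec x = x := by
    rintro _ ⟨u, rfl⟩
    rw [Matrix.toLin'_apply, Matrix.mulVec_mulVec, hE]
  have hf : ∀ x ∈ p, f x ∈ p := by
    intro x _
    refine ⟨(Y' * E).mulVec x, ?_⟩
    rw [Matrix.toLin'_apply, Matrix.toLin'_apply, Matrix.mulVec_mulVec, mul_assoc]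
  have : Nontrivial p := ⟨⟨⟨v, v, hEv⟩, 0, fun h => hv0 (congrArg Subtype.val h)⟩⟩
  obtain ⟨c, hc⟩ := Module.End.exists_eigenvalue (f.restrict hf)
  obtain ⟨⟨w, hwp⟩, hw⟩ := hc.exists_hasEigenvector
  have hw0 : w ≠ 0 := fun h => hw.2 (Subtype.ext h)
  have hfw : E.mulVec (Y'.mulVec w) = c • w := by
    have h := congrArg Subtype.val hw.apply_eq_smul
    have h' : (E * Y' * E).mulVec w = c • w := h
    rwa [← Matrix.mulVec_mulVec, hp w hwp, ← Matrix.mulVec_mulVec] at h'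
  -- `w` is an eigenvector of `E Y` in the image of `E` with eigenvalue `c`, which corrects the
  -- character by `c • t ^ n`.
  refine ⟨w, hw0, χ + c • t ^ n, fun i => ?_⟩
  have hAE : M.map σ * E.map (algebraMap k S) =
      σ χ • E.map (algebraMap k S) + σ (t ^ n) • Y'.map (algebraMap k S) := by
    ext i j
    have h := Ideal.Quotient.eq_zero_iff_mem.2 (hY i j)
    change σ _ = 0 at h
    have h1 : σ (orbit M (E.mulVec (Pi.single j 1)) i) =
        (M.map σ * E.map (algebraMap k S)) i j := by
      change σ.toLinearMap _ = _
      rw [map_orbit, Matrix.mul_apply]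
      refine Finset.sum_congr rfl fun q _ => ?_
      rw [Matrix.mulVec_single_one, Algebra.smul_def, mul_comm]
      rfl
    rw [map_sub, map_sub, h1, map_smul, map_smul, sub_sub, sub_eq_zero] at h
    rw [h, Matrix.mulVec_single_one, Algebra.smul_def, Algebra.smul_def, mul_comm,
      mul_comm (algebraMap k S (Y i j))]
    rfl
  have hmap : ∀ (X : Matrix ι ι k) (x : ι → k),
      (X.map (algebraMap k S)).mulVec (algebraMap k S ∘ x) = algebraMap k S ∘ X.mulVec x := by
    intro X x
    ext i
    simp [Matrix.mulVec, dotProduct]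
  have hσ : σ (orbit M w i) = (M.map σ).mulVec (algebraMap k S ∘ w) i := by
    change σ.toLinearMap _ = _
    rw [map_orbit]
    refine Finset.sum_congr rfl fun q _ => ?_
    rw [Algebra.smul_def, mul_comm]
    rfl
  have hmain : (M.map σ).mulVec (algebraMap k S ∘ w) =
      (σ (χ + c • t ^ n)) • (algebraMap k S ∘ w) := by
    calc (M.map σ).mulVec (algebraMap k S ∘ w)
        = (M.map σ * E.map (algebraMap k S)).mulVec (algebraMap k S ∘ w) := by
          rw [← Matrix.mulVec_mulVec, hmap, hp w hwp]
      _ = (M.map σ * E.map (algebraMap k S) * E.map (algebraMap k S)).mulVec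
            (algebraMap k S ∘ w) := by
          rw [mul_assoc, ← Matrix.map_mul, hE]
      -- Commutation allows a projection to be put in front, where it replaces `Y w` by `E Y w = c •
      -- w`.
      _ = (E.map (algebraMap k S)).mulVec ((M.map σ * E.map (algebraMap k S)).mulVec
            (algebraMap k S ∘ w)) := by
          rw [hcomm.eq, Matrix.mulVec_mulVec, mul_assoc, ← hcomm.eq]
      _ = _ := by
          rw [hAE, Matrix.add_mulVec, Matrix.smul_mulVec, Matrix.smul_mulVec, hmap, hmap,
            hp w hwp, Matrix.mulVec_add, Matrix.mulVec_smul, Matrix.mulVec_smul, hmap, hmap,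
            hp w hwp, hfw]
          ext i
          simp only [Pi.add_apply, Pi.smul_apply, Function.comp_apply, smul_eq_mul, map_mul,
            map_add, map_smul]
          rw [Algebra.smul_def]
          ring
  have : σ (orbit M w i - w i • (χ + c • t ^ n)) = 0 := by
    rw [map_sub, hσ, hmain, map_smul, sub_eq_zero, Pi.smul_apply, smul_eq_mul, mul_comm]
    exact (Algebra.smul_def _ _).symm
  exact Ideal.Quotient.eq_zero_iff_mem.1 this

/-- Either `v` remains an eigenvector, or `I ^ n` defines a diagonalizable subgroup and the new
eigenvector is found in the weight space of the eigencharacter of `v`. -/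
theorem exists_eigenvector_succ [IsAlgClosed k] [Module.Finite k H] [Nonempty ι]
    {M : Matrix ι ι H} (hM : IsComatrix k M) (hF : HasFreeOrbits k M) {t : H}
    (ht : t ∈ augIdeal k H) (hI : augIdeal k H ≤ Ideal.span {t} ⊔ augIdeal k H ^ 2)
    {n : ℕ} (hn : n ≠ 0) {v : ι → k} (hv0 : v ≠ 0) {χ₀ : H}
    (hv₀ : ∀ i, orbit M v i - v i • χ₀ ∈ augIdeal k H ^ n) :
    ∃ w : ι → k, w ≠ 0 ∧ ∃ χ' : H, ∀ i, orbit M w i - w i • χ' ∈ augIdeal k H ^ (n + 1) := by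
  obtain ⟨i₀, hi₀⟩ := Function.ne_iff.1 hv0
  -- The eigenvalue is only given modulo `I ^ n`. A normalized orbit coordinate represents it; its
  -- value at the unit is `1`, and the comultiplication formula for orbits shows that it is
  -- group-like.
  let χ : H := (v i₀)⁻¹ • orbit M v i₀
  have hLI : augIdeal k H ^ n ≤ augIdeal k H := Ideal.pow_le_self hn
  have hχχ : χ - χ₀ ∈ augIdeal k H ^ n := by
    have : χ - χ₀ = (v i₀)⁻¹ • (orbit M v i₀ - v i₀ • χ₀) := by
      rw [smul_sub, inv_smul_smul₀ hi₀]
    rw [this, Algebra.smul_def]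
    exact Ideal.mul_mem_left _ _ (hv₀ i₀)
  have hv : ∀ i, orbit M v i - v i • χ ∈ augIdeal k H ^ n := by
    intro i
    have : orbit M v i - v i • χ = (orbit M v i - v i • χ₀) - v i • (χ - χ₀) := by
      rw [smul_sub]; abel
    rw [this, Algebra.smul_def (v i) (χ - χ₀)]
    exact sub_mem (hv₀ i) (Ideal.mul_mem_left _ _ hχχ)
  by_contra hcon
  obtain ⟨i₁, hi₁⟩ : ∃ i, orbit M v i - v i • χ ∉ augIdeal k H ^ (n + 1) := by
    by_contra h
    push Not at h
    exact hcon ⟨v, hv0, χ, h⟩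
  have hχ : redComul k (augIdeal k H ^ n) χ = Ideal.Quotient.mkₐ k (augIdeal k H ^ n) χ ⊗ₜ[k]
      Ideal.Quotient.mkₐ k (augIdeal k H ^ n) χ := by
    rw [map_smul, redComul_orbit hM hv, inv_smul_smul₀ hi₀]
  have hε : Coalgebra.counit (R := k) χ = 1 := by
    rw [map_smul, hM.counit_orbit, smul_eq_mul, inv_mul_cancel₀ hi₀]
  have hL := redComul_eq_zero_of_mem hM ht hI hχ hv hi₁
  obtain ⟨r, b, hb⟩ := exists_basis_pow hF hv0 hv
  have horth := coordConv_mul_coordConv hb hL hχ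
  have hsum := sum_coordConv hb hLI hε
  refine hcon ?_
  by_cases hr : 1 < r
  -- The weight space of the character `χ` itself, that is, of its first power.
  · let l : Fin r := ⟨1, hr⟩
    have hE : M.map (coordConv b l).ofConv * M.map (coordConv b l).ofConv =
        M.map (coordConv b l).ofConv := by
      rw [← hM.map_mul_linear, horth, if_pos rfl]
    refine exists_eigenvector_succ_of_projection ht hI hv0 (χ := χ) hE ?_ ?_
      (commute_weight_augIdeal hM hb horth (n + 1) l)
    · ext i
      have h := Ideal.Quotient.eq_zero_iff_mem.2 (hv i)
      change Ideal.Quotient.mkₐ k (augIdeal k H ^ n) _ = 0 at h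
      rw [map_sub, sub_eq_zero, map_smul] at h
      have hb1 : b l = Ideal.Quotient.mkₐ k (augIdeal k H ^ n) χ := by
        rw [hb]; exact pow_one _
      rw [← map_orbit_eq_mulVec, coordConv_apply, h, map_smul, ← hb1]
      simp
    · intro u i
      rw [← Ideal.Quotient.eq_zero_iff_mem]
      change Ideal.Quotient.mkₐ k (augIdeal k H ^ n) _ = 0
      rw [map_sub, sub_eq_zero, mk_eq_sum_coordConv hb, map_smul, Finset.sum_eq_single l]
      · rw [map_orbit_eq_mulVec, Matrix.mulVec_mulVec, hE]
        exact congrArg _ (pow_one _)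
      · intro m _ hm
        rw [map_orbit_eq_mulVec, Matrix.mulVec_mulVec, ← hM.map_mul_linear, horth, if_neg hm]
        have : M.map (0 : WithConv (H →ₗ[k] k)).ofConv = 0 := rfl
        rw [this, Matrix.zero_mulVec, Pi.zero_apply, zero_smul]
      · simp
  -- Here `H ⧸ I ^ n` contains only constants: the subgroup is trivial, and the whole space serves
  -- as weight space.
  · have hone : ∀ x, x - algebraMap k H (Coalgebra.counit x) ∈ augIdeal k H ^ n := by
      intro x
      rw [← Ideal.Quotient.eq_zero_iff_mem]
      change Ideal.Quotient.mkₐ k (augIdeal k H ^ n) _ = 0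
      rw [map_sub, sub_eq_zero, mk_eq_sum_coordConv hb, AlgHom.commutes]
      have h1 : Coalgebra.counit (R := k) x = ∑ l, (coordConv b l).ofConv x := by
        have := congrArg (fun y : WithConv (H →ₗ[k] k) => y.ofConv x) hsum
        simp only [LinearMap.convOne_apply] at this
        simpa using this.symm
      rw [h1, map_sum]
      refine Finset.sum_congr rfl fun l _ => ?_
      have : (l : ℕ) = 0 := by omega
      rw [this, pow_zero, Algebra.algebraMap_eq_smul_one]
    refine exists_eigenvector_succ_of_projection ht hI hv0 (χ := χ) (E := 1) (one_mul _)
      (Matrix.one_mulVec _) ?_ ?_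
    · intro u i
      rw [Matrix.one_mulVec]
      have h1 := hone (orbit M u i)
      have h2 := hone χ
      rw [hM.counit_orbit] at h1
      rw [hε, map_one] at h2
      have : orbit M u i - u i • χ =
          (orbit M u i - algebraMap k H (u i)) - algebraMap k H (u i) * (χ - 1) := by
        rw [Algebra.smul_def]; ring
      rw [this]
      exact sub_mem h1 (Ideal.mul_mem_left _ _ h2)
    · rw [Matrix.map_one _ (map_zero _) (map_one _)]
      exact Commute.one_right _

/-- If orbits are free, then the identity component of `G` has an eigenvector. -/
theorem HasFreeOrbits.exists_eigenvector [IsAlgClosed k] [Module.Finite k H] [Nonempty ι]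
    {M : Matrix ι ι H} (hM : IsComatrix k M) (hF : HasFreeOrbits k M) (n : ℕ) :
    ∃ w : ι → k, w ≠ 0 ∧ ∃ χ : H, ∀ i, orbit M w i - w i • χ ∈ augIdeal k H ^ (n + 1) := by
  obtain ⟨t, ht, hI⟩ := hF.exists_augIdeal_le
  induction n with
  | zero =>
    obtain ⟨v, hv⟩ := exists_ne (0 : ι → k)
    refine ⟨v, hv, 1, fun i => ?_⟩
    rw [zero_add, pow_one, mem_augIdeal, map_sub, hM.counit_orbit, map_smul,
      Bialgebra.counit_one]
    simp
  | succ n ih =>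
    obtain ⟨w, hw, χ, h⟩ := ih
    exact exists_eigenvector_succ hM hF ht hI n.succ_ne_zero hw h

end Infinitesimal

/-! ### Representations as modules over the dual algebra -/

section DualAction

variable {k : Type u} {H : Type v} [Field k] [CommRing H] [HopfAlgebra k H]
  {V : Type w} [AddCommGroup V] [Module k V]

/-- The action of linear functionals on `H` on a representation. -/
noncomputable def Rep.act (r : Rep k H V) (x : WithConv (H →ₗ[k] k)) : Module.End k V :=
  (TensorProduct.rid k V).toLinearMap ∘ₗ x.ofConv.lTensor V ∘ₗ r.coact

theorem Rep.act_apply (r : Rep k H V) (x : WithConv (H →ₗ[k] k)) (v : V) :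
    r.act x v = TensorProduct.rid k V (x.ofConv.lTensor V (r.coact v)) := rfl

theorem Rep.act_one (r : Rep k H V) : r.act 1 = 1 := r.counit_coact

theorem Rep.act_mul (r : Rep k H V) (x y : WithConv (H →ₗ[k] k)) :
    r.act (x * y) = r.act x * r.act y := by
  let F : V ⊗[k] (H ⊗[k] H) →ₗ[k] V := (TensorProduct.rid k V).toLinearMap ∘ₗ
    (LinearMap.mul' k k ∘ₗ TensorProduct.map x.ofConv y.ofConv).lTensor V
  have h1 : F ∘ₗ (Coalgebra.comul (R := k) (A := H)).lTensor V =
      (TensorProduct.rid k V).toLinearMap ∘ₗ (x * y).ofConv.lTensor V := by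
    ext v h
    rfl
  have h2 : F ∘ₗ (TensorProduct.assoc k V H H).toLinearMap ∘ₗ r.coact.rTensor H =
      r.act x ∘ₗ (TensorProduct.rid k V).toLinearMap ∘ₗ y.ofConv.lTensor V := by
    ext v h
    simp only [TensorProduct.AlgebraTensorModule.curry_apply, TensorProduct.curry_apply,
      LinearMap.coe_restrictScalars, LinearMap.comp_apply, LinearMap.rTensor_tmul,
      LinearMap.lTensor_tmul, LinearEquiv.coe_coe, TensorProduct.rid_tmul, map_smul, act_apply]
    induction r.coact v with
    | zero => simp
    | tmul a c => simp [F, smul_smul, mul_comm]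
    | add a c ha hc => simp only [TensorProduct.add_tmul, map_add, ha, hc, smul_add]
  calc r.act (x * y)
      = (F ∘ₗ (Coalgebra.comul (R := k) (A := H)).lTensor V) ∘ₗ r.coact := by rw [h1]; rfl
    _ = (F ∘ₗ (TensorProduct.assoc k V H H).toLinearMap ∘ₗ r.coact.rTensor H) ∘ₗ r.coact := by
      rw [LinearMap.comp_assoc, ← r.coassoc]; rfl
    _ = _ := by rw [h2]; rfl

/-- A representation as a module over the dual algebra of `H`. -/
noncomputable def Rep.actHom (r : Rep k H V) : WithConv (H →ₗ[k] k) →+* Module.End k V where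
  toFun := r.act
  map_one' := r.act_one
  map_mul' := r.act_mul
  map_zero' := by ext v; simp [act_apply]
  map_add' x y := by ext v; simp [act_apply, LinearMap.lTensor_add]

theorem Rep.actHom_apply (r : Rep k H V) (x : WithConv (H →ₗ[k] k)) : r.actHom x = r.act x := rfl

theorem Rep.actHom_smul (r : Rep k H V) (c : k) (x : WithConv (H →ₗ[k] k)) :
    r.actHom (c • x) = c • r.actHom x := by
  ext v
  simp [actHom_apply, act_apply, LinearMap.lTensor_smul]

/-- Expanding in a basis of `H` shows that the coaction is recovered from the operators of the
coordinate functionals. -/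
theorem Rep.isSubrep_iff [Module.Finite k H] (r : Rep k H V) (W : Submodule k V) :
    r.IsSubrep W ↔ ∀ x, ∀ w ∈ W, r.actHom x w ∈ W := by
  constructor
  · intro h x w hw
    obtain ⟨z, hz⟩ := h w hw
    rw [actHom_apply, act_apply, ← hz]
    clear hz
    induction z with
    | zero => simp
    | tmul a c => simpa using W.smul_mem _ a.2
    | add a c ha hc => simpa only [map_add] using add_mem ha hc
  · intro h w hw
    let b := Module.Free.chooseBasis k H
    have key : ∀ z : V ⊗[k] H, z = ∑ i,
        (TensorProduct.rid k V ((b.coord i).lTensor V z)) ⊗ₜ[k] b i := by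
      intro z
      induction z with
      | zero => simp
      | tmul a c =>
        conv_lhs => rw [← b.sum_repr c]
        rw [TensorProduct.tmul_sum]
        simp [TensorProduct.smul_tmul]
      | add a c ha hc =>
        simp only [map_add, TensorProduct.add_tmul, Finset.sum_add_distrib]
        rw [← ha, ← hc]
    rw [key (r.coact w)]
    refine Submodule.sum_mem _ fun i _ => ?_
    exact ⟨⟨_, h (toConv (b.coord i)) w hw⟩ ⊗ₜ[k] b i, rfl⟩

end DualAction

/-! ### The dual algebra is generated by the identity component and the rational points -/

section Generation

variable {k : Type u} {H : Type v} [Field k] [CommRing H] [HopfAlgebra k H]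

/-- Rational points as elements of the dual algebra. -/
noncomputable def pointFunctional (k : Type u) (H : Type v) [Field k] [CommRing H]
    [HopfAlgebra k H] : WithConv (H →ₐ[k] k) →* WithConv (H →ₗ[k] k) where
  toFun g := toConv g.ofConv.toLinearMap
  map_one' := rfl
  map_mul' _ _ := rfl

/-- Left translation by a rational point. -/
noncomputable def leftTranslate (g : WithConv (H →ₐ[k] k)) : WithConv (H →ₐ[k] H) :=
  pointsMap (Algebra.ofId k H) g * toConv (AlgHom.id k H)

theorem pointsMap_leftTranslate_ofId {R : Type*} [CommRing R] [Algebra k R] (f : H →ₐ[k] R)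
    (g : WithConv (H →ₐ[k] k)) :
    pointsMap f (pointsMap (Algebra.ofId k H) g) = pointsMap (Algebra.ofId k R) g := by
  ext x
  simp [pointsMap_apply, Algebra.ofId_apply]

theorem pointsMap_id {R : Type*} [CommRing R] [Algebra k R] (f : H →ₐ[k] R) :
    pointsMap f (toConv (AlgHom.id k H)) = toConv f := rfl

theorem pointsMap_leftTranslate {R : Type*} [CommRing R] [Algebra k R] (f : H →ₐ[k] R)
    (g : WithConv (H →ₐ[k] k)) :
    pointsMap f (leftTranslate g) = pointsMap (Algebra.ofId k R) g * toConv f := by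
  rw [leftTranslate, map_mul, pointsMap_leftTranslate_ofId, pointsMap_id]

theorem ofId_self : pointsMap (H := H) (Algebra.ofId k k) = MonoidHom.id _ := by
  ext g x
  rfl

theorem apply_leftTranslate_inv (g : WithConv (H →ₐ[k] k)) (h : H) :
    g.ofConv ((leftTranslate g⁻¹).ofConv h) = Coalgebra.counit (R := k) h := by
  have := pointsMap_leftTranslate g.ofConv g⁻¹
  rw [ofId_self, MonoidHom.id_apply] at this
  have h1 : toConv g.ofConv = g := rfl
  rw [h1, inv_mul_cancel] at this
  exact congrArg (fun y : WithConv (H →ₐ[k] k) => y.ofConv h) this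

theorem leftTranslate_inv_leftTranslate (g : WithConv (H →ₐ[k] k)) (h : H) :
    (leftTranslate g⁻¹).ofConv ((leftTranslate g).ofConv h) = h := by
  have := pointsMap_leftTranslate (leftTranslate g⁻¹).ofConv g
  have h1 : toConv (leftTranslate g⁻¹).ofConv = leftTranslate g⁻¹ := rfl
  rw [h1, leftTranslate, ← mul_assoc, ← map_mul, mul_inv_cancel, map_one, one_mul] at this
  exact congrArg (fun y : WithConv (H →ₐ[k] H) => y.ofConv h) this

theorem pointFunctional_mul_apply (g : WithConv (H →ₐ[k] k)) (x : WithConv (H →ₗ[k] k)) (h : H) :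
    (pointFunctional k H g * x).ofConv h = x.ofConv ((leftTranslate g).ofConv h) := by
  rw [leftTranslate, AlgHom.convMul_apply, LinearMap.convMul_apply]
  induction Coalgebra.comul (R := k) h with
  | zero => simp
  | tmul a b =>
    simp only [TensorProduct.map_tmul, LinearMap.mul'_apply, Algebra.TensorProduct.lift_tmul]
    change g.ofConv a * x.ofConv b = x.ofConv (algebraMap k H (g.ofConv a) * b)
    rw [← Algebra.smul_def, map_smul, smul_eq_mul]
  | add a b ha hb => simp only [map_add, ha, hb]

/-- The automorphism of `H` given by conjugation with a rational point. -/
noncomputable def conjPoint (g : WithConv (H →ₐ[k] k)) : WithConv (H →ₐ[k] H) :=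
  pointsMap (Algebra.ofId k H) g * toConv (AlgHom.id k H) *
    pointInv (pointsMap (Algebra.ofId k H) g)

theorem conj_pointFunctional_apply (g : WithConv (H →ₐ[k] k)) (x : WithConv (H →ₗ[k] k)) (h : H) :
    (pointFunctional k H g * x * pointFunctional k H g⁻¹).ofConv h =
      x.ofConv ((conjPoint g).ofConv h) := by
  rw [conjPoint, AlgHom.convMul_apply, LinearMap.convMul_apply]
  induction Coalgebra.comul (R := k) h with
  | zero => simp
  | tmul a b =>
    simp only [TensorProduct.map_tmul, LinearMap.mul'_apply, Algebra.TensorProduct.lift_tmul]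
    rw [pointFunctional_mul_apply]
    change x.ofConv ((leftTranslate g).ofConv a) * g⁻¹.ofConv b =
      x.ofConv ((leftTranslate g).ofConv a * algebraMap k H (g⁻¹.ofConv b))
    rw [mul_comm ((leftTranslate g).ofConv a), ← Algebra.smul_def, map_smul, smul_eq_mul, mul_comm]
  | add a b ha hb => simp only [map_add, ha, hb]

theorem conjPoint_mem (g : WithConv (H →ₐ[k] k)) {n : ℕ} {h : H} (hh : h ∈ augIdeal k H ^ n) :
    (conjPoint g).ofConv h ∈ augIdeal k H ^ n := by
  have h1 : ∀ x ∈ augIdeal k H, (conjPoint g).ofConv x ∈ augIdeal k H :=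
    conj_apply_mem _ fun x hx => hx
  have h2 : (augIdeal k H).map (conjPoint g).ofConv ≤ augIdeal k H := Ideal.map_le_iff_le_comap.2 h1
  have h3 := Ideal.pow_right_mono h2 n
  rw [← Ideal.map_pow] at h3
  exact h3 (Ideal.mem_map_of_mem _ hh)

theorem exists_point_of_isMaximal [IsAlgClosed k] [Module.Finite k H] (m : Ideal H)
    [hm : m.IsMaximal] : ∃ g : H →ₐ[k] k, RingHom.ker g = m := by
  let := Ideal.Quotient.field m
  have hbij : Function.Bijective (algebraMap k (H ⧸ m)) :=
    IsAlgClosed.algebraMap_bijective_of_isIntegral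
  let e : k ≃ₐ[k] H ⧸ m := AlgEquiv.ofBijective (Algebra.ofId k _) hbij
  refine ⟨e.symm.toAlgHom.comp (Ideal.Quotient.mkₐ k m), ?_⟩
  ext x
  rw [RingHom.mem_ker]
  change e.symm (Ideal.Quotient.mkₐ k m x) = 0 ↔ _
  rw [map_eq_zero_iff _ e.symm.injective]
  exact Ideal.Quotient.eq_zero_iff_mem

/-- A function all of whose translates vanish on the identity component is zero. -/
theorem eq_zero_of_leftTranslate_mem [IsAlgClosed k] [Module.Finite k H] {n : ℕ}
    (hn : augIdeal k H ^ (n + 1) = augIdeal k H ^ n) {h : H}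
    (hh : ∀ g : WithConv (H →ₐ[k] k), (leftTranslate g).ofConv h ∈ augIdeal k H ^ n) : h = 0 := by
  have : IsNoetherianRing H := IsNoetherianRing.of_finite k H
  -- Nakayama: as `I * I ^ n = I ^ n`, some function `r` with value `1` at the unit annihilates `I ^
  -- n`.
  obtain ⟨r, hr1, hr⟩ := Submodule.exists_sub_one_mem_and_smul_eq_zero_of_fg_of_le_smul
    (augIdeal k H) (augIdeal k H ^ n : Ideal H) (IsNoetherian.noetherian _) (by
      rw [smul_eq_mul, ← pow_succ', hn])
  let J : Ideal H := LinearMap.ker (LinearMap.toSpanSingleton H H h)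
  have hJ : J = ⊤ := by
    by_contra hJ
    obtain ⟨m, hm, hJm⟩ := Ideal.exists_le_maximal J hJ
    obtain ⟨g, rfl⟩ := exists_point_of_isMaximal (k := k) m
    -- Translated back to `g`, the function `r` annihilates `h` and has value `1` at `g`. Hence the
    -- annihilator `J` of `h` lies in no maximal ideal.
    have h1 : (leftTranslate (toConv g)⁻¹).ofConv r ∈ J := by
      have h2 := congrArg (leftTranslate (toConv g)⁻¹).ofConv (hr _ (hh (toConv g)))
      rw [smul_eq_mul, map_mul, leftTranslate_inv_leftTranslate, map_zero] at h2
      exact h2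
    have h3 := hJm h1
    rw [RingHom.mem_ker] at h3
    have h4 := apply_leftTranslate_inv (toConv g) r
    have h5 : Coalgebra.counit (R := k) r = 1 := by
      have := mem_augIdeal.1 hr1
      rwa [map_sub, Bialgebra.counit_one, sub_eq_zero] at this
    rw [h5] at h4
    exact zero_ne_one (h3.symm.trans h4)
  have : (1 : H) ∈ J := by rw [hJ]; trivial
  simpa [J] using this

/-- By duality it suffices that a function killed by all these functionals is zero; all its
translates lie in `I ^ n`. Geometrically, `G` is the union of the translates of its identity
component by rational points. -/
theorem span_pointFunctional_mul_eq_top [IsAlgClosed k] [Module.Finite k H] {n : ℕ}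
    (hn : augIdeal k H ^ (n + 1) = augIdeal k H ^ n) (P : Submodule k (WithConv (H →ₗ[k] k)))
    (hP : ∀ g x, (∀ h ∈ augIdeal k H ^ n, x.ofConv h = 0) → pointFunctional k H g * x ∈ P) :
    P = ⊤ := by
  let e : WithConv (H →ₗ[k] k) ≃ₗ[k] Module.Dual k H := WithConv.linearEquiv k _
  let P' : Submodule k (Module.Dual k H) := P.map e.toLinearMap
  have h1 : P'.dualCoannihilator = ⊥ := by
    rw [eq_bot_iff]
    intro h hh
    rw [Submodule.mem_dualCoannihilator] at hh
    refine eq_zero_of_leftTranslate_mem hn fun g => ?_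
    by_contra hcon
    have hcon' : (leftTranslate g).ofConv h ∉ (augIdeal k H ^ n).restrictScalars k := hcon
    obtain ⟨x, hx, hx0⟩ := Submodule.exists_le_ker_of_notMem hcon'
    refine hx ?_
    have := hh (pointFunctional k H g * toConv x).ofConv
      ⟨_, hP g (toConv x) (fun y hy => hx0 hy), rfl⟩
    rwa [pointFunctional_mul_apply] at this
  have h2 : P' = ⊤ := by
    rw [← Subspace.dualCoannihilator_dualAnnihilator_eq (W := P'), h1]
    exact Submodule.dualAnnihilator_bot
  rw [eq_top_iff]
  intro x _
  have hx : e x ∈ P' := by rw [h2]; trivial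
  obtain ⟨y, hy, hyx⟩ := hx
  rwa [← e.injective hyx]

end Generation

/-! ### Free orbits force linear reductivity -/

section Reductive

variable {k : Type u} {H : Type v} [Field k] [CommRing H] [HopfAlgebra k H]
  {ι : Type w} [Fintype ι] [DecidableEq ι]

/-- If orbits are free, then the order of the group of rational points is invertible. -/
theorem HasFreeOrbits.card_ne_zero [Module.Finite k H] [Nonempty ι]
    {M : Matrix ι ι H} (hM : IsComatrix k M) (hF : HasFreeOrbits k M) :
    (Nat.card (WithConv (H →ₐ[k] k)) : k) ≠ 0 := by
  have hfin : Finite (WithConv (H →ₐ[k] k)) := Finite.of_equiv _ (WithConv.equiv (H →ₐ[k] k)).symm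
  intro h0
  obtain ⟨p, hp⟩ := CharP.exists k
  have hdvd : p ∣ Nat.card (WithConv (H →ₐ[k] k)) := (CharP.cast_eq_zero_iff k p _).1 h0
  have hpos : 0 < Nat.card (WithConv (H →ₐ[k] k)) := Nat.card_pos
  have hprime : p.Prime := (CharP.char_is_prime_or_zero k p).resolve_right fun h => by
    rw [h, zero_dvd_iff] at hdvd
    omega
  have : Fact p.Prime := ⟨hprime⟩
  obtain ⟨g, hg⟩ := exists_prime_orderOf_dvd_card' p hdvd
  let A : Matrix ι ι k := hM.toMonoidHom k g
  have hA : A ^ p = 1 := by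
    rw [← map_pow, ← hg, pow_orderOf_eq_one, map_one]
  -- In characteristic `p` an element of order `p` is unipotent, so it fixes a nonzero vector.
  have hA1 : (A - 1) ^ p = 0 := by
    rw [sub_pow_char_of_commute p (Commute.one_right A), hA, one_pow, sub_self]
  have hdet : (A - 1).det = 0 := by
    have : (A - 1).det ^ p = 0 := by
      rw [← Matrix.det_pow, hA1, Matrix.det_zero]
    exact pow_eq_zero_iff hprime.ne_zero |>.1 this
  obtain ⟨v, hv, hv0⟩ := Matrix.exists_mulVec_eq_zero_iff.2 hdet
  rw [Matrix.sub_mulVec, Matrix.one_mulVec, sub_eq_zero] at hv0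
  -- The points `g` and `1` agree on the orbit coordinates of `v`, which generate `H`.
  have hg1 : g = 1 := by
    apply WithConv.ofConv_injective
    refine AlgHom.ext_of_adjoin_eq_top (hF v hv) ?_
    rintro _ ⟨i, rfl⟩
    have h1 : g.ofConv (orbit M v i) = A.mulVec v i := map_orbit_eq_mulVec M v g.ofConv.toLinearMap i
    rw [h1, hv0, AlgHom.convOne_apply, hM.counit_orbit]
    rfl
  rw [hg1, orderOf_one] at hg
  exact hprime.one_lt.ne hg

/-- A ring-theoretic form of averaging: `e` is averaged first over the orthogonal idempotents `E l`
and then over the finite group `Γ`, which normalizes the span of the idempotents. -/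
theorem commute_average {Γ R : Type*} [Group Γ] [Fintype Γ] [Ring R] {r : ℕ} {E : Fin r → R}
    (hE : ∀ l m, E l * E m = if l = m then E l else 0) (ρ : Γ →* R) (e : R)
    {x : R} (hx : ∀ g : Γ, ∀ f, (∀ l, Commute f (E l)) → Commute f (ρ g⁻¹ * x * ρ g)) (g : Γ) :
    Commute (∑ h, ρ h * (∑ l, E l * e * E l) * ρ h⁻¹) (ρ g * x) := by
  set e' := ∑ l, E l * e * E l with he'
  -- The block-diagonal part of `e` with respect to the idempotents.
  have h1 : ∀ l, Commute e' (E l) := by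
    intro m
    have h2 : e' * E m = E m * e * E m := by
      rw [he', Finset.sum_mul, Finset.sum_eq_single m]
      · rw [mul_assoc, hE, if_pos rfl]
      · intro l _ hl
        rw [mul_assoc, hE, if_neg hl, mul_zero]
      · simp
    have h3 : E m * e' = E m * e * E m := by
      rw [he', Finset.mul_sum, Finset.sum_eq_single m]
      · rw [← mul_assoc, ← mul_assoc, hE, if_pos rfl]
      · intro l _ hl
        rw [← mul_assoc, ← mul_assoc, hE, if_neg (Ne.symm hl), zero_mul, zero_mul]
      · simp
    exact h2.trans h3.symm
  have hρ : ∀ h : Γ, ρ h * ρ h⁻¹ = 1 := fun h => by rw [← map_mul, mul_inv_cancel, map_one]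
  have hρ' : ∀ h : Γ, ρ h⁻¹ * ρ h = 1 := fun h => by rw [← map_mul, inv_mul_cancel, map_one]
  have hg : Commute (∑ h, ρ h * e' * ρ h⁻¹) (ρ g) := by
    change _ * _ = _ * _
    rw [Finset.sum_mul, Finset.mul_sum]
    refine (Fintype.sum_equiv (Equiv.mulLeft g) _ _ fun h => ?_).symm
    simp only [Equiv.coe_mulLeft, mul_inv_rev, map_mul]
    rw [mul_assoc _ (ρ h⁻¹ * ρ g⁻¹), mul_assoc (ρ h⁻¹), hρ', mul_one]
    simp only [mul_assoc]
  refine hg.mul_right ?_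
  refine Commute.sum_left _ _ _ fun h _ => ?_
  have hc := (hx h e' h1).eq
  change _ = _
  calc ρ h * e' * ρ h⁻¹ * x = ρ h * (e' * (ρ h⁻¹ * x * ρ h)) * ρ h⁻¹ := by
        simp only [mul_assoc, hρ, mul_one]
    _ = ρ h * ((ρ h⁻¹ * x * ρ h) * e') * ρ h⁻¹ := by rw [hc]
    _ = x * (ρ h * e' * ρ h⁻¹) := by
        simp only [← mul_assoc, hρ, one_mul]

/-- A finite group scheme with free orbits on some nonzero representation is linearly reductive. -/
theorem HasFreeOrbits.isLinearlyReductive [IsAlgClosed k] [Module.Finite k H] [Nonempty ι]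
    {M : Matrix ι ι H} (hM : IsComatrix k M) (hF : HasFreeOrbits k M) :
    IsLinearlyReductive k H := by
  intro V _ _ _ r W hW
  have : IsArtinianRing H := IsArtinianRing.of_finite k H
  obtain ⟨N, hN⟩ := IsArtinian.monotone_stabilizes
    (⟨fun n => OrderDual.toDual (augIdeal k H ^ n), fun _ _ h => Ideal.pow_le_pow_right h⟩ :
      ℕ →o (Ideal H)ᵒᵈ)
  have hN' : ∀ m, N ≤ m → augIdeal k H ^ N = augIdeal k H ^ m := hN
  obtain ⟨v, hv0, χ₀, hv₀⟩ := hF.exists_eigenvector hM N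
  set n := N + 1 with hn
  have hstab : ∀ m, n ≤ m → augIdeal k H ^ m = augIdeal k H ^ n := fun m hm => by
    rw [← hN' m (by omega), ← hN' n (by omega)]
  obtain ⟨i₀, hi₀⟩ := Function.ne_iff.1 hv0
  have hLI : augIdeal k H ^ n ≤ augIdeal k H := Ideal.pow_le_self (by omega)
  have hε : Coalgebra.counit (R := k) χ₀ = 1 := by
    have h := mem_augIdeal.1 (hLI (hv₀ i₀))
    rw [map_sub, hM.counit_orbit, map_smul, sub_eq_zero, smul_eq_mul] at h
    exact (mul_left_cancel₀ hi₀ ((mul_one _).trans h)).symm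
  -- Past stabilization `I ^ n = I ^ (2 * n)`, so `I ^ n` defines a subgroup, the identity
  -- component.
  have hL : ∀ x ∈ augIdeal k H ^ n, redComul k (augIdeal k H ^ n) x = 0 := by
    intro x hx
    rw [← hstab (2 * n) (by omega)] at hx
    exact redComul_augIdeal_pow_eq_zero le_rfl hx
  have hχ : redComul k (augIdeal k H ^ n) χ₀ = Ideal.Quotient.mkₐ k (augIdeal k H ^ n) χ₀ ⊗ₜ[k]
      Ideal.Quotient.mkₐ k (augIdeal k H ^ n) χ₀ := by
    have h := hL _ (hv₀ i₀)
    rw [map_sub, redComul_orbit hM hv₀, map_smul, sub_eq_zero] at h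
    exact (smul_right_injective _ hi₀ h).symm
  obtain ⟨q, b, hb⟩ := exists_basis_pow hF hv0 hv₀
  have horth := coordConv_mul_coordConv hb hL hχ
  have hsum := sum_coordConv hb hLI hε
  let E : Fin q → Module.End k V := fun l => r.actHom (coordConv b l)
  have hE : ∀ l m, E l * E m = if l = m then E l else 0 := by
    intro l m
    rw [← map_mul, horth]
    split_ifs
    · rfl
    · exact map_zero _
  have hEsum : ∑ l, E l = 1 := by
    rw [← map_sum, hsum, map_one]
  let Γ := WithConv (H →ₐ[k] k)
  have hfin : Finite Γ := Finite.of_equiv _ (WithConv.equiv (H →ₐ[k] k)).symm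
  let := Fintype.ofFinite Γ
  have hcard : (Fintype.card Γ : k) ≠ 0 := by
    rw [← Nat.card_eq_fintype_card]
    exact hF.card_ne_zero hM
  let ρ : Γ →* Module.End k V := r.actHom.toMonoidHom.comp (pointFunctional k H)
  -- A merely linear projection onto `W`; its average `f` still maps into `W` and acts there as
  -- multiplication by the order of `Γ`.
  obtain ⟨p, hp⟩ := W.subtype.exists_leftInverse_of_injective (Submodule.ker_subtype W)
  let e : Module.End k V := W.subtype ∘ₗ p
  have heW : ∀ w ∈ W, e w = w := fun w hw =>
    congrArg Subtype.val (LinearMap.congr_fun hp ⟨w, hw⟩)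
  have heV : ∀ x, e x ∈ W := fun x => (p x).2
  let f : Module.End k V := ∑ h, ρ h * (∑ l, E l * e * E l) * ρ h⁻¹
  have hstable := (r.isSubrep_iff W).1 hW
  have hfV : ∀ x, f x ∈ W := by
    intro x
    simp only [f, LinearMap.sum_apply, Module.End.mul_apply]
    exact W.sum_mem fun h _ => hstable _ _ (W.sum_mem fun l _ => hstable _ _ (heV _))
  have hfW : ∀ w ∈ W, f w = (Fintype.card Γ : k) • w := by
    intro w hw
    have h1 : ∀ h : Γ, (ρ h * (∑ l, E l * e * E l) * ρ h⁻¹) w = w := by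
      intro h
      have h2 : (∑ l, E l * e * E l) (ρ h⁻¹ w) = ρ h⁻¹ w := by
        have h3 : ∀ l, (E l * e * E l) (ρ h⁻¹ w) = E l (ρ h⁻¹ w) := by
          intro l
          have h4 : E l (ρ h⁻¹ w) ∈ W :=
            hstable (coordConv b l) _ (hstable (pointFunctional k H h⁻¹) _ hw)
          rw [Module.End.mul_apply, Module.End.mul_apply, heW _ h4, ← Module.End.mul_apply, hE, if_pos rfl]
        rw [LinearMap.sum_apply, Finset.sum_congr rfl fun l _ => h3 l, ← LinearMap.sum_apply, hEsum,
          Module.End.one_apply]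
      rw [Module.End.mul_apply, Module.End.mul_apply, h2, ← Module.End.mul_apply, ← map_mul,
        mul_inv_cancel, map_one, Module.End.one_apply]
    rw [LinearMap.sum_apply, Finset.sum_congr rfl fun h _ => h1 h, Finset.sum_const,
      Finset.card_univ, Nat.cast_smul_eq_nsmul]
  -- Functionals supported on the identity component are combinations of the weight idempotents.
  have hexp : ∀ x : WithConv (H →ₗ[k] k), (∀ h ∈ augIdeal k H ^ n, x.ofConv h = 0) →
      x = ∑ l : Fin q, x.ofConv (χ₀ ^ (l : ℕ)) • coordConv b l := by
    intro x hx
    ext h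
    have hh : h - ∑ j, (coordConv b j).ofConv h • χ₀ ^ (j : ℕ) ∈ augIdeal k H ^ n := by
      rw [← Ideal.Quotient.eq_zero_iff_mem]
      change Ideal.Quotient.mkₐ k _ _ = 0
      rw [map_sub, map_sum, sub_eq_zero, mk_eq_sum_coordConv hb h]
      simp only [map_smul, map_pow]
    have h1 := hx _ hh
    rw [map_sub, map_sum, sub_eq_zero] at h1
    rw [h1]
    simp [mul_comm]
  have hcomm : ∀ x, Commute f (r.actHom x) := by
    let P : Submodule k (WithConv (H →ₗ[k] k)) :=
      { carrier := {x | Commute f (r.actHom x)}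
        zero_mem' := by
          change Commute _ _
          rw [map_zero]; exact Commute.zero_right _
        add_mem' := fun {x y} hx hy => by
          change Commute _ _
          rw [map_add]; exact Commute.add_right hx hy
        smul_mem' := fun c x hx => by
          change Commute _ _
          rw [r.actHom_smul]; exact Commute.smul_right hx c }
    have hP : P = ⊤ := by
      -- It suffices to commute with products of a rational point and a functional supported on the
      -- identity component. Conjugation by rational points preserves this support, as
      -- `commute_average` requires.
      refine span_pointFunctional_mul_eq_top (hstab (n + 1) (by omega)) P fun g x hx => ?_
      change Commute f (r.actHom (pointFunctional k H g * x))
      rw [map_mul]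
      refine commute_average hE ρ e (fun h s hs => ?_) g
      have h1 : ∀ y ∈ augIdeal k H ^ n,
          (pointFunctional k H h⁻¹ * x * pointFunctional k H h).ofConv y = 0 := by
        intro y hy
        have := conj_pointFunctional_apply h⁻¹ x y
        rw [inv_inv] at this
        rw [this]
        exact hx _ (conjPoint_mem _ hy)
      have h2 : ρ h⁻¹ * r.actHom x * ρ h =
          r.actHom (pointFunctional k H h⁻¹ * x * pointFunctional k H h) := by
        rw [map_mul, map_mul]; rfl
      rw [h2, hexp _ h1, map_sum]
      refine Commute.sum_right _ _ _ fun l _ => ?_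
      rw [r.actHom_smul]
      exact Commute.smul_right (hs l) _
    intro x
    have : x ∈ P := by rw [hP]; trivial
    exact this
  let F : Module.End k V := (Fintype.card Γ : k)⁻¹ • f
  have hproj : LinearMap.IsProj W F :=
    ⟨fun x => W.smul_mem _ (hfV x), fun w hw => by
      change (Fintype.card Γ : k)⁻¹ • f w = w
      rw [hfW w hw, inv_smul_smul₀ hcard]⟩
  refine ⟨LinearMap.ker F, (r.isSubrep_iff _).2 fun x w hw => ?_, hproj.isCompl⟩
  have hFx : Commute F (r.actHom x) := Commute.smul_left (hcomm x) _
  rw [LinearMap.mem_ker] at hw ⊢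
  rw [← Module.End.mul_apply, hFx.eq, Module.End.mul_apply, hw, map_zero]

end Reductive

/-! ### Norms and invariants -/

section Norm

variable {k : Type u} {H : Type v} [Field k] [CommRing H]

/-- The norm of `B ⊗ H` over `B` is compatible with change of `B`. -/
theorem norm_map [Algebra k H] [Module.Finite k H] {B B' : Type*} [CommRing B] [Algebra k B]
    [CommRing B'] [Algebra k B'] (ψ : B →ₐ[k] B') (x : B ⊗[k] H) :
    Algebra.norm B' (Algebra.TensorProduct.map ψ (AlgHom.id k H) x) = ψ (Algebra.norm B x) := by
  classical
  let b := Module.Free.chooseBasis k H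
  have key : ∀ (y : B ⊗[k] H) i,
      (Algebra.TensorProduct.basis B' b).repr (Algebra.TensorProduct.map ψ (AlgHom.id k H) y) i =
        ψ ((Algebra.TensorProduct.basis B b).repr y i) := by
    intro y i
    induction y with
    | zero => simp
    | tmul c h => simp [Algebra.TensorProduct.basis_repr_tmul]
    | add y z hy hz => simp only [map_add, Finsupp.add_apply, hy, hz]
  rw [Algebra.norm_eq_matrix_det (Algebra.TensorProduct.basis B' b),
    Algebra.norm_eq_matrix_det (Algebra.TensorProduct.basis B b), AlgHom.map_det]
  congr 1
  ext i j
  rw [AlgHom.mapMatrix_apply, Matrix.map_apply, Algebra.leftMulMatrix_eq_repr_mul,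
    Algebra.leftMulMatrix_eq_repr_mul, ← key, map_mul (Algebra.TensorProduct.map ψ (AlgHom.id k H))]
  simp

variable [HopfAlgebra k H]

/-- Multiplication of the last variable of `B ⊗ H` by a `B`-valued point of `G`. -/
noncomputable def shear {B : Type w} [CommRing B] [Algebra k B] (g : WithConv (H →ₐ[k] B)) :
    B ⊗[k] H →ₐ[B] B ⊗[k] H :=
  Algebra.TensorProduct.lift (Algebra.ofId B _)
    (toConv (Algebra.TensorProduct.includeRight : H →ₐ[k] B ⊗[k] H) *
      pointsMap Algebra.TensorProduct.includeLeft g).ofConv (fun _ _ => Commute.all _ _)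

theorem shear_tmul {B : Type w} [CommRing B] [Algebra k B] (g : WithConv (H →ₐ[k] B)) (b : B)
    (h : H) : shear g (b ⊗ₜ h) = (b ⊗ₜ[k] 1) *
      (toConv (Algebra.TensorProduct.includeRight : H →ₐ[k] B ⊗[k] H) *
        pointsMap Algebra.TensorProduct.includeLeft g).ofConv h := by
  simp [shear, Algebra.ofId_apply]

theorem pointsMap_shear {B : Type w} [CommRing B] [Algebra k B] (g g' : WithConv (H →ₐ[k] B)) :
    pointsMap ((shear g').restrictScalars k)
      (toConv (Algebra.TensorProduct.includeRight : H →ₐ[k] B ⊗[k] H) *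
        pointsMap Algebra.TensorProduct.includeLeft g) =
    toConv (Algebra.TensorProduct.includeRight : H →ₐ[k] B ⊗[k] H) *
        pointsMap Algebra.TensorProduct.includeLeft (g' * g) := by
  rw [map_mul, map_mul, ← mul_assoc]
  congr 1
  · ext h
    change shear g' (1 ⊗ₜ h) = _
    rw [shear_tmul]
    exact one_mul _
  · ext h
    change shear g' (g.ofConv h ⊗ₜ 1) = g.ofConv h ⊗ₜ 1
    rw [shear_tmul, map_one, mul_one]

theorem shear_one {B : Type w} [CommRing B] [Algebra k B] :
    shear (1 : WithConv (H →ₐ[k] B)) = AlgHom.id B _ := by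
  ext h
  change shear 1 (1 ⊗ₜ h) = 1 ⊗ₜ h
  rw [shear_tmul, map_one, mul_one]
  exact one_mul _

theorem shear_comp_shear {B : Type w} [CommRing B] [Algebra k B] (g g' : WithConv (H →ₐ[k] B)) :
    (shear g').comp (shear g) = shear (g' * g) := by
  ext h
  change shear g' (shear g (1 ⊗ₜ h)) = shear (g' * g) (1 ⊗ₜ h)
  rw [shear_tmul, shear_tmul, ← pointsMap_shear, map_mul]
  congr 1
  rw [shear_tmul, map_one, mul_one]

/-- `shear` as an automorphism. -/
noncomputable def shearEquiv {B : Type w} [CommRing B] [Algebra k B] (g : WithConv (H →ₐ[k] B)) :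
    B ⊗[k] H ≃ₐ[B] B ⊗[k] H :=
  AlgEquiv.ofAlgHom (shear g) (shear (pointInv g))
    (by rw [shear_comp_shear, mul_pointInv, shear_one])
    (by rw [shear_comp_shear, pointInv_mul, shear_one])

theorem norm_shear {B : Type w} [CommRing B] [Algebra k B] (g : WithConv (H →ₐ[k] B))
    (x : B ⊗[k] H) : Algebra.norm B (shear g x) = Algebra.norm B x :=
  Algebra.norm_eq_of_algEquiv (shearEquiv g) x

variable {A : Type w} [CommRing A] [Algebra k A]

namespace Action

/-- The product of the translates of a function, as the norm of its coaction. -/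
noncomputable def norm (δ : Action k H A) (a : A) : A :=
  Algebra.norm A (Algebra.TensorProduct.comm k H A (δ.coact a))

theorem shear_coact (δ : Action k H A) (a : A) :
    shear (toConv (Algebra.TensorProduct.includeLeft : H →ₐ[k] H ⊗[k] A))
      (Algebra.TensorProduct.map (Algebra.TensorProduct.includeRight : A →ₐ[k] H ⊗[k] A)
        (AlgHom.id k H) (Algebra.TensorProduct.comm k H A (δ.coact a))) =
    Algebra.TensorProduct.map δ.coact (AlgHom.id k H)
      (Algebra.TensorProduct.comm k H A (δ.coact a)) := by
  have h1 : ∀ x : H ⊗[k] A, Algebra.TensorProduct.map δ.coact (AlgHom.id k H)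
      (Algebra.TensorProduct.comm k H A x) = Algebra.TensorProduct.comm k H (H ⊗[k] A)
        (Algebra.TensorProduct.map (AlgHom.id k H) δ.coact x) := by
    intro x
    induction x with
    | zero => simp
    | tmul h b => simp
    | add x y hx hy => simp only [map_add, hx, hy]
  rw [h1, ← coassoc_apply]
  induction δ.coact a with
  | zero => simp
  | add x y hx hy => simp only [map_add, hx, hy]
  | tmul h b =>
    simp only [Algebra.TensorProduct.comm_tmul, Algebra.TensorProduct.map_tmul, AlgHom.id_apply]
    rw [shear_tmul, AlgHom.convMul_apply, Bialgebra.comulAlgHom_apply]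
    induction Coalgebra.comul (R := k) h with
    | zero => simp
    | add x y hx hy => simp only [map_add, TensorProduct.add_tmul, mul_add, hx, hy]
    | tmul p q => simp [pointsMap_apply]

/-- The coaction of the norm is the norm after base change along `coact`. By `shear_coact` this
differs from the trivial base change by an automorphism of the algebra, which preserves norms. -/
theorem norm_mem_invariants [Module.Finite k H] (δ : Action k H A) (a : A) :
    δ.norm a ∈ δ.invariants := by
  rw [mem_invariants, norm, ← norm_map, ← shear_coact, norm_shear, norm_map]
  rfl

end Action

end Norm

/-! ### Restriction of power series to lines -/

section Line

variable {d : ℕ}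

/-- The parametrized line `t ↦ (w₁ t, …, w_d t)`. -/
noncomputable def line {R : Type*} [CommRing R] (w : Fin d → R) (i : Fin d) :
    MvPowerSeries Unit R :=
  MvPowerSeries.C (w i) * MvPowerSeries.X ()

theorem hasSubst_line {R : Type*} [CommRing R] (w : Fin d → R) :
    MvPowerSeries.HasSubst (line w) :=
  MvPowerSeries.hasSubst_of_constantCoeff_zero fun i => by simp [line]

theorem map_line {R S : Type*} [CommRing R] [CommRing S] (f : R →+* S) (w : Fin d → R) :
    (fun i => MvPowerSeries.map f (line w i)) = line (f ∘ w) := by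
  ext1 i
  simp [line]

/-- The restriction of a power series to a line with coordinates in `S` has coefficients
in `S`. -/
theorem coeff_subst_line_mem {k H : Type*} [Field k] [CommRing H] [Algebra k H]
    (S : Subalgebra k H) {w : Fin d → H} (hw : ∀ i, w i ∈ S) (f : MvPowerSeries (Fin d) k)
    (e : Unit →₀ ℕ) : MvPowerSeries.coeff e (MvPowerSeries.subst (line w) f) ∈ S := by
  rw [MvPowerSeries.coeff_subst (hasSubst_line w)]
  refine finsum_induction (· ∈ S) (zero_mem S) (fun _ _ => add_mem) fun c => ?_
  refine S.smul_mem ?_ _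
  -- The line is already defined over `S`, so the monomials in its coordinates have coefficients
  -- there.
  let w' : Fin d → S := fun i => ⟨w i, hw i⟩
  have h1 : line w = fun i => MvPowerSeries.map S.val.toRingHom (line w' i) := by
    rw [map_line]; rfl
  have h2 : (c.prod fun s e => line w s ^ e) =
      MvPowerSeries.map S.val.toRingHom (c.prod fun s e => line w' s ^ e) := by
    rw [h1, map_finsuppProd]
    simp
  rw [h2, MvPowerSeries.coeff_map]
  exact (MvPowerSeries.coeff e (c.prod fun s e => line w' s ^ e)).2

end Line

/-! ### Restricting the coaction to lines -/

section Evaluation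

variable {k : Type u} {H : Type v} [Field k] [CommRing H] [HopfAlgebra k H] {d : ℕ}

theorem tensorToPowerSeries_tmul (h : H) (a : MvPowerSeries (Fin d) k) :
    tensorToPowerSeries k H d (h ⊗ₜ a) =
      MvPowerSeries.C h * MvPowerSeries.map (algebraMap k H) a := by
  simp only [tensorToPowerSeries, Algebra.TensorProduct.lift_tmul]
  rfl

theorem tensorToPowerSeries_injective [Module.Finite k H] :
    Function.Injective (tensorToPowerSeries k H d) := by
  rw [injective_iff_map_eq_zero]
  intro z hz
  let b := Module.Free.chooseBasis k H
  have hzsum : ∃ a : Module.Free.ChooseBasisIndex k H → MvPowerSeries (Fin d) k,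
      z = ∑ i, b i ⊗ₜ a i := by
    clear hz
    induction z with
    | zero => exact ⟨0, by simp⟩
    | tmul h f =>
      refine ⟨fun i => b.repr h i • f, ?_⟩
      conv_lhs => rw [← b.sum_repr h]
      rw [TensorProduct.sum_tmul]
      simp [TensorProduct.smul_tmul]
    | add x y hx hy =>
      obtain ⟨p, rfl⟩ := hx
      obtain ⟨q, rfl⟩ := hy
      exact ⟨p + q, by simp [TensorProduct.tmul_add, Finset.sum_add_distrib]⟩
  obtain ⟨a, rfl⟩ := hzsum
  have ha : ∀ i, a i = 0 := by
    intro i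
    ext e
    have h1 := congrArg (MvPowerSeries.coeff e) hz
    rw [map_sum, map_sum, map_zero] at h1
    simp only [tensorToPowerSeries_tmul, MvPowerSeries.coeff_C_mul, MvPowerSeries.coeff_map] at h1
    have h2 : ∑ i, MvPowerSeries.coeff e (a i) • b i = 0 := by
      rw [← h1]
      exact Finset.sum_congr rfl fun i _ => by rw [Algebra.smul_def, mul_comm]
    exact Fintype.linearIndependent_iff.1 b.linearIndependent _ h2 i
  simp [ha]

/-- Restriction of the second factor of `H ⊗ k[[u]]` to the line through `v`. -/
noncomputable def evalLine (v : Fin d → k) :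
    H ⊗[k] MvPowerSeries (Fin d) k →ₐ[k] MvPowerSeries Unit H :=
  ((MvPowerSeries.substAlgHom (hasSubst_line (algebraMap k H ∘ v))).restrictScalars k).comp
    (tensorToPowerSeries k H d)

theorem evalLine_apply (v : Fin d → k) (z : H ⊗[k] MvPowerSeries (Fin d) k) :
    evalLine v z = MvPowerSeries.subst (line (algebraMap k H ∘ v)) (tensorToPowerSeries k H d z) := by
  rw [← MvPowerSeries.coe_substAlgHom (hasSubst_line (algebraMap k H ∘ v))]
  rfl

theorem evalLine_tmul (v : Fin d → k) (h : H) (a : MvPowerSeries (Fin d) k) :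
    evalLine v (h ⊗ₜ a) = MvPowerSeries.C h *
      MvPowerSeries.map (algebraMap k H) (MvPowerSeries.subst (line v) a) := by
  rw [evalLine_apply, tensorToPowerSeries_tmul, MvPowerSeries.subst_mul (hasSubst_line _),
    MvPowerSeries.map_subst (hasSubst_line v), map_line, MvPowerSeries.subst_C]

theorem hasSubst_linear (M : Matrix (Fin d) (Fin d) H) :
    MvPowerSeries.HasSubst fun i => ∑ j, MvPowerSeries.C (M i j) * MvPowerSeries.X j :=
  MvPowerSeries.hasSubst_of_constantCoeff_zero fun i => by simp

/-- The restriction of `f (M · u)` to the line through `v` is the restriction of `f` to the line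
through `M v`. -/
theorem evalLine_of_linear {M : Matrix (Fin d) (Fin d) H} {z : H ⊗[k] MvPowerSeries (Fin d) k}
    {f : MvPowerSeries (Fin d) k} (hz : tensorToPowerSeries k H d z =
      MvPowerSeries.subst (fun i => ∑ j, MvPowerSeries.C (M i j) * MvPowerSeries.X j) f)
    (v : Fin d → k) : evalLine v z = MvPowerSeries.subst (line (orbit M v)) f := by
  rw [evalLine_apply, hz,
    MvPowerSeries.subst_comp_subst_apply (hasSubst_linear M) (hasSubst_line _)]
  congr 1
  ext1 i
  rw [← MvPowerSeries.coe_substAlgHom (hasSubst_line _), map_sum, line, orbit, map_sum,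
    Finset.sum_mul]
  refine Finset.sum_congr rfl fun j _ => ?_
  rw [map_mul, MvPowerSeries.substAlgHom_X, MvPowerSeries.coe_substAlgHom, MvPowerSeries.subst_C,
    line, ← mul_assoc, ← map_mul, Algebra.smul_def, mul_comm (M i j)]
  rfl

end Evaluation

/-! ### Consequences of freeness outside the closed point -/

section Free

variable {k : Type u} {H : Type v} {A : Type w} [Field k] [CommRing H] [HopfAlgebra k H]
  [CommRing A] [Algebra k A]

namespace Action

/-- The homomorphism `a ⊗ b ↦ δ(a) (1 ⊗ b)`. -/
noncomputable def actionGraph (δ : Action k H A) : A ⊗[k] A →ₐ[k] H ⊗[k] A :=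
  Algebra.TensorProduct.lift δ.coact Algebra.TensorProduct.includeRight (fun _ _ => Commute.all _ _)

theorem actionGraph_tmul (δ : Action k H A) (a b : A) :
    δ.actionGraph (a ⊗ₜ b) = δ.coact a * (1 ⊗ₜ b) := by
  simp [actionGraph]

/-- If the action is free on `D(f)`, then `H ⊗ A` is generated by `δ(A)` and `A` up to
powers of `f`. -/
theorem exists_tmul_pow_mem_range [IsDomain A] (δ : Action k H A) {f : A} (hf : f ∈ δ.invariants)
    (hf0 : f ≠ 0) (hfree : (δ.restrict f hf).IsFree) (h : H) :
    ∃ N : ℕ, h ⊗ₜ[k] (f ^ N) ∈ δ.actionGraph.range := by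
  let B := Localization.Away f
  let ι : A →ₐ[k] B := IsScalarTower.toAlgHom k A B
  let Ψ : H ⊗[k] A →ₐ[k] H ⊗[k] B := Algebra.TensorProduct.map (AlgHom.id k H) ι
  have hι : Function.Injective ι := IsLocalization.injective B
    (powers_le_nonZeroDivisors_of_noZeroDivisors hf0)
  have hΨ : Function.Injective Ψ :=
    Module.Flat.lTensor_preserves_injective_linearMap (M := H) ι.toLinearMap hι
  have hcoact : ∀ a, (δ.restrict f hf).coact (ι a) = Ψ (δ.coact a) := δ.awayCoact_algebraMap f hf
  -- Denominators are powers of `f`, and `coact f = 1 ⊗ f`, so both factors of `z` can be cleared by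
  -- multiplying by `1 ⊗ f ^ N`. The result is then applied to a preimage of `h ⊗ 1` under the
  -- Galois map.
  have key : ∀ z, ∃ N : ℕ, ∃ y ∈ δ.actionGraph.range,
      Ψ y = (1 ⊗ₜ ι (f ^ N)) * (δ.restrict f hf).galoisMap z := by
    intro z
    induction z with
    | zero => exact ⟨0, 0, zero_mem _, by simp⟩
    | tmul a b =>
      obtain ⟨n, a', ha⟩ := IsLocalization.Away.surj f a
      obtain ⟨m, b', hb⟩ := IsLocalization.Away.surj f b
      refine ⟨n + m, _, ⟨a' ⊗ₜ b', rfl⟩, ?_⟩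
      change Ψ (δ.actionGraph (a' ⊗ₜ b')) = _
      rw [actionGraph_tmul, galoisMap_tmul, map_mul, ← hcoact]
      have h1 : ι a' = a * ι (f ^ n) := by rw [map_pow]; exact ha.symm
      have h2 : ι b' = b * ι (f ^ m) := by rw [map_pow]; exact hb.symm
      have h3 : Ψ (1 ⊗ₜ b') = 1 ⊗ₜ ι b' := by simp [Ψ]
      have h4 : (δ.restrict f hf).coact (ι (f ^ n)) = 1 ⊗ₜ ι (f ^ n) := by
        rw [hcoact, δ.mem_invariants.1 (pow_mem hf n)]
        simp [Ψ]
      have h5 : ∀ x y : B, (1 : H) ⊗ₜ[k] (x * y) = (1 ⊗ₜ x) * (1 ⊗ₜ y) := by simp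
      rw [h3, h1, h2, map_mul, h4, pow_add, map_mul ι, h5, h5]
      ring
    | add x y hx hy =>
      obtain ⟨n, p, hp, hp'⟩ := hx
      obtain ⟨m, q, hq, hq'⟩ := hy
      have hmem : ∀ j, (1 : H) ⊗ₜ[k] (f ^ j) ∈ δ.actionGraph.range :=
        fun j => ⟨1 ⊗ₜ (f ^ j), by
          change δ.actionGraph _ = _
          rw [actionGraph_tmul, map_one, one_mul]⟩
      have h1 : ∀ j, Ψ (1 ⊗ₜ (f ^ j)) = 1 ⊗ₜ ι (f ^ j) := fun j => by simp [Ψ]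
      have h5 : ∀ x y : B, (1 : H) ⊗ₜ[k] (x * y) = (1 ⊗ₜ x) * (1 ⊗ₜ y) := by simp
      refine ⟨n + m, (1 ⊗ₜ (f ^ m)) * p + (1 ⊗ₜ (f ^ n)) * q,
        add_mem (mul_mem (hmem _) hp) (mul_mem (hmem _) hq), ?_⟩
      rw [map_add, map_mul, map_mul, hp', hq', h1, h1, map_add, pow_add, map_mul ι, h5]
      ring
  obtain ⟨z, hz⟩ := hfree.2.2 (h ⊗ₜ 1)
  obtain ⟨N, y, hy, hyz⟩ := key z
  refine ⟨N, ?_⟩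
  have : y = h ⊗ₜ (f ^ N) := by
    apply hΨ
    rw [hyz, hz]
    simp [Ψ]
  rwa [← this]

theorem transport_coact_apply {B : Type w} [CommRing B] [Algebra k B] (δ : Action k H A)
    (φ : A ≃ₐ[k] B) (b : B) : (δ.transport φ).coact b =
      Algebra.TensorProduct.map (AlgHom.id k H) φ.toAlgHom (δ.coact (φ.symm b)) := rfl

theorem symm_mem_invariants {B : Type w} [CommRing B] [Algebra k B] (δ : Action k H A)
    (φ : A ≃ₐ[k] B) {f : B} (hf : f ∈ (δ.transport φ).invariants) :
    φ.symm f ∈ δ.invariants := by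
  rw [mem_invariants] at hf ⊢
  rw [transport_coact_apply] at hf
  have hinv : ∀ x : H ⊗[k] A, Algebra.TensorProduct.map (AlgHom.id k H) φ.symm.toAlgHom
      (Algebra.TensorProduct.map (AlgHom.id k H) φ.toAlgHom x) = x := by
    intro x
    induction x with
    | zero => simp
    | tmul h a => simp
    | add x y hx hy => simp only [map_add, hx, hy]
  rw [← hinv (δ.coact (φ.symm f)), hf]
  simp

theorem actionGraph_transport_mem {B : Type w} [CommRing B] [Algebra k B] (δ : Action k H A)
    (φ : A ≃ₐ[k] B) {x : H ⊗[k] A} (hx : x ∈ δ.actionGraph.range) :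
    Algebra.TensorProduct.map (AlgHom.id k H) φ.toAlgHom x ∈ (δ.transport φ).actionGraph.range := by
  obtain ⟨z, rfl⟩ := hx
  refine ⟨Algebra.TensorProduct.map φ.toAlgHom φ.toAlgHom z, ?_⟩
  change (δ.transport φ).actionGraph _ = Algebra.TensorProduct.map _ _ (δ.actionGraph z)
  induction z with
  | zero => simp
  | tmul a b => simp [actionGraph_tmul, transport_coact_apply]
  | add x y hx hy => simp only [map_add, hx, hy]

end Action

end Free

/-! ### Linear actions free outside the origin have free orbits -/

section LinearFree

variable {k : Type u} {H : Type v} [Field k] [CommRing H] [HopfAlgebra k H] {d : ℕ}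

/-- Some linear form does not vanish on the orbit of a nonzero vector. -/
theorem exists_isUnit_sum_orbit [IsAlgClosed k] [Module.Finite k H]
    {M : Matrix (Fin d) (Fin d) H} (hM : IsComatrix k M) {v : Fin d → k} (hv : v ≠ 0) :
    ∃ c : Fin d → k, IsUnit (∑ i, c i • orbit M v i) := by
  have hfin : Finite (H →ₐ[k] k) := inferInstance
  -- The linear forms vanishing at the translate `g v`. As `g v ≠ 0`, these subspaces are proper;
  -- being finite in number over an infinite field, they do not cover the space of forms. A form
  -- outside them all gives a function in no maximal ideal of `H`.
  let p : (H →ₐ[k] k) → Submodule k (Fin d → k) := fun g =>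
    LinearMap.ker (∑ i, (g (orbit M v i)) • LinearMap.proj (R := k) (φ := fun _ : Fin d => k) i)
  have hp : ∀ g, p g ≠ ⊤ := by
    intro g hg
    have h0 : ∀ i, g (orbit M v i) = 0 := by
      intro i
      have h1 : (Pi.single i 1 : Fin d → k) ∈ p g := by rw [hg]; trivial
      have h2 := LinearMap.mem_ker.1 h1
      simpa [LinearMap.sum_apply, Pi.single_apply] using h2
    have h3 : (M.map g).mulVec v = 0 := by
      ext i
      rw [Pi.zero_apply, ← h0 i]
      exact (map_orbit_eq_mulVec M v g.toLinearMap i).symm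
    have h4 := hM.map_mul (toConv g)⁻¹ (toConv g)
    rw [inv_mul_cancel, hM.map_one] at h4
    apply hv
    rw [← Matrix.one_mulVec v, h4, ← Matrix.mulVec_mulVec]
    exact (congrArg _ h3).trans (Matrix.mulVec_zero _)
  have hunion : ⋃ g, (p g : Set (Fin d → k)) ≠ Set.univ := fun h =>
    let ⟨g, hg⟩ := Subspace.exists_eq_top_of_iUnion_eq_univ h
    hp g hg
  obtain ⟨c, hc⟩ := (Set.ne_univ_iff_exists_notMem _).1 hunion
  refine ⟨c, ?_⟩
  by_contra hu
  obtain ⟨m, hm, hcm⟩ := exists_max_ideal_of_mem_nonunits hu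
  obtain ⟨g, rfl⟩ := exists_point_of_isMaximal (k := k) m
  refine hc (Set.mem_iUnion.2 ⟨g, LinearMap.mem_ker.2 ?_⟩)
  rw [RingHom.mem_ker, map_sum] at hcm
  rw [LinearMap.sum_apply, ← hcm]
  refine Finset.sum_congr rfl fun i _ => ?_
  rw [map_smul, smul_eq_mul, mul_comm]
  rfl

theorem coact_linearForm [Module.Finite k H] {δ : Action k H (MvPowerSeries (Fin d) k)}
    {M : Matrix (Fin d) (Fin d) H}
    (hδ : ∀ f : MvPowerSeries (Fin d) k, tensorToPowerSeries k H d (δ.coact f) =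
      MvPowerSeries.subst (fun i => ∑ j, MvPowerSeries.C (M i j) * MvPowerSeries.X j) f)
    (c : Fin d → k) :
    δ.coact (∑ i, c i • MvPowerSeries.X i) = ∑ i, ∑ j, (c i • M i j) ⊗ₜ MvPowerSeries.X j := by
  rw [map_sum]
  refine Finset.sum_congr rfl fun i _ => ?_
  apply tensorToPowerSeries_injective
  rw [map_smul, map_smul, hδ, MvPowerSeries.subst_X (hasSubst_linear M), map_sum, Finset.smul_sum]
  refine Finset.sum_congr rfl fun j _ => ?_
  rw [← TensorProduct.smul_tmul', map_smul, tensorToPowerSeries_tmul, MvPowerSeries.map_X]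

/-- For a linear action, there are invariant functions that vanish at the origin but not on a
given line. -/
theorem exists_invariant_subst_line_ne_zero [IsAlgClosed k] [Module.Finite k H]
    {δ : Action k H (MvPowerSeries (Fin d) k)} {M : Matrix (Fin d) (Fin d) H}
    (hM : IsComatrix k M)
    (hδ : ∀ f : MvPowerSeries (Fin d) k, tensorToPowerSeries k H d (δ.coact f) =
      MvPowerSeries.subst (fun i => ∑ j, MvPowerSeries.C (M i j) * MvPowerSeries.X j) f)
    {v : Fin d → k} (hv : v ≠ 0) :
    ∃ f ∈ δ.invariants, MvPowerSeries.constantCoeff f = 0 ∧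
      MvPowerSeries.subst (line v) f ≠ 0 := by
  obtain ⟨c, hc⟩ := exists_isUnit_sum_orbit hM hv
  have hH : Nontrivial H := ⟨0, 1, fun h => zero_ne_one (α := k) (by
    have := congrArg (Coalgebra.counit (R := k)) h
    simp at this)⟩
  -- The norm of a linear form that vanishes nowhere on the orbit of `v`.
  refine ⟨_, δ.norm_mem_invariants (∑ i, c i • MvPowerSeries.X i), ?_, ?_⟩
  · have h1 := norm_map (H := H) (Action.closedPt k d) (Algebra.TensorProduct.comm k H _
      (δ.coact (∑ i, c i • MvPowerSeries.X i)))
    refine h1.symm.trans ?_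
    have h2 : Algebra.TensorProduct.map (Action.closedPt k d) (AlgHom.id k H)
        (Algebra.TensorProduct.comm k H _ (δ.coact (∑ i, c i • MvPowerSeries.X i))) = 0 := by
      have h3 : ∀ j, Action.closedPt k d (MvPowerSeries.X j) = 0 := MvPowerSeries.constantCoeff_X
      rw [coact_linearForm hδ]
      simp [h3]
    rw [h2]
    exact Algebra.norm_zero
  · let L : MvPowerSeries (Fin d) k →ₐ[k] MvPowerSeries Unit k :=
      MvPowerSeries.substAlgHom (hasSubst_line v)
    have h1 := norm_map (H := H) L (Algebra.TensorProduct.comm k H _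
      (δ.coact (∑ i, c i • MvPowerSeries.X i)))
    have hL : ∀ f, L f = MvPowerSeries.subst (line v) f := fun f => by
      rw [← MvPowerSeries.coe_substAlgHom (hasSubst_line v)]
    rw [hL] at h1
    refine fun h0 => ?_
    -- Along the line the coaction of the form is the parameter times a unit, so its norm is a power
    -- of the parameter times a unit.
    have h2 : Algebra.TensorProduct.map L (AlgHom.id k H)
        (Algebra.TensorProduct.comm k H _ (δ.coact (∑ i, c i • MvPowerSeries.X i))) =
        algebraMap (MvPowerSeries Unit k) (MvPowerSeries Unit k ⊗[k] H) (MvPowerSeries.X ()) * (1 ⊗ₜ[k] (∑ i, c i • orbit M v i)) := by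
      rw [coact_linearForm hδ]
      simp only [map_sum, Algebra.TensorProduct.comm_tmul, Algebra.TensorProduct.map_tmul,
        AlgHom.id_apply, hL, MvPowerSeries.subst_X (hasSubst_line v), line, orbit, Finset.smul_sum,
        TensorProduct.tmul_sum, Finset.mul_sum, Algebra.TensorProduct.algebraMap_apply,
        Algebra.TensorProduct.tmul_mul_tmul, mul_one, one_mul]
      refine Finset.sum_congr rfl fun i _ => Finset.sum_congr rfl fun j _ => ?_
      rw [← MvPowerSeries.smul_eq_C_mul, TensorProduct.smul_tmul, smul_comm]
      rfl
    have h3 := h1.trans h0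
    rw [h2, map_mul, Algebra.norm_algebraMap] at h3
    have h4 : IsUnit (Algebra.norm (MvPowerSeries Unit k)
        ((1 : MvPowerSeries Unit k) ⊗ₜ[k] (∑ i, c i • orbit M v i))) :=
      (hc.map (Algebra.TensorProduct.includeRight : H →ₐ[k] MvPowerSeries Unit k ⊗[k] H)).map
        (Algebra.norm (MvPowerSeries Unit k))
    have h5 := (h4.mul_left_eq_zero).1 h3
    have h6 := congrArg (MvPowerSeries.coeff (Finsupp.single () 1)) (eq_zero_of_pow_eq_zero h5)
    rw [MvPowerSeries.coeff_X, if_pos rfl, map_zero] at h6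
    exact one_ne_zero h6

/-- A linear action that is free outside the closed point has free orbits. -/
theorem hasFreeOrbits_of_transport [IsAlgClosed k] [Module.Finite k H]
    {δ : Action k H (MvPowerSeries (Fin d) k)} (hfree : δ.IsFreeOutsideClosedPoint)
    (φ : MvPowerSeries (Fin d) k ≃ₐ[k] MvPowerSeries (Fin d) k)
    {M : Matrix (Fin d) (Fin d) H} (hM : IsComatrix k M)
    (hδ : ∀ f : MvPowerSeries (Fin d) k,
      tensorToPowerSeries k H d ((δ.transport φ).coact f) =
      MvPowerSeries.subst (fun i => ∑ j, MvPowerSeries.C (M i j) * MvPowerSeries.X j) f) :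
    HasFreeOrbits k M := by
  intro v hv
  have hdom : IsDomain (MvPowerSeries (Fin d) k) := NoZeroDivisors.to_isDomain _
  have hdom' : IsDomain (MvPowerSeries Unit k) := NoZeroDivisors.to_isDomain _
  obtain ⟨f, hf, hf0, hfv⟩ := exists_invariant_subst_line_ne_zero hM hδ hv
  have hfne : φ.symm f ≠ 0 := by
    intro h
    rw [map_eq_zero_iff _ φ.symm.injective] at h
    rw [h, ← MvPowerSeries.coe_substAlgHom (hasSubst_line v), map_zero] at hfv
    exact hfv rfl
  have hfm : φ.symm f ∈ IsLocalRing.maximalIdeal (MvPowerSeries (Fin d) k) := by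
    rw [IsLocalRing.mem_maximalIdeal, mem_nonunits_iff, MulEquiv.isUnit_map,
      MvPowerSeries.isUnit_iff_constantCoeff, hf0]
    exact not_isUnit_zero
  rw [eq_top_iff]
  intro h _
  obtain ⟨N, hN⟩ := δ.exists_tmul_pow_mem_range (δ.symm_mem_invariants φ hf) hfne
    (hfree _ (δ.symm_mem_invariants φ hf) hfm) h
  have hN' := δ.actionGraph_transport_mem φ hN
  have hN2 : Algebra.TensorProduct.map (AlgHom.id k H) φ.toAlgHom (h ⊗ₜ[k] (φ.symm f ^ N)) =
      h ⊗ₜ[k] (f ^ N) := by simp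
  rw [hN2] at hN'
  set S := Algebra.adjoin k (Set.range (orbit M v))
  -- On the line through `v`, `coact a` becomes `a` along the line through the orbit point, with
  -- coefficients in `S`; the second factor `b` contributes scalars.
  have hS : ∀ z ∈ (δ.transport φ).actionGraph.range, ∀ e,
      MvPowerSeries.coeff e (evalLine v z) ∈ S := by
    rintro _ ⟨z, rfl⟩
    change ∀ e, MvPowerSeries.coeff e (evalLine v ((δ.transport φ).actionGraph z)) ∈ S
    induction z with
    | zero => intro e; simp
    | tmul a b =>
      intro e
      rw [Action.actionGraph_tmul, map_mul, evalLine_of_linear (hδ a), evalLine_tmul,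
        MvPowerSeries.coeff_mul]
      refine sum_mem fun q _ => mul_mem ?_ ?_
      · exact coeff_subst_line_mem S (fun i => Algebra.subset_adjoin ⟨i, rfl⟩) a q.1
      · rw [map_one, one_mul, MvPowerSeries.coeff_map]
        exact S.algebraMap_mem _
    | add x y hx hy =>
      intro e
      rw [map_add, map_add, map_add]
      exact add_mem (hx e) (hy e)
  have hpow : MvPowerSeries.subst (line v) (f ^ N) ≠ 0 := by
    rw [MvPowerSeries.subst_pow (hasSubst_line v)]
    exact pow_ne_zero _ hfv
  -- Some coefficient of `f ^ N` on the line is a nonzero scalar, and `h` times that scalar lies in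
  -- `S`.
  obtain ⟨e, he⟩ := (MvPowerSeries.ne_zero_iff_exists_coeff_ne_zero _).1 hpow
  have h1 := hS _ hN' e
  rw [evalLine_tmul, MvPowerSeries.coeff_C_mul, MvPowerSeries.coeff_map, mul_comm,
    ← Algebra.smul_def] at h1
  have h2 := S.smul_mem h1 (MvPowerSeries.coeff e (MvPowerSeries.subst (line v) (f ^ N)))⁻¹
  rwa [inv_smul_smul₀ he] at h2

end LinearFree

/-! ### Power series of given order and formal inverse functions -/

section Order

variable {σ R : Type*} [CommRing R]

/-- The ideal of power series of order at least `n`. -/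
def orderIdeal (σ R : Type*) [CommRing R] (n : ℕ) : Ideal (MvPowerSeries σ R) where
  carrier := {f | (n : ℕ∞) ≤ f.order}
  zero_mem' := by simp
  add_mem' hf hg := (le_min hf hg).trans MvPowerSeries.min_order_le_add
  smul_mem' c f hf := (le_add_of_nonneg_of_le zero_le hf).trans MvPowerSeries.le_order_mul

theorem mem_orderIdeal {n : ℕ} {f : MvPowerSeries σ R} :
    f ∈ orderIdeal σ R n ↔ ∀ e, e.degree < n → MvPowerSeries.coeff e f = 0 :=
  ⟨fun h _ he => MvPowerSeries.coeff_of_lt_order (lt_of_lt_of_le (Nat.cast_lt.2 he) h),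
    MvPowerSeries.nat_le_order⟩

theorem mem_orderIdeal_one {f : MvPowerSeries σ R} :
    f ∈ orderIdeal σ R 1 ↔ MvPowerSeries.constantCoeff f = 0 := by
  rw [mem_orderIdeal, ← MvPowerSeries.coeff_zero_eq_constantCoeff_apply]
  refine ⟨fun h => h 0 (by simp), fun h e he => ?_⟩
  rw [(Finsupp.degree_eq_zero_iff e).1 (Nat.lt_one_iff.1 he), h]

theorem mul_mem_orderIdeal {m n : ℕ} {f g : MvPowerSeries σ R} (hf : f ∈ orderIdeal σ R m)
    (hg : g ∈ orderIdeal σ R n) : f * g ∈ orderIdeal σ R (m + n) := by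
  change ((m + n : ℕ) : ℕ∞) ≤ _
  rw [Nat.cast_add]
  exact (add_le_add hf hg).trans MvPowerSeries.le_order_mul

theorem orderIdeal_le {m n : ℕ} (h : m ≤ n) : orderIdeal σ R n ≤ orderIdeal σ R m :=
  fun _ hf => (Nat.cast_le.2 h : (m : ℕ∞) ≤ n).trans hf

theorem eq_of_sub_mem_orderIdeal {f g : MvPowerSeries σ R}
    (h : ∀ n, f - g ∈ orderIdeal σ R n) : f = g := by
  rw [← sub_eq_zero]
  ext e
  exact mem_orderIdeal.1 (h (e.degree + 1)) e (Nat.lt_succ_self _)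

theorem X_mem_orderIdeal (i : σ) : MvPowerSeries.X i ∈ orderIdeal σ R 1 :=
  mem_orderIdeal_one.2 (MvPowerSeries.constantCoeff_X i)

theorem sub_C_mem_orderIdeal (f : MvPowerSeries σ R) :
    f - MvPowerSeries.C (MvPowerSeries.constantCoeff f) ∈ orderIdeal σ R 1 :=
  mem_orderIdeal_one.2 (by simp)

theorem mem_orderIdeal_two {f : MvPowerSeries σ R} :
    f ∈ orderIdeal σ R 2 ↔ MvPowerSeries.constantCoeff f = 0 ∧
      ∀ i, MvPowerSeries.coeff (Finsupp.single i 1) f = 0 := by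
  rw [mem_orderIdeal, ← MvPowerSeries.coeff_zero_eq_constantCoeff_apply]
  refine ⟨fun h => ⟨h 0 (by simp), fun i => h _ (by simp)⟩, fun h e he => ?_⟩
  rcases Nat.lt_succ_iff_lt_or_eq.1 he with he | he
  · rw [(Finsupp.degree_eq_zero_iff e).1 (Nat.lt_one_iff.1 he), h.1]
  · obtain ⟨i, rfl⟩ : e ∈ Set.range fun i : σ => Finsupp.single i 1 := by
      rw [Finsupp.range_single_one]; exact he
    exact h.2 i

/-- Every nonconstant monomial is assigned to one chosen variable dividing it. This serves as a
substitute for continuity in the lemmas below. -/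
theorem exists_eq_sum_X_mul [Fintype σ] {n : ℕ} {f : MvPowerSeries σ R}
    (hf : f ∈ orderIdeal σ R (n + 1)) :
    ∃ g : σ → MvPowerSeries σ R, (∀ i, g i ∈ orderIdeal σ R n) ∧
      f = ∑ i, MvPowerSeries.X i * g i := by
  classical
  have hsel : ∃ s : (σ →₀ ℕ) → Option σ, s 0 = none ∧ ∀ e ≠ 0, ∃ i, s e = some i ∧ e i ≠ 0 := by
    have h : ∀ e : σ →₀ ℕ, e ≠ 0 → ∃ i, e i ≠ 0 := fun e he => by
      by_contra! h
      exact he (Finsupp.ext h)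
    choose s hs using h
    refine ⟨fun e => if he : e = 0 then none else some (s e he), by simp, fun e he =>
      ⟨s e he, by simp [he], hs e he⟩⟩
  obtain ⟨s, -, hs⟩ := hsel
  rw [mem_orderIdeal] at hf
  let g : σ → MvPowerSeries σ R := fun i e => if s (e + Finsupp.single i 1) = some i then
    MvPowerSeries.coeff (e + Finsupp.single i 1) f else 0
  have hg : ∀ i e, MvPowerSeries.coeff e (g i) = if s (e + Finsupp.single i 1) = some i then
    MvPowerSeries.coeff (e + Finsupp.single i 1) f else 0 := fun _ _ => rfl
  refine ⟨g, fun i => ?_, ?_⟩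
  · rw [mem_orderIdeal]
    intro e he
    rw [hg]
    split_ifs
    · exact hf _ (by simpa using he)
    · rfl
  · ext e
    rw [map_sum]
    by_cases he : e = 0
    · subst he
      rw [hf 0 (by simp)]
      refine (Finset.sum_eq_zero fun i _ => ?_).symm
      simp
    · obtain ⟨i, hi, hei⟩ := hs e he
      have hle : ∀ j, e j ≠ 0 → Finsupp.single j 1 ≤ e := fun j hj =>
        Finsupp.single_le_iff.2 (Nat.one_le_iff_ne_zero.2 hj)
      have hcoeff : ∀ j (g : MvPowerSeries σ R), e j ≠ 0 → MvPowerSeries.coeff e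
          (MvPowerSeries.X j * g) = MvPowerSeries.coeff (e - Finsupp.single j 1) g := by
        intro j g hj
        rw [MvPowerSeries.X_def, MvPowerSeries.coeff_monomial_mul, if_pos (hle j hj), one_mul]
      rw [Finset.sum_eq_single i, hcoeff i _ hei]
      · rw [hg, tsub_add_cancel_of_le (hle i hei), if_pos hi]
      · intro j _ hj
        by_cases hej : e j = 0
        · rw [MvPowerSeries.X_def, MvPowerSeries.coeff_monomial_mul, if_neg]
          intro h
          exact (Nat.one_le_iff_ne_zero.1 (Finsupp.single_le_iff.1 h)) hej
        · rw [hcoeff j _ hej]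
          rw [hg, tsub_add_cancel_of_le (hle j hej), hi, if_neg]
          intro h
          exact hj (Option.some.inj h).symm
      · simp

variable {τ S : Type*} [CommRing S] [Fintype σ]

/-- No continuity is assumed: variables are split off one at a time, each contributing order at
least one. -/
theorem map_mem_orderIdeal {θ : MvPowerSeries σ R →+* MvPowerSeries τ S}
    (hX : ∀ i, θ (MvPowerSeries.X i) ∈ orderIdeal τ S 1) {n : ℕ} {f : MvPowerSeries σ R}
    (hf : f ∈ orderIdeal σ R n) : θ f ∈ orderIdeal τ S n := by
  induction n generalizing f with
  | zero => exact mem_orderIdeal.2 fun e he => absurd he (Nat.not_lt_zero _)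
  | succ n ih =>
    obtain ⟨g, hg, rfl⟩ := exists_eq_sum_X_mul hf
    rw [map_sum]
    refine sum_mem fun i _ => ?_
    rw [map_mul, add_comm n 1]
    exact mul_mem_orderIdeal (hX i) (ih (hg i))

/-- Homomorphisms of power series rings that agree on variables up to order `n` agree up to order
`n`. -/
theorem sub_mem_orderIdeal {θ ψ : MvPowerSeries σ R →+* MvPowerSeries τ S}
    (hC : ∀ c, θ (MvPowerSeries.C c) = ψ (MvPowerSeries.C c))
    (hX : ∀ i, θ (MvPowerSeries.X i) ∈ orderIdeal τ S 1) {n : ℕ}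
    (h : ∀ i, θ (MvPowerSeries.X i) - ψ (MvPowerSeries.X i) ∈ orderIdeal τ S n)
    (f : MvPowerSeries σ R) : θ f - ψ f ∈ orderIdeal τ S n := by
  suffices ∀ m ≤ n, ∀ f, θ f - ψ f ∈ orderIdeal τ S m from this n le_rfl f
  intro m
  induction m with
  | zero => exact fun _ f => mem_orderIdeal.2 fun e he => absurd he (Nat.not_lt_zero _)
  | succ m ih =>
    intro hm f
    obtain ⟨g, -, hfg⟩ := exists_eq_sum_X_mul (n := 0) (sub_C_mem_orderIdeal f)
    rw [eq_add_of_sub_eq hfg, map_add, map_add, hC, add_sub_add_right_eq_sub, map_sum, map_sum,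
      ← Finset.sum_sub_distrib]
    refine sum_mem fun i _ => ?_
    have e : θ (MvPowerSeries.X i * g i) - ψ (MvPowerSeries.X i * g i) =
        θ (MvPowerSeries.X i) * (θ (g i) - ψ (g i)) +
        ψ (g i) * (θ (MvPowerSeries.X i) - ψ (MvPowerSeries.X i)) := by
      rw [map_mul, map_mul]; ring
    rw [e]
    refine add_mem ?_ (Ideal.mul_mem_left _ _ (orderIdeal_le hm (h i)))
    rw [add_comm m 1]
    exact mul_mem_orderIdeal (hX i) (ih (by omega) _)

/-- Terms of order at least two gain one order of agreement. This is the contraction estimate behind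
the inverse function theorem. -/
theorem sub_mem_orderIdeal_succ {θ ψ : MvPowerSeries σ R →+* MvPowerSeries τ S}
    (hC : ∀ c, θ (MvPowerSeries.C c) = ψ (MvPowerSeries.C c))
    (hX : ∀ i, θ (MvPowerSeries.X i) ∈ orderIdeal τ S 1)
    (hX' : ∀ i, ψ (MvPowerSeries.X i) ∈ orderIdeal τ S 1) {n : ℕ}
    (h : ∀ i, θ (MvPowerSeries.X i) - ψ (MvPowerSeries.X i) ∈ orderIdeal τ S n)
    {f : MvPowerSeries σ R} (hf : f ∈ orderIdeal σ R 2) : θ f - ψ f ∈ orderIdeal τ S (n + 1) := by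
  obtain ⟨g, hg, rfl⟩ := exists_eq_sum_X_mul hf
  rw [map_sum, map_sum, ← Finset.sum_sub_distrib]
  refine sum_mem fun i _ => ?_
  have e : θ (MvPowerSeries.X i * g i) - ψ (MvPowerSeries.X i * g i) =
      θ (MvPowerSeries.X i) * (θ (g i) - ψ (g i)) +
      (θ (MvPowerSeries.X i) - ψ (MvPowerSeries.X i)) * ψ (g i) := by
    rw [map_mul, map_mul]; ring
  rw [e]
  refine add_mem ?_ (mul_mem_orderIdeal (h i) (map_mem_orderIdeal hX' (hg i)))
  rw [add_comm n 1]
  exact mul_mem_orderIdeal (hX i) (sub_mem_orderIdeal hC hX h _)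

theorem ringHom_eq_of_X {θ ψ : MvPowerSeries σ R →+* MvPowerSeries τ S}
    (hC : ∀ c, θ (MvPowerSeries.C c) = ψ (MvPowerSeries.C c))
    (hX : ∀ i, θ (MvPowerSeries.X i) ∈ orderIdeal τ S 1)
    (h : ∀ i, θ (MvPowerSeries.X i) = ψ (MvPowerSeries.X i)) : θ = ψ :=
  RingHom.ext fun f => eq_of_sub_mem_orderIdeal fun n =>
    sub_mem_orderIdeal hC hX (fun i => by rw [h i, sub_self]; exact zero_mem _) f

end Order

/-! ### The formal inverse function theorem -/

section InverseFunction

variable {σ k : Type*} [Field k]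

theorem mem_orderIdeal_one_of_sub_X {v : MvPowerSeries σ k} {i : σ}
    (hv : v - MvPowerSeries.X i ∈ orderIdeal σ k 2) : v ∈ orderIdeal σ k 1 := by
  have h := add_mem (orderIdeal_le one_le_two hv) (X_mem_orderIdeal i)
  rwa [sub_add_cancel] at h

theorem algHom_C {A : Type*} [CommRing A] [Algebra k A] (θ : MvPowerSeries σ k →ₐ[k] A) (c : k) :
    θ (MvPowerSeries.C c) = algebraMap k A c :=
  θ.commutes c

variable [Fintype σ]

theorem hasSubst_of_mem_orderIdeal {v : σ → MvPowerSeries σ k}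
    (hv : ∀ i, v i ∈ orderIdeal σ k 1) : MvPowerSeries.HasSubst v :=
  MvPowerSeries.hasSubst_of_constantCoeff_zero fun i => mem_orderIdeal_one.1 (hv i)

/-- The substitution homomorphism `f ↦ f(v)`. -/
noncomputable def substHom (v : σ → MvPowerSeries σ k) (hv : ∀ i, v i ∈ orderIdeal σ k 1) :
    MvPowerSeries σ k →ₐ[k] MvPowerSeries σ k :=
  MvPowerSeries.substAlgHom (hasSubst_of_mem_orderIdeal hv)

theorem substHom_X (v : σ → MvPowerSeries σ k) (hv : ∀ i, v i ∈ orderIdeal σ k 1) (i : σ) :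
    substHom v hv (MvPowerSeries.X i) = v i :=
  MvPowerSeries.substAlgHom_X _ _

theorem substHom_sub_mem_succ {v v' : σ → MvPowerSeries σ k} (hv : ∀ i, v i ∈ orderIdeal σ k 1)
    (hv' : ∀ i, v' i ∈ orderIdeal σ k 1) {n : ℕ} (h : ∀ i, v i - v' i ∈ orderIdeal σ k n)
    {f : MvPowerSeries σ k} (hf : f ∈ orderIdeal σ k 2) :
    substHom v hv f - substHom v' hv' f ∈ orderIdeal σ k (n + 1) :=
  sub_mem_orderIdeal_succ (θ := (substHom v hv).toRingHom) (ψ := (substHom v' hv').toRingHom)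
    (fun c => (algHom_C _ c).trans (algHom_C _ c).symm)
    (fun i => (substHom_X v hv i).symm ▸ hv i) (fun i => (substHom_X v' hv' i).symm ▸ hv' i)
    (fun i => by
      change substHom v hv _ - substHom v' hv' _ ∈ _
      rw [substHom_X, substHom_X]; exact h i) hf

theorem substHom_mem {v : σ → MvPowerSeries σ k} (hv : ∀ i, v i ∈ orderIdeal σ k 1) {n : ℕ}
    {f : MvPowerSeries σ k} (hf : f ∈ orderIdeal σ k n) : substHom v hv f ∈ orderIdeal σ k n :=
  map_mem_orderIdeal (θ := (substHom v hv).toRingHom)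
    (fun i => (substHom_X v hv i).symm ▸ hv i) hf

/-- A formal right inverse of a tuple of power series tangent to the identity. -/
theorem exists_substHom_eq_X {v : σ → MvPowerSeries σ k}
    (hv : ∀ i, v i - MvPowerSeries.X i ∈ orderIdeal σ k 2) :
    ∃ (w : σ → MvPowerSeries σ k) (hw : ∀ i, w i ∈ orderIdeal σ k 1),
      (∀ i, w i - MvPowerSeries.X i ∈ orderIdeal σ k 2) ∧
        ∀ i, substHom w hw (v i) = MvPowerSeries.X i := by
  let T := {w : σ → MvPowerSeries σ k // ∀ i, w i - MvPowerSeries.X i ∈ orderIdeal σ k 2}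
  have hT : ∀ w : T, ∀ i, w.1 i ∈ orderIdeal σ k 1 := fun w i =>
    mem_orderIdeal_one_of_sub_X (w.2 i)
  -- The equation `v(w) = X` is the fixed point equation `w = X - (v - X)(w)`, whose right-hand side
  -- is contracting because `v - X` has order at least two.
  let next : T → T := fun w =>
    ⟨fun i => MvPowerSeries.X i - substHom w.1 (hT w) (v i - MvPowerSeries.X i), fun i => by
      rw [sub_sub_cancel_left]
      exact neg_mem (substHom_mem (hT w) (hv i))⟩
  let W : ℕ → T := fun n => next^[n] ⟨MvPowerSeries.X, fun i => by
    rw [sub_self]; exact zero_mem _⟩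
  have hW : ∀ n i, (W (n + 1)).1 i =
      MvPowerSeries.X i - substHom (W n).1 (hT (W n)) (v i - MvPowerSeries.X i) := by
    intro n i
    change (next^[n + 1] _).1 i = _
    rw [Function.iterate_succ_apply']
  have hstep : ∀ n i, (W (n + 1)).1 i - (W n).1 i ∈ orderIdeal σ k (n + 1) := by
    intro n
    induction n with
    | zero =>
      intro i
      exact sub_mem (hT _ i) (hT _ i)
    | succ n ih =>
      intro i
      rw [hW, hW n, sub_sub_sub_cancel_left]
      refine substHom_sub_mem_succ _ _ (fun j => ?_) (hv i)
      rw [← neg_sub]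
      exact neg_mem (ih j)
  have hcauchy : ∀ n m i, (W (n + m)).1 i - (W n).1 i ∈ orderIdeal σ k (n + 1) := by
    intro n m i
    induction m with
    | zero => rw [add_zero, sub_self]; exact zero_mem _
    | succ m ih =>
      rw [← sub_add_sub_cancel]
      exact add_mem (orderIdeal_le (by omega) (hstep (n + m) i)) ih
  -- The limit: a coefficient of degree `n` no longer changes from stage `n` on.
  let w : σ → MvPowerSeries σ k := fun i e => MvPowerSeries.coeff e ((W e.degree).1 i)
  have hwcoeff : ∀ i e, MvPowerSeries.coeff e (w i) = MvPowerSeries.coeff e ((W e.degree).1 i) :=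
    fun _ _ => rfl
  have hlim : ∀ n i, w i - (W n).1 i ∈ orderIdeal σ k (n + 1) := by
    intro n i
    rw [mem_orderIdeal]
    intro e he
    obtain ⟨m, rfl⟩ := Nat.exists_eq_add_of_le (Nat.lt_succ_iff.1 he)
    have h := mem_orderIdeal.1 (hcauchy e.degree m i) e (Nat.lt_succ_self _)
    rw [map_sub, hwcoeff, ← neg_sub, ← map_sub, h, neg_zero]
  have hw2 : ∀ i, w i - MvPowerSeries.X i ∈ orderIdeal σ k 2 := by
    intro i
    rw [← sub_add_sub_cancel]
    exact add_mem (hlim 1 i) ((W 1).2 i)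
  have hw1 : ∀ i, w i ∈ orderIdeal σ k 1 := fun i => mem_orderIdeal_one_of_sub_X (hw2 i)
  refine ⟨w, hw1, hw2, fun i => eq_of_sub_mem_orderIdeal fun n => ?_⟩
  have e : substHom w hw1 (v i) - MvPowerSeries.X i =
      (w i - (W (n + 1)).1 i) + (substHom w hw1 (v i - MvPowerSeries.X i) -
        substHom (W n).1 (hT _) (v i - MvPowerSeries.X i)) := by
    rw [hW, map_sub (substHom w hw1), substHom_X]
    ring
  rw [e]
  exact add_mem (orderIdeal_le (by omega) (hlim (n + 1) i)) (orderIdeal_le (by omega)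
    (substHom_sub_mem_succ _ _ (hlim n) (hv i)))

theorem substHom_comp_eq_id {v w : σ → MvPowerSeries σ k} (hv : ∀ i, v i ∈ orderIdeal σ k 1)
    (hw : ∀ i, w i ∈ orderIdeal σ k 1) (h : ∀ i, substHom w hw (v i) = MvPowerSeries.X i)
    (f : MvPowerSeries σ k) : substHom w hw (substHom v hv f) = f := by
  have key : ((substHom w hw).comp (substHom v hv)).toRingHom = RingHom.id _ := by
    refine ringHom_eq_of_X (fun c => ?_) (fun i => ?_) fun i => ?_
    · exact algHom_C _ c
    · change substHom w hw (substHom v hv (MvPowerSeries.X i)) ∈ _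
      rw [substHom_X, h]
      exact X_mem_orderIdeal i
    · change substHom w hw (substHom v hv (MvPowerSeries.X i)) = _
      rw [substHom_X, h]
      rfl
  exact RingHom.congr_fun key f

/-- A formal inverse function theorem. -/
theorem exists_algEquiv_X {v : σ → MvPowerSeries σ k}
    (hv : ∀ i, v i - MvPowerSeries.X i ∈ orderIdeal σ k 2) :
    ∃ φ : MvPowerSeries σ k ≃ₐ[k] MvPowerSeries σ k, ∀ i, φ (MvPowerSeries.X i) = v i := by
  have hv1 : ∀ i, v i ∈ orderIdeal σ k 1 := fun i => mem_orderIdeal_one_of_sub_X (hv i)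
  obtain ⟨w, hw1, hw2, hwv⟩ := exists_substHom_eq_X hv
  -- The inverse `w` is itself tangent to the identity, so its substitution also has a left inverse
  -- and is injective; this gives surjectivity for `v`.
  obtain ⟨w', hw1', -, hww'⟩ := exists_substHom_eq_X hw2
  have h1 := substHom_comp_eq_id hv1 hw1 hwv
  have h2 := substHom_comp_eq_id hw1 hw1' hww'
  refine ⟨AlgEquiv.ofBijective (substHom v hv1) ⟨Function.LeftInverse.injective h1, fun f =>
    ⟨substHom w hw1 f, (Function.LeftInverse.injective h2) (h1 _)⟩⟩, substHom_X v hv1⟩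

end InverseFunction

/-! ### Representations given by matrices -/

section MatrixRep

variable {k : Type u} {H : Type v} [Field k] [CommRing H] [HopfAlgebra k H]
  {ι : Type w} [Fintype ι] [DecidableEq ι]

theorem IsComatrix.mul_map_antipode {M : Matrix ι ι H} (hM : IsComatrix k M) :
    M * M.map (HopfAlgebra.antipode k) = 1 := by
  have h := hM.map_mul (toConv (AlgHom.id k H)) (pointInv (toConv (AlgHom.id k H)))
  rw [mul_pointInv, hM.map_one] at h
  exact h.symm

/-- The contragredient comatrix. -/
theorem IsComatrix.antipode_transpose {M : Matrix ι ι H} (hM : IsComatrix k M) :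
    IsComatrix k (M.map (HopfAlgebra.antipode k)).transpose where
  counit i j := by
    simp [hM.counit, Matrix.one_apply, eq_comm]
  comul := by
    let inl : H →ₐ[k] H ⊗[k] H := Algebra.TensorProduct.includeLeft
    let inr : H →ₐ[k] H ⊗[k] H := Algebra.TensorProduct.includeRight
    let Δ : H →ₐ[k] H ⊗[k] H := Bialgebra.comulAlgHom k H
    have h1 : M.map Δ = M.map inl * M.map inr := by
      ext i j
      simp [Matrix.mul_apply, Δ, inl, inr, hM.comul]
    have hinv : ∀ f : H →ₐ[k] H ⊗[k] H,
        M.map f * (M.map (HopfAlgebra.antipode k)).map f = 1 := fun f => by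
      have h := congrArg (fun A : Matrix ι ι H => A.map f) hM.mul_map_antipode
      simpa only [Matrix.map_mul, Matrix.map_one f (_root_.map_zero f) (_root_.map_one f)] using h
    -- Inverting `M(g g') = M(g) M(g')` reverses the factors; the transposition restores their
    -- order.
    have h2 : (M.map (HopfAlgebra.antipode k)).map Δ =
        (M.map (HopfAlgebra.antipode k)).map inr * (M.map (HopfAlgebra.antipode k)).map inl := by
      have h3 : M.map Δ * ((M.map (HopfAlgebra.antipode k)).map inr *
          (M.map (HopfAlgebra.antipode k)).map inl) = 1 := by
        rw [h1, Matrix.mul_assoc, ← Matrix.mul_assoc (M.map inr), hinv, Matrix.one_mul, hinv]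
      have h4 := mul_eq_one_comm.1 (hinv Δ)
      exact left_inv_eq_right_inv h4 h3
    intro i j
    have h := congrFun (congrFun h2 j) i
    simpa [Matrix.mul_apply, Δ, inl, inr] using h

/-- The representation on `k^ι` given by a comatrix. -/
noncomputable def IsComatrix.rep {N : Matrix ι ι H} (hN : IsComatrix k N) :
    Rep k H (ι → k) where
  coact := (Pi.basisFun k ι).constr k fun j => ∑ i, Pi.single i (1 : k) ⊗ₜ N i j
  counit_coact := by
    refine (Pi.basisFun k ι).ext fun j => ?_
    rw [LinearMap.comp_apply, LinearMap.comp_apply, Module.Basis.constr_basis]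
    simp only [map_sum, LinearMap.lTensor_tmul, LinearEquiv.coe_coe, TensorProduct.rid_tmul,
      hN.counit, LinearMap.id_apply, Pi.basisFun_apply, Matrix.one_apply, ite_smul, one_smul,
      zero_smul, Finset.sum_ite_eq', Finset.mem_univ, if_true]
  coassoc := by
    have hb : ∀ j, (Pi.basisFun k ι).constr k (fun j => ∑ i, Pi.single i (1 : k) ⊗ₜ[k] N i j)
        (Pi.single j 1) = ∑ i, Pi.single i (1 : k) ⊗ₜ[k] N i j := fun j => by
      rw [← Pi.basisFun_apply, Module.Basis.constr_basis]
    refine (Pi.basisFun k ι).ext fun j => ?_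
    simp only [LinearMap.comp_apply, Pi.basisFun_apply, hb, map_sum, LinearMap.lTensor_tmul,
      LinearMap.rTensor_tmul, LinearEquiv.coe_coe, TensorProduct.sum_tmul,
      TensorProduct.assoc_tmul, hN.comul, TensorProduct.tmul_sum]
    exact Finset.sum_comm

theorem IsComatrix.rep_actHom {N : Matrix ι ι H} (hN : IsComatrix k N)
    (x : WithConv (H →ₗ[k] k)) (v : ι → k) :
    hN.rep.actHom x v = (N.map x.ofConv).mulVec v := by
  have h : hN.rep.actHom x = Matrix.mulVecLin (N.map x.ofConv) := by
    refine (Pi.basisFun k ι).ext fun j => ?_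
    rw [Rep.actHom_apply, Rep.act_apply]
    change TensorProduct.rid k _ (x.ofConv.lTensor _ ((Pi.basisFun k ι).constr k _ _)) = _
    rw [Module.Basis.constr_basis]
    ext i
    simp [Pi.single_apply]
  rw [h, Matrix.mulVecLin_apply]

/-- If `G` is linearly reductive, then row vectors are completely reducible as well. -/
theorem IsLinearlyReductive.exists_isCompl [Module.Finite k H] {n : Type} [Fintype n]
    [DecidableEq n] (h : IsLinearlyReductive k H) {M : Matrix n n H} (hM : IsComatrix k M)
    (P : Submodule k (n → k))
    (hP : ∀ x : H →ₗ[k] k, ∀ v ∈ P, Matrix.vecMul v (M.map x) ∈ P) :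
    ∃ Q : Submodule k (n → k),
      (∀ x : H →ₗ[k] k, ∀ v ∈ Q, Matrix.vecMul v (M.map x) ∈ Q) ∧ IsCompl P Q := by
  have hact : ∀ (x : H →ₗ[k] k) v, hM.antipode_transpose.rep.actHom (toConv x) v =
      Matrix.vecMul v (M.map (x ∘ₗ HopfAlgebra.antipode k)) := by
    intro x v
    rw [IsComatrix.rep_actHom, Matrix.transpose_map, Matrix.mulVec_transpose]
    rfl
  -- The antipode is an involution, so every functional has the form `x ∘ S`. Hence the stable
  -- spaces of row vectors are exactly the subrepresentations of the contragredient.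
  have hSS : ∀ x : H →ₗ[k] k,
      (x ∘ₗ HopfAlgebra.antipode k) ∘ₗ HopfAlgebra.antipode k = x := by
    intro x
    ext a
    have h1 : pointInv (pointInv (toConv (AlgHom.id k H))) = toConv (AlgHom.id k H) := by
      have h2 := pointInv_mul (pointInv (toConv (AlgHom.id k H)))
      calc _ = pointInv (pointInv (toConv (AlgHom.id k H))) *
            (pointInv (toConv (AlgHom.id k H)) * toConv (AlgHom.id k H)) := by
              rw [pointInv_mul, mul_one]
        _ = _ := by rw [← mul_assoc, h2, one_mul]
    exact congrArg x (DFunLike.congr_fun (congrArg WithConv.ofConv h1) a)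
  obtain ⟨Q, hQ, hPQ⟩ := h _ hM.antipode_transpose.rep P ((Rep.isSubrep_iff _ _).2 fun x v hv =>
    (hact x.ofConv v).symm ▸ hP _ v hv)
  refine ⟨Q, fun x v hv => ?_, hPQ⟩
  rw [← hSS x, ← hact]
  exact (Rep.isSubrep_iff _ _).1 hQ _ v hv

end MatrixRep

/-! ### Matrix coefficients of coactions -/

section Coefficients

variable {k : Type u} {H : Type v} {A : Type w} [Field k] [CommRing H] [HopfAlgebra k H]
  [CommRing A] [Algebra k A]

theorem eq_of_sum_basis_tmul_eq {ι N : Type*} [Fintype ι] [AddCommGroup N] [Module k N]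
    (b : Module.Basis ι k H) {x y : ι → N} (h : ∑ i, b i ⊗ₜ[k] x i = ∑ i, b i ⊗ₜ[k] y i) :
    x = y := by
  classical
  ext1 i
  have h1 := congrArg (fun z => TensorProduct.lid k N ((b.coord i).rTensor N z)) h
  simpa [Finsupp.single_apply] using h1

theorem exists_eq_sum_basis_tmul {ι N : Type*} [Fintype ι] [AddCommGroup N] [Module k N]
    (b : Module.Basis ι k H) (z : H ⊗[k] N) : ∃ x : ι → N, z = ∑ i, b i ⊗ₜ[k] x i := by
  obtain ⟨c, hc⟩ := TensorProduct.eq_repr_basis_left b z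
  refine ⟨c, hc.symm.trans (Finsupp.sum_fintype _ _ fun i => ?_)⟩
  rw [TensorProduct.tmul_zero]

/-- The right regular representation in a basis. -/
theorem exists_regular_comatrix {ι : Type*} [Fintype ι] [DecidableEq ι]
    (b : Module.Basis ι k H) : ∃ R : Matrix ι ι H, IsComatrix k R ∧
      ∀ q, Coalgebra.comul (R := k) (b q) = ∑ p, b p ⊗ₜ[k] R p q := by
  have h := fun q => exists_eq_sum_basis_tmul b (Coalgebra.comul (R := k) (b q))
  choose R' hR using h
  refine ⟨fun p q => R' q p, ⟨fun p q => ?_, fun p q => ?_⟩, hR⟩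
  · have h1 := Coalgebra.coassoc_apply (R := k) (b q)
    rw [hR] at h1
    simp only [map_sum, LinearMap.rTensor_tmul, LinearMap.lTensor_tmul, hR,
      TensorProduct.sum_tmul, TensorProduct.assoc_tmul] at h1
    rw [Finset.sum_comm] at h1
    simp only [← TensorProduct.tmul_sum] at h1
    exact (congrFun (eq_of_sum_basis_tmul_eq b h1) p).symm
  · have h1 := Coalgebra.lTensor_counit_comul (R := k) (b q)
    rw [hR, map_sum] at h1
    simp only [LinearMap.lTensor_tmul] at h1
    have h2 : b q ⊗ₜ[k] (1 : k) = ∑ p, b p ⊗ₜ[k] ((1 : Matrix ι ι k) p q) := by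
      rw [Finset.sum_eq_single q] <;> simp +contextual
    exact congrFun (eq_of_sum_basis_tmul_eq b (h1.trans h2)) p

/-- The coefficients of `coact a` span a subcomodule. -/
theorem Action.coact_coefficient (δ : Action k H A) {ι : Type*} [Fintype ι] [DecidableEq ι]
    (b : Module.Basis ι k H) {R : Matrix ι ι H}
    (hR : ∀ q, Coalgebra.comul (R := k) (b q) = ∑ p, b p ⊗ₜ[k] R p q) {a : A} {c : ι → A}
    (hc : δ.coact a = ∑ q, b q ⊗ₜ[k] c q) (p : ι) :
    δ.coact (c p) = ∑ q, R p q ⊗ₜ[k] c q := by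
  have h1 := δ.coassoc_apply a
  rw [hc] at h1
  simp only [map_sum, Algebra.TensorProduct.map_tmul, Bialgebra.comulAlgHom_apply, hR,
    AlgHom.id_apply, TensorProduct.sum_tmul, Algebra.TensorProduct.assoc_tmul] at h1
  rw [Finset.sum_comm] at h1
  simp only [← TensorProduct.tmul_sum] at h1
  exact (congrFun (eq_of_sum_basis_tmul_eq b h1) p).symm

theorem Action.eq_sum_counit_coefficient (δ : Action k H A) {ι : Type*} [Fintype ι]
    (b : Module.Basis ι k H) {a : A} {c : ι → A} (hc : δ.coact a = ∑ q, b q ⊗ₜ[k] c q) :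
    a = ∑ q, Coalgebra.counit (R := k) (b q) • c q := by
  have h1 := δ.counit_apply a
  rw [hc] at h1
  simpa using h1.symm

/-- The operator on `A` given by a functional on `H`. -/
noncomputable def Action.operator (δ : Action k H A) (x : H →ₗ[k] k) : A →ₗ[k] A :=
  (TensorProduct.lid k A).toLinearMap ∘ₗ x.rTensor A ∘ₗ δ.coact.toLinearMap

theorem Action.operator_apply (δ : Action k H A) (x : H →ₗ[k] k) (a : A) :
    δ.operator x a = TensorProduct.lid k A (x.rTensor A (δ.coact a)) := rfl

end Coefficients

/-! ### Linearization -/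

section Linearization

variable {k : Type u} {H : Type v} [Field k] [CommRing H] [HopfAlgebra k H] {d : ℕ}

theorem coeff_lid_rTensor (x : H →ₗ[k] k) (z : H ⊗[k] MvPowerSeries (Fin d) k)
    (e : Fin d →₀ ℕ) : MvPowerSeries.coeff e (TensorProduct.lid k _ (x.rTensor _ z)) =
      x (MvPowerSeries.coeff e (tensorToPowerSeries k H d z)) := by
  induction z with
  | zero => simp
  | tmul h a =>
    rw [tensorToPowerSeries_tmul, MvPowerSeries.coeff_C_mul, MvPowerSeries.coeff_map, mul_comm,
      ← Algebra.smul_def, map_smul]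
    simp [mul_comm]
  | add y z hy hz => simp only [map_add, hy, hz]

/-- The action as a homomorphism `k[[u]] → H[[u]]`. -/
noncomputable def Action.series (δ : Action k H (MvPowerSeries (Fin d) k)) :
    MvPowerSeries (Fin d) k →ₐ[k] MvPowerSeries (Fin d) H :=
  (tensorToPowerSeries k H d).comp δ.coact

theorem Action.coeff_operator (δ : Action k H (MvPowerSeries (Fin d) k)) (x : H →ₗ[k] k)
    (a : MvPowerSeries (Fin d) k) (e : Fin d →₀ ℕ) :
    MvPowerSeries.coeff e (δ.operator x a) = x (MvPowerSeries.coeff e (δ.series a)) :=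
  coeff_lid_rTensor x _ e

theorem Action.IsFixedPoint.constantCoeff_series {δ : Action k H (MvPowerSeries (Fin d) k)}
    (hδ : δ.IsFixedPoint (Action.closedPt k d)) (a : MvPowerSeries (Fin d) k) :
    MvPowerSeries.constantCoeff (δ.series a) =
      algebraMap k H (MvPowerSeries.constantCoeff a) := by
  have h1 : ∀ z : H ⊗[k] MvPowerSeries (Fin d) k,
      MvPowerSeries.constantCoeff (tensorToPowerSeries k H d z) =
        TensorProduct.rid k H (Algebra.TensorProduct.map (AlgHom.id k H)
          (Action.closedPt k d) z) := by
    intro z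
    induction z with
    | zero => simp
    | tmul h a =>
      rw [tensorToPowerSeries_tmul, map_mul, MvPowerSeries.constantCoeff_C,
        MvPowerSeries.constantCoeff_map, Algebra.TensorProduct.map_tmul, TensorProduct.rid_tmul,
        Algebra.smul_def, mul_comm]
      rfl
    | add y z hy hz => simp only [map_add, hy, hz]
  refine (h1 _).trans ?_
  have h2 := DFunLike.congr_fun hδ a
  refine (congrArg (TensorProduct.rid k H) h2).trans ?_
  rw [AlgHom.comp_apply, Algebra.TensorProduct.includeRight_apply, TensorProduct.rid_tmul,
    Algebra.smul_def, mul_one]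
  rfl

theorem Action.IsFixedPoint.series_mem_orderIdeal {δ : Action k H (MvPowerSeries (Fin d) k)}
    (hδ : δ.IsFixedPoint (Action.closedPt k d)) {n : ℕ} {a : MvPowerSeries (Fin d) k}
    (ha : a ∈ orderIdeal (Fin d) k n) : δ.series a ∈ orderIdeal (Fin d) H n :=
  map_mem_orderIdeal (θ := δ.series.toRingHom) (fun i => mem_orderIdeal_one.2
    ((hδ.constantCoeff_series _).trans (by simp))) ha

theorem Action.IsFixedPoint.operator_mem_orderIdeal {δ : Action k H (MvPowerSeries (Fin d) k)}
    (hδ : δ.IsFixedPoint (Action.closedPt k d)) (x : H →ₗ[k] k) {n : ℕ}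
    {a : MvPowerSeries (Fin d) k} (ha : a ∈ orderIdeal (Fin d) k n) :
    δ.operator x a ∈ orderIdeal (Fin d) k n := by
  rw [mem_orderIdeal]
  intro e he
  rw [δ.coeff_operator, mem_orderIdeal.1 (hδ.series_mem_orderIdeal ha) e he, map_zero]

/-- The coefficients of all coordinate functions form an equivariant image of a matrix
representation. -/
theorem Action.exists_comatrix_cover [Module.Finite k H]
    (δ : Action k H (MvPowerSeries (Fin d) k)) :
    ∃ (n : ℕ) (M : Matrix (Fin d × Fin n) (Fin d × Fin n) H)
      (π : (Fin d × Fin n → k) →ₗ[k] MvPowerSeries (Fin d) k), IsComatrix k M ∧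
      (∀ x v, δ.operator x (π v) = π (Matrix.vecMul v (M.map x))) ∧
      (∀ i, MvPowerSeries.X i ∈ LinearMap.range π) ∧
      ∀ v, ∃ y : Fin d → H →ₗ[k] k, π v = ∑ i, δ.operator (y i) (MvPowerSeries.X i) := by
  let b := Module.finBasis k H
  obtain ⟨R, hR, hbR⟩ := exists_regular_comatrix b
  have h := fun i => exists_eq_sum_basis_tmul b (δ.coact (MvPowerSeries.X i))
  choose c hc using h
  -- The coefficients `c i p` may be linearly dependent, so their span is presented as the image
  -- under `π` of `d` copies of the regular representation, acting on row vectors.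
  let M : Matrix (Fin d × Fin (Module.finrank k H)) (Fin d × Fin (Module.finrank k H)) H :=
    fun p q => if p.1 = q.1 then R p.2 q.2 else 0
  let π : (Fin d × Fin (Module.finrank k H) → k) →ₗ[k] MvPowerSeries (Fin d) k :=
    Fintype.linearCombination k fun p => c p.1 p.2
  have hπ : ∀ v, π v = ∑ i, ∑ p, v (i, p) • c i p := fun v => by
    rw [← Fintype.sum_prod_type']
    rfl
  have hop : ∀ x i p, δ.operator x (c i p) = ∑ q, x (R p q) • c i q := by
    intro x i p
    rw [operator_apply, δ.coact_coefficient b hbR (hc i) p]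
    simp
  refine ⟨_, M, π, ⟨?_, ?_⟩, ?_, ?_, ?_⟩
  · rintro ⟨i, p⟩ ⟨j, q⟩
    rw [Fintype.sum_prod_type]
    by_cases hij : i = j
    · subst hij
      rw [Finset.sum_eq_single i]
      · simp [M, hR.comul]
      · intro l _ hl
        simp [M, hl.symm]
      · simp
    · simp only [M, if_neg hij, map_zero]
      refine (Finset.sum_eq_zero fun l _ => Finset.sum_eq_zero fun s _ => ?_).symm
      by_cases hil : i = l
      · subst hil; simp [hij]
      · simp [hil]
  · rintro ⟨i, p⟩ ⟨j, q⟩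
    by_cases hij : i = j
    · subst hij
      simp [M, hR.counit, Matrix.one_apply]
    · simp [M, hij]
  · intro x v
    rw [hπ, hπ, map_sum]
    refine Finset.sum_congr rfl fun i _ => ?_
    simp only [map_sum, map_smul, hop, Finset.smul_sum, smul_smul]
    rw [Finset.sum_comm]
    refine Finset.sum_congr rfl fun q _ => ?_
    rw [← Finset.sum_smul]
    congr 1
    have hMx : ∀ l p, (M.map x) (l, p) (i, q) = if l = i then x (R p q) else 0 := fun l p => by
      rw [Matrix.map_apply, ← map_zero x, ← apply_ite]
    rw [Matrix.vecMul, dotProduct, Fintype.sum_prod_type, Finset.sum_eq_single i]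
    · simp only [hMx, if_true]
    · intro l _ hl
      simp only [hMx, if_neg hl, mul_zero, Finset.sum_const_zero]
    · simp
  · intro i
    refine ⟨fun p => if p.1 = i then Coalgebra.counit (R := k) (b p.2) else 0, ?_⟩
    rw [hπ, Finset.sum_eq_single i]
    · simpa using (δ.eq_sum_counit_coefficient b (hc i)).symm
    · intro l _ hl
      simp [hl]
    · simp
  · intro v
    refine ⟨fun i => b.constr k fun p => v (i, p), ?_⟩
    rw [hπ]
    refine Finset.sum_congr rfl fun i _ => ?_
    rw [operator_apply, hc i]
    simp

/-- Coordinates whose span is stable under a linearly reductive group. -/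
theorem Action.IsFixedPoint.exists_stable_coordinates [Module.Finite k H]
    {δ : Action k H (MvPowerSeries (Fin d) k)} (hδ : δ.IsFixedPoint (Action.closedPt k d))
    (hred : IsLinearlyReductive k H) :
    ∃ v : Fin d → MvPowerSeries (Fin d) k,
      (∀ i, v i - MvPowerSeries.X i ∈ orderIdeal (Fin d) k 2) ∧
      ∀ x i, δ.operator x (v i) = ∑ j, MvPowerSeries.coeff (Finsupp.single j 1)
        (δ.operator x (v i)) • v j := by
  obtain ⟨n, M, π, hM, hπ, hX, hy⟩ := δ.exists_comatrix_cover
  have hπ1 : ∀ v, π v ∈ orderIdeal (Fin d) k 1 := fun v => by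
    obtain ⟨y, hy⟩ := hy v
    rw [hy]
    exact sum_mem fun i _ => hδ.operator_mem_orderIdeal _ (X_mem_orderIdeal i)
  -- The linear part, a map to the cotangent space. Its kernel is stable because operators preserve
  -- the order of vanishing; the complement `Q` splits it equivariantly.
  let lin : (Fin d × Fin n → k) →ₗ[k] (Fin d → k) :=
    LinearMap.pi fun j => MvPowerSeries.coeff (R := k) (Finsupp.single j 1) ∘ₗ π
  have hlin : ∀ v j, lin v j = MvPowerSeries.coeff (Finsupp.single j 1) (π v) := fun _ _ => rfl
  have hker : ∀ v, lin v = 0 ↔ π v ∈ orderIdeal (Fin d) k 2 := fun v => by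
    rw [mem_orderIdeal_two, and_iff_right (mem_orderIdeal_one.1 (hπ1 v)), funext_iff]
    rfl
  obtain ⟨Q, hQ, hPQ⟩ := hred.exists_isCompl hM (LinearMap.ker lin) fun x v hv => by
    rw [LinearMap.mem_ker, hker] at hv ⊢
    rw [← hπ]
    exact hδ.operator_mem_orderIdeal x hv
  have hsurj : ∀ i, ∃ p ∈ Q, lin p = Pi.single i 1 := by
    intro i
    obtain ⟨q, hq⟩ := hX i
    obtain ⟨a, ha, p, hp, rfl⟩ := Submodule.mem_sup.1 (hPQ.sup_eq_top ▸ Submodule.mem_top (x := q))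
    refine ⟨p, hp, ?_⟩
    have h1 : lin (a + p) = Pi.single i 1 := by
      ext j
      rw [hlin, hq, MvPowerSeries.coeff_X, Pi.single_apply]
      simp [Finsupp.single_left_inj]
    rwa [map_add, LinearMap.mem_ker.1 ha, zero_add] at h1
  choose p hpQ hp using hsurj
  refine ⟨fun i => π (p i), fun i => ?_, fun x i => ?_⟩
  · rw [mem_orderIdeal_two]
    refine ⟨mem_orderIdeal_one.1 (sub_mem (hπ1 _) (X_mem_orderIdeal i)), fun j => ?_⟩
    rw [map_sub, ← hlin, hp, MvPowerSeries.coeff_X, Pi.single_apply]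
    simp [Finsupp.single_left_inj]
  · have h1 := hQ x _ (hpQ i)
    set q := Matrix.vecMul (p i) (M.map x)
    -- The map `lin` is injective on `Q`, so an element of `Q` is determined by its linear part.
    have h2 : q - ∑ j, lin q j • p j ∈ LinearMap.ker lin ⊓ Q := by
      refine ⟨?_, sub_mem h1 (sum_mem fun j _ => Q.smul_mem _ (hpQ j))⟩
      rw [SetLike.mem_coe, LinearMap.mem_ker, map_sub, map_sum, sub_eq_zero]
      simp only [map_smul, hp]
      exact pi_eq_sum_univ' (lin q)
    rw [hPQ.inf_eq_bot, Submodule.mem_bot, sub_eq_zero] at h2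
    rw [hπ]
    change π q = ∑ j, lin q j • π (p j)
    conv_lhs => rw [h2]
    simp only [map_sum, map_smul]

theorem eq_of_lid_rTensor_eq [Module.Finite k H] {A : Type*} [AddCommGroup A] [Module k A]
    {y z : H ⊗[k] A} (h : ∀ x : H →ₗ[k] k,
      TensorProduct.lid k A (x.rTensor A y) = TensorProduct.lid k A (x.rTensor A z)) : y = z := by
  classical
  refine (TensorProduct.equivFinsuppOfBasisLeft (Module.finBasis k H)).injective
    (Finsupp.ext fun i => ?_)
  rw [TensorProduct.equivFinsuppOfBasisLeft_apply, TensorProduct.equivFinsuppOfBasisLeft_apply, h]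

theorem sum_tmul_injective_of_coordinates {v : Fin d → MvPowerSeries (Fin d) k}
    (hv : ∀ i, v i - MvPowerSeries.X i ∈ orderIdeal (Fin d) k 2) {N : Type*} [AddCommGroup N]
    [Module k N] {a b : Fin d → N} (h : ∑ j, a j ⊗ₜ[k] v j = ∑ j, b j ⊗ₜ[k] v j) : a = b := by
  have hc : ∀ i j, MvPowerSeries.coeff (Finsupp.single i 1) (v j) =
      (Pi.single j 1 : Fin d → k) i := fun i j => by
    have h1 := (mem_orderIdeal_two.1 (hv j)).2 i
    rw [map_sub, sub_eq_zero] at h1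
    rw [h1, MvPowerSeries.coeff_X, Pi.single_apply]
    simp [Finsupp.single_left_inj]
  ext1 i
  have h2 := congrArg (fun z => TensorProduct.rid k N
    ((MvPowerSeries.coeff (R := k) (Finsupp.single i 1)).lTensor N z)) h
  simpa [hc, Pi.single_apply] using h2

/-- An action of a linearly reductive group with a fixed closed point is linearizable. -/
theorem Action.IsFixedPoint.isLinearizable [Module.Finite k H]
    {δ : Action k H (MvPowerSeries (Fin d) k)} (hδ : δ.IsFixedPoint (Action.closedPt k d))
    (hred : IsLinearlyReductive k H) : δ.IsLinearizable := by
  obtain ⟨v, hv, hstable⟩ := hδ.exists_stable_coordinates hred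
  obtain ⟨φ, hφ⟩ := exists_algEquiv_X hv
  -- The linear part of the action. The `v j` have independent linear parts, so the coaction laws
  -- can be read off from their coefficients.
  let M : Matrix (Fin d) (Fin d) H := fun i j =>
    MvPowerSeries.coeff (Finsupp.single j 1) (δ.series (v i))
  have hM : ∀ i, δ.coact (v i) = ∑ j, M i j ⊗ₜ[k] v j := by
    intro i
    refine eq_of_lid_rTensor_eq fun x => ?_
    change δ.operator x (v i) = _
    rw [hstable]
    simp [δ.coeff_operator, M]
  have hcomatrix : IsComatrix k M := by
    refine ⟨fun i j => ?_, fun i j => ?_⟩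
    · have h1 := δ.coassoc_apply (v i)
      rw [hM] at h1
      simp only [map_sum, Algebra.TensorProduct.map_tmul, Bialgebra.comulAlgHom_apply,
        AlgHom.id_apply, hM, TensorProduct.tmul_sum] at h1
      have h2 := congrArg (TensorProduct.assoc k H H (MvPowerSeries (Fin d) k)).symm h1
      have h3 : ∑ j, Coalgebra.comul (R := k) (M i j) ⊗ₜ[k] v j =
          ∑ j, (∑ l, M i l ⊗ₜ[k] M l j) ⊗ₜ[k] v j := by
        rw [map_sum, map_sum] at h2
        simp only [map_sum, TensorProduct.assoc_symm_tmul] at h2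
        simp only [TensorProduct.sum_tmul]
        rw [Finset.sum_comm (s := Finset.univ) (t := Finset.univ) (f := fun j l =>
          (M i l ⊗ₜ[k] M l j) ⊗ₜ[k] v j), ← h2]
        exact Finset.sum_congr rfl fun j _ =>
          ((TensorProduct.assoc k H H (MvPowerSeries (Fin d) k)).symm_apply_apply _).symm
      exact congrFun (sum_tmul_injective_of_coordinates hv h3) j
    · have h1 := δ.counit_apply (v i)
      rw [hM] at h1
      have h2 : ∑ j, Coalgebra.counit (R := k) (M i j) ⊗ₜ[k] v j =
          ∑ j, ((1 : Matrix (Fin d) (Fin d) k) i j) ⊗ₜ[k] v j := by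
        apply (TensorProduct.lid k _).injective
        simp only [map_sum, TensorProduct.lid_tmul]
        simpa [Matrix.one_apply] using h1
      exact congrFun (sum_tmul_injective_of_coordinates hv h2) j
  let g : Matrix.GeneralLinearGroup (Fin d) H :=
    ⟨M, M.map (HopfAlgebra.antipode k), hcomatrix.mul_map_antipode,
      mul_eq_one_comm.1 hcomatrix.mul_map_antipode⟩
  refine ⟨φ.symm, g, hcomatrix.comul, fun f => ?_⟩
  have hX : ∀ i, (δ.transport φ.symm).series (MvPowerSeries.X i) =
      ∑ j, MvPowerSeries.C (M i j) * MvPowerSeries.X j := by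
    intro i
    change tensorToPowerSeries k H d (Algebra.TensorProduct.map (AlgHom.id k H)
      φ.symm.toAlgHom (δ.coact (φ (MvPowerSeries.X i)))) = _
    rw [hφ, hM, map_sum, map_sum]
    refine Finset.sum_congr rfl fun j _ => ?_
    rw [Algebra.TensorProduct.map_tmul, tensorToPowerSeries_tmul, ← hφ j]
    change _ * MvPowerSeries.map _ (φ.symm (φ _)) = _
    rw [φ.symm_apply_apply, MvPowerSeries.map_X]
    rfl
  let ψ : MvPowerSeries (Fin d) k →ₐ[k] MvPowerSeries (Fin d) H :=
    MvPowerSeries.substAlgHom (hasSubst_linear M)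
  -- Both homomorphisms send variables to series without constant term, so agreement on variables
  -- suffices.
  have key : (δ.transport φ.symm).series.toRingHom = ψ.toRingHom := by
    refine ringHom_eq_of_X (fun c => (algHom_C _ c).trans (algHom_C _ c).symm)
      (fun i => ?_) fun i => ?_
    · change (δ.transport φ.symm).series (MvPowerSeries.X i) ∈ _
      rw [hX]
      exact sum_mem fun j _ => Ideal.mul_mem_left _ _ (X_mem_orderIdeal j)
    · exact (hX i).trans (MvPowerSeries.substAlgHom_X (hasSubst_linear M) i).symm
  refine (RingHom.congr_fun key f).trans ?_
  exact congrFun (MvPowerSeries.coe_substAlgHom (hasSubst_linear M)) f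

end Linearization

end FinGroupScheme

theorem proposition5p4 {k : Type*} [Field k] [IsAlgClosed k]
    {H : Type*} [CommRing H] [HopfAlgebra k H] [Module.Finite k H]
    {d : ℕ} (hd : 2 ≤ d)
    (δ : FinGroupScheme.Action k H (MvPowerSeries (Fin d) k)) (hδ : δ.IsVerySmall) :
    δ.IsLinearizable ↔ FinGroupScheme.IsLinearlyReductive k H := by
  refine ⟨?_, hδ.fixed.isLinearizable⟩
  rintro ⟨φ, M, hM, hlin⟩
  -- Free orbits constrain `G` only if a nonzero vector exists.
  have : Nonempty (Fin d) := ⟨⟨0, by omega⟩⟩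
  exact (FinGroupScheme.hasFreeOrbits_of_transport hδ.free φ hM.isComatrix
    hlin).isLinearlyReductive hM.isComatrix
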